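/- Let $X$ be a finite set, let $U=\mathbb{Z}[X]$ be the polynomial ring in the variables $X$, let $A$ be a free $U$-module, and let $p$ be a prime. Let $L(A)$ be the free Lie ring on the abelian group $A$. For $c\ge 1$ let $L^c(A)\subseteq L(A)$ be the span of all left-normed Lie products $[a_1,\dots,a_c]=[\dots[[a_1,a_2],a_3],\dots,a_c]$ with $a_i\in A$, and let $M^c(A)=L^c(A)/(L^c(A)\cap L(A)'')$, where $L(A)''$ is the second derived ideal of $L(A)$. The ring $U$ acts on $L(A)$, $L^c(A)$ and $M^c(A)$ by the derivation action: each $x\in X$ acts on $L(A)$ as the unique derivation extending its action on $A$, so that $$[a_1,\dots,a_c]\,x=\sum_{i=1}^c[a_1,\dots,a_ix,\dots,a_c].$$ Regard $\mathbb{Z}$ as the trivial $U$-module, on which each $x\in X$ acts as $0$. Then there is exactly one additive map $\theta_p:M^p(A)\to L^p(A)$ such that, for all $a_1,\dots,a_p\in A$, $$p\,\theta_p([a_1,\dots,a_p])=\sum_{\sigma}[a_1,a_{\sigma(2)},\dots,a_{\sigma(p)}]-\sum_{\tau}[a_2,a_{\tau(1)},a_{\tau(3)},\dots,a_{\tau(p)}],$$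 where $\sigma$ runs over all permutations of $\{2,3,\dots,p\}$ and $\tau$ over all permutations of $\{1,3,\dots,p\}$; this map is a homomorphism of $U$-modules. Moreover, the torsion subgroups of the abelian groups $L^p(A)\otimes_U\mathbb{Z}$ and $M^p(A)\otimes_U\mathbb{Z}$ are isomorphic: the homomorphism $\theta_p\otimes 1:M^p(A)\otimes_U\mathbb{Z}\to L^p(A)\otimes_U\mathbb{Z}$ restricts to an isomorphism from the torsion subgroup of $M^p(A)\otimes_U\mathbb{Z}$ onto the torsion subgroup of $L^p(A)\otimes_U\mathbb{Z}$. -/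

import Mathlib

open scoped TensorProduct

noncomputable section

/-! ### The free Lie ring on an abelian group -/

/-- The Lie ideal of the free Lie ring on the set `A` that forces `A → L(A)` to be additive. -/
def FreeLieRing.additivityIdeal (A : Type*) [AddCommGroup A] :
    LieIdeal ℤ (FreeLieAlgebra ℤ A) :=
  LieSubmodule.lieSpan ℤ (FreeLieAlgebra ℤ A)
    {u | ∃ a b : A, u = FreeLieAlgebra.of ℤ (a + b) - FreeLieAlgebra.of ℤ a
      - FreeLieAlgebra.of ℤ b}

/-- The free Lie ring `L(A)` on the abelian group `A`: additive maps from `A` to a Lie ring extend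
uniquely to Lie ring homomorphisms from `L(A)`, see `FreeLieRing.lift`. -/
def FreeLieRing (A : Type*) [AddCommGroup A] : Type _ :=
  FreeLieAlgebra ℤ A ⧸ FreeLieRing.additivityIdeal A

namespace FreeLieRing

instance (A : Type*) [AddCommGroup A] : LieRing (FreeLieRing A) :=
  inferInstanceAs (LieRing (FreeLieAlgebra ℤ A ⧸ FreeLieRing.additivityIdeal A))

/-- The quotient map from the free Lie ring on the set `A` onto `L(A)`. -/
def proj (A : Type*) [AddCommGroup A] : FreeLieAlgebra ℤ A →ₗ⁅ℤ⁆ FreeLieRing A where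
  toFun u := (LieSubmodule.Quotient.mk u : FreeLieAlgebra ℤ A ⧸ FreeLieRing.additivityIdeal A)
  map_add' _ _ := rfl
  map_smul' n u := by
    let f : FreeLieAlgebra ℤ A →+ FreeLieRing A :=
      AddMonoidHom.mk' (fun u => (LieSubmodule.Quotient.mk u :
        FreeLieAlgebra ℤ A ⧸ FreeLieRing.additivityIdeal A)) (fun _ _ => rfl)
    have h := map_intCast_smul f ℤ ℤ n u
    rw [Int.cast_id] at h
    exact h
  map_lie' := rfl

theorem proj_surjective (A : Type*) [AddCommGroup A] : Function.Surjective (proj A) :=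
  Quot.mk_surjective

theorem proj_eq_zero (A : Type*) [AddCommGroup A] (u : FreeLieAlgebra ℤ A) :
    proj A u = 0 ↔ u ∈ additivityIdeal A :=
  LieSubmodule.Quotient.mk_eq_zero' (N := additivityIdeal A)

/-- The canonical additive map `A → L(A)`. -/
def ι (A : Type*) [AddCommGroup A] : A →+ FreeLieRing A :=
  AddMonoidHom.mk' (fun a => proj A (FreeLieAlgebra.of ℤ a)) (fun a b => by
    have h : proj A (FreeLieAlgebra.of ℤ (a + b) - FreeLieAlgebra.of ℤ a
        - FreeLieAlgebra.of ℤ b) = 0 :=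
      (proj_eq_zero A _).2 (LieSubmodule.subset_lieSpan ⟨a, b, rfl⟩)
    rw [map_sub, map_sub, sub_sub, sub_eq_zero] at h
    exact h)

section UniversalProperty

variable {A : Type*} [AddCommGroup A] {L : Type*} [LieRing L]

theorem ker_lift_le (f : A →+ L) (u : FreeLieAlgebra ℤ A) (hu : u ∈ additivityIdeal A) :
    FreeLieAlgebra.lift ℤ (f : A → L) u = 0 := by
  have h : additivityIdeal A ≤ (FreeLieAlgebra.lift ℤ (f : A → L)).ker := by
    refine LieSubmodule.lieSpan_le.2 ?_
    rintro _ ⟨a, b, rfl⟩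
    refine LieHom.mem_ker.2 ?_
    rw [map_sub, map_sub, FreeLieAlgebra.lift_of_apply, FreeLieAlgebra.lift_of_apply,
      FreeLieAlgebra.lift_of_apply, map_add, add_sub_cancel_left, sub_self]
  exact LieHom.mem_ker.1 (h hu)

/-- The extension of an additive map `A → L` to a Lie ring homomorphism `L(A) → L`. -/
def lift (f : A →+ L) : FreeLieRing A →ₗ⁅ℤ⁆ L where
  toFun := Quotient.lift (fun u => FreeLieAlgebra.lift ℤ (f : A → L) u) (fun u v huv => by
    have h : -u + v ∈ additivityIdeal A := QuotientAddGroup.leftRel_apply.1 huv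
    have h' := ker_lift_le f _ h
    rw [map_add, map_neg, neg_add_eq_zero] at h'
    exact h')
  map_add' x y := by
    obtain ⟨u, rfl⟩ := proj_surjective A x
    obtain ⟨v, rfl⟩ := proj_surjective A y
    exact map_add (FreeLieAlgebra.lift ℤ (f : A → L)) u v
  map_smul' n x := by
    obtain ⟨u, rfl⟩ := proj_surjective A x
    rw [← map_smul]
    exact map_smul (FreeLieAlgebra.lift ℤ (f : A → L)) n u
  map_lie' {x y} := by
    obtain ⟨u, rfl⟩ := proj_surjective A x
    obtain ⟨v, rfl⟩ := proj_surjective A y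
    exact LieHom.map_lie (FreeLieAlgebra.lift ℤ (f : A → L)) u v

@[simp]
theorem lift_ι (f : A →+ L) (a : A) : lift f (ι A a) = f a :=
  FreeLieAlgebra.lift_of_apply (R := ℤ) (f : A → L) a

theorem hom_ext {f g : FreeLieRing A →ₗ⁅ℤ⁆ L} (h : ∀ a, f (ι A a) = g (ι A a)) : f = g := by
  have h' : f.comp (proj A) = g.comp (proj A) := FreeLieAlgebra.hom_ext h
  ext x
  obtain ⟨u, rfl⟩ := proj_surjective A x
  exact LieHom.congr_fun h' u

end UniversalProperty

end FreeLieRing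

/-! ### Extending endomorphisms of `A` to derivations of `L(A)` -/

/-- The Lie ring `L ⊕ εL` with `ε² = 0`, an auxiliary object for constructing derivations. -/
def DualLie (L : Type*) : Type _ := L × L

namespace DualLie

variable {L : Type*} [LieRing L]

instance : AddCommGroup (DualLie L) := inferInstanceAs (AddCommGroup (L × L))

instance : LieRing (DualLie L) where
  bracket x y := (⁅x.1, y.1⁆, ⁅x.1, y.2⁆ + ⁅x.2, y.1⁆)
  add_lie x y z := by
    refine Prod.ext (add_lie x.1 y.1 z.1) ?_
    change ⁅x.1 + y.1, z.2⁆ + ⁅x.2 + y.2, z.1⁆ = (⁅x.1, z.2⁆ + ⁅x.2, z.1⁆)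
      + (⁅y.1, z.2⁆ + ⁅y.2, z.1⁆)
    rw [add_lie, add_lie]; abel
  lie_add x y z := by
    refine Prod.ext (lie_add x.1 y.1 z.1) ?_
    change ⁅x.1, y.2 + z.2⁆ + ⁅x.2, y.1 + z.1⁆ = (⁅x.1, y.2⁆ + ⁅x.2, y.1⁆)
      + (⁅x.1, z.2⁆ + ⁅x.2, z.1⁆)
    rw [lie_add, lie_add]; abel
  lie_self x := by
    refine Prod.ext (lie_self x.1) ?_
    change ⁅x.1, x.2⁆ + ⁅x.2, x.1⁆ = 0
    rw [← lie_skew x.1 x.2, neg_add_cancel]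
  leibniz_lie x y z := by
    refine Prod.ext (leibniz_lie x.1 y.1 z.1) ?_
    change ⁅x.1, ⁅y.1, z.2⁆ + ⁅y.2, z.1⁆⁆ + ⁅x.2, ⁅y.1, z.1⁆⁆ =
      (⁅⁅x.1, y.1⁆, z.2⁆ + ⁅⁅x.1, y.2⁆ + ⁅x.2, y.1⁆, z.1⁆) +
      (⁅y.1, ⁅x.1, z.2⁆ + ⁅x.2, z.1⁆⁆ + ⁅y.2, ⁅x.1, z.1⁆⁆)
    rw [lie_add, lie_add, add_lie, leibniz_lie x.1 y.1 z.2, leibniz_lie x.1 y.2 z.1,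
      leibniz_lie x.2 y.1 z.1]
    abel

/-- The projection of `L ⊕ εL` onto `L`. -/
def fstHom (L : Type*) [LieRing L] : DualLie L →ₗ⁅ℤ⁆ L where
  toFun x := x.1
  map_add' _ _ := rfl
  map_smul' _ _ := rfl
  map_lie' := rfl

end DualLie

namespace FreeLieRing

section Derivation

variable {A : Type*} [AddCommGroup A]

/-- The Lie ring homomorphism `id + εD : L(A) → L(A) ⊕ εL(A)` with `D = d` on `A`. -/
def derHom (d : A →+ A) : FreeLieRing A →ₗ⁅ℤ⁆ DualLie (FreeLieRing A) :=
  lift (AddMonoidHom.mk' (fun a => ((ι A a, ι A (d a)) : FreeLieRing A × FreeLieRing A))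
    (fun a b => Prod.ext (map_add (ι A) a b) ((congrArg (ι A) (map_add d a b)).trans
      (map_add (ι A) (d a) (d b)))))

theorem derHom_ι (d : A →+ A) (a : A) :
    derHom d (ι A a) = ((ι A a, ι A (d a)) : FreeLieRing A × FreeLieRing A) :=
  lift_ι _ a

theorem derHom_fst (d : A →+ A) (u : FreeLieRing A) : (derHom d u).1 = u := by
  have h : (DualLie.fstHom (FreeLieRing A)).comp (derHom d) = LieHom.id := by
    refine hom_ext fun a => ?_
    change (derHom d (ι A a)).1 = ι A a
    rw [derHom_ι]
  exact LieHom.congr_fun h u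

/-- The derivation of `L(A)` that extends the endomorphism `d` of `A`. -/
def der (d : A →+ A) : LieDerivation ℤ (FreeLieRing A) (FreeLieRing A) where
  toFun u := (derHom d u).2
  map_add' u v := by rw [map_add]; rfl
  map_smul' n u := by rw [map_smul]; rfl
  leibniz' u v := by
    change (derHom d ⁅u, v⁆).2 = ⁅u, (derHom d v).2⁆ - ⁅v, (derHom d u).2⁆
    rw [LieHom.map_lie]
    change ⁅(derHom d u).1, (derHom d v).2⁆ + ⁅(derHom d u).2, (derHom d v).1⁆ = _
    rw [derHom_fst, derHom_fst, ← lie_skew v, sub_eq_add_neg, neg_neg]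

@[simp]
theorem der_ι (d : A →+ A) (a : A) : der d (ι A a) = ι A (d a) := by
  change (derHom d (ι A a)).2 = _
  rw [derHom_ι]

theorem lieSpan_range_ι :
    LieSubalgebra.lieSpan ℤ (FreeLieRing A) (Set.range (ι A)) = ⊤ := by
  set S := LieSubalgebra.lieSpan ℤ (FreeLieRing A) (Set.range (ι A)) with hS
  let f : A →+ S := AddMonoidHom.mk' (fun a => ⟨ι A a, LieSubalgebra.subset_lieSpan ⟨a, rfl⟩⟩)
    (fun a b => Subtype.ext (map_add (ι A) a b))
  have h : S.incl.comp (lift f) = LieHom.id := by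
    refine hom_ext fun a => ?_
    change ((lift f (ι A a) : S) : FreeLieRing A) = ι A a
    rw [lift_ι]
    rfl
  refine eq_top_iff.2 fun u _ => ?_
  have hu := LieHom.congr_fun h u
  rw [LieHom.comp_apply, LieHom.id_apply] at hu
  rw [← hu]
  exact (lift f u).2

theorem der_comm (d e : A →+ A) (h : ∀ a, d (e a) = e (d a)) (u : FreeLieRing A) :
    der d (der e u) = der e (der d u) := by
  have h0 : ⁅der d, der e⁆ = (0 : LieDerivation ℤ (FreeLieRing A) (FreeLieRing A)) := by
    refine LieDerivation.ext_of_lieSpan_eq_top _ lieSpan_range_ι ?_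
    rintro _ ⟨a, rfl⟩
    rw [LieDerivation.commutator_apply]
    simp [h]
  have h1 := LieDerivation.congr_fun h0 u
  rwa [LieDerivation.commutator_apply, LieDerivation.zero_apply, sub_eq_zero] at h1

end Derivation

/-! ### The derivation action of `U = ℤ[X]` on `L(A)` -/

section Action

variable {X : Type*} {A : Type*} [AddCommGroup A] [Module (MvPolynomial X ℤ) A]

variable (A) in
/-- The derivation of `L(A)` extending the action of the variable `x` on `A`. -/
def varDer (x : X) : LieDerivation ℤ (FreeLieRing A) (FreeLieRing A) :=
  der (DistribSMul.toAddMonoidHom A (MvPolynomial.X x : MvPolynomial X ℤ))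

@[simp]
theorem varDer_ι (x : X) (a : A) :
    varDer A x (ι A a) = ι A ((MvPolynomial.X x : MvPolynomial X ℤ) • a) :=
  der_ι _ a

theorem varDer_comm (x y : X) (u : FreeLieRing A) :
    varDer A x (varDer A y u) = varDer A y (varDer A x u) :=
  der_comm _ _ (fun a => smul_comm (MvPolynomial.X x : MvPolynomial X ℤ)
    (MvPolynomial.X y : MvPolynomial X ℤ) a) u

variable (X A) in
/-- The endomorphisms of the abelian group `L(A)` given by the variables. -/
def varEnds : Set (Module.End ℤ (FreeLieRing A)) :=
  Set.range fun x : X => (varDer A x : FreeLieRing A →ₗ[ℤ] FreeLieRing A)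

theorem varEnds_comm : ∀ f ∈ varEnds X A, ∀ g ∈ varEnds X A, f * g = g * f := by
  rintro _ ⟨x, rfl⟩ _ ⟨y, rfl⟩
  exact LinearMap.ext fun u => varDer_comm x y u

variable (X A) in
open scoped IsMulCommutative in
/-- The ring homomorphism `ℤ[X] → End(L(A))` that sends the variable `x` to the derivation
extending the action of `x` on `A`. -/
def actionHom : MvPolynomial X ℤ →ₐ[ℤ] Module.End ℤ (FreeLieRing A) :=
  haveI : IsMulCommutative (Algebra.adjoin ℤ (varEnds X A)) :=
    Algebra.isMulCommutative_adjoin ℤ varEnds_comm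
  (Algebra.adjoin ℤ (varEnds X A)).val.comp
    (MvPolynomial.aeval fun x : X =>
      (⟨(varDer A x : FreeLieRing A →ₗ[ℤ] FreeLieRing A),
        Algebra.subset_adjoin ⟨x, rfl⟩⟩ : Algebra.adjoin ℤ (varEnds X A)))

theorem actionHom_X (x : X) :
    actionHom X A (MvPolynomial.X x) = (varDer A x : FreeLieRing A →ₗ[ℤ] FreeLieRing A) := by
  simp [actionHom]

/-- `L(A)` as a `U`-module under the derivation action. -/
instance : Module (MvPolynomial X ℤ) (FreeLieRing A) :=
  Module.compHom (FreeLieRing A) (actionHom X A).toRingHom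

theorem smul_def (q : MvPolynomial X ℤ) (u : FreeLieRing A) : q • u = actionHom X A q u := rfl

theorem X_smul (x : X) (u : FreeLieRing A) :
    (MvPolynomial.X x : MvPolynomial X ℤ) • u = varDer A x u := by
  rw [smul_def, actionHom_X]; rfl

theorem C_smul (n : ℤ) (u : FreeLieRing A) :
    (MvPolynomial.C n : MvPolynomial X ℤ) • u = n • u := by
  rw [smul_def, ← MvPolynomial.algebraMap_eq, AlgHom.commutes]
  rfl

/-- A subgroup of `L(A)` that is stable under the derivations `varDer A x` is a `U`-submodule. -/
def submoduleOfStable (X : Type*) [Module (MvPolynomial X ℤ) A] (S : AddSubgroup (FreeLieRing A))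
    (hS : ∀ x : X, ∀ u ∈ S, varDer A x u ∈ S) : Submodule (MvPolynomial X ℤ) (FreeLieRing A) where
  carrier := S
  add_mem' := S.add_mem
  zero_mem' := S.zero_mem
  smul_mem' q := by
    induction q using MvPolynomial.induction_on with
    | C n => intro u hu; rw [C_smul]; exact S.zsmul_mem hu n
    | add q r hq hr => intro u hu; rw [add_smul]; exact S.add_mem (hq hu) (hr hu)
    | mul_X q x hq => intro u hu; rw [mul_smul, X_smul]; exact hq (hS x u hu)

end Action

end FreeLieRing

/-! ### Lie powers and metabelian Lie powers -/

/-- The left-normed Lie product `[u₁, u₂, …, u_c] = [[…[u₁, u₂], …], u_c]`; the empty product is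
`0` by convention. -/
def leftNormed {L : Type*} [LieRing L] : (c : ℕ) → (Fin c → L) → L
  | 0, _ => 0
  | 1, u => u 0
  | c + 2, u => ⁅leftNormed (c + 1) (fun i => u i.castSucc), u (Fin.last (c + 1))⁆

theorem leftNormed_derivation {L : Type*} [LieRing L] (D : LieDerivation ℤ L L) :
    (c : ℕ) → (u : Fin c → L) →
      D (leftNormed c u) = ∑ i, leftNormed c (Function.update u i (D (u i)))
  | 0, _ => by simp [leftNormed]
  | 1, u => by simp [leftNormed]
  | c + 2, u => by
    have ih := leftNormed_derivation D (c + 1) (fun i => u i.castSucc)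
    rw [Fin.sum_univ_castSucc]
    simp only [leftNormed, LieDerivation.apply_lie_eq_add, ih, Function.update_self]
    rw [add_comm, sum_lie]
    congr 1
    · refine Finset.sum_congr rfl fun i _ => ?_
      rw [Function.update_of_ne (Fin.castSucc_lt_last i).ne']
      congr 2
      funext j
      by_cases h : j = i
      · subst h; simp
      · rw [Function.update_of_ne h,
          Function.update_of_ne (fun h' => h (Fin.castSucc_injective _ h'))]
    · congr 2
      funext j
      rw [Function.update_of_ne (Fin.castSucc_lt_last j).ne]

namespace FreeLieRing

variable (X : Type*) (A : Type*) [AddCommGroup A] [Module (MvPolynomial X ℤ) A]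

/-- The left-normed Lie product `[a₁, …, a_c]` in `L(A)` of elements of `A`. -/
def lieProd {A : Type*} [AddCommGroup A] {c : ℕ} (a : Fin c → A) : FreeLieRing A :=
  leftNormed c fun i => ι A (a i)

/-- The formula `[a₁, …, a_c] x = ∑ᵢ [a₁, …, aᵢ x, …, a_c]` for the derivation action. -/
theorem varDer_lieProd (x : X) {c : ℕ} (a : Fin c → A) :
    varDer A x (lieProd a) =
      ∑ i, lieProd (Function.update a i ((MvPolynomial.X x : MvPolynomial X ℤ) • a i)) := by
  rw [lieProd, leftNormed_derivation]
  refine Finset.sum_congr rfl fun i _ => ?_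
  rw [lieProd, varDer_ι]
  congr 1
  funext j
  by_cases h : j = i
  · subst h; simp
  · simp [Function.update_of_ne h]

/-- The Lie power `L^c(A)`: the span of all left-normed products `[a₁, …, a_c]` with `aᵢ ∈ A`,
a `U`-submodule of `L(A)`. -/
def liePower (c : ℕ) : Submodule (MvPolynomial X ℤ) (FreeLieRing A) :=
  submoduleOfStable X (AddSubgroup.closure (Set.range fun a : Fin c → A => lieProd a)) (by
    intro x u hu
    induction hu using AddSubgroup.closure_induction with
    | mem u hu =>
      obtain ⟨a, rfl⟩ := hu
      rw [varDer_lieProd]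
      exact AddSubgroup.sum_mem _ fun i _ => AddSubgroup.subset_closure ⟨_, rfl⟩
    | zero => rw [map_zero]; exact AddSubgroup.zero_mem _
    | add u v _ _ hu hv => rw [map_add]; exact AddSubgroup.add_mem _ hu hv
    | neg u _ hu => rw [map_neg]; exact AddSubgroup.neg_mem _ hu)

theorem der_mem_derivedSeries {L : Type*} [LieRing L] (D : LieDerivation ℤ L L) (k : ℕ) :
    ∀ u ∈ LieAlgebra.derivedSeries ℤ L k, D u ∈ LieAlgebra.derivedSeries ℤ L k := by
  induction k with
  | zero => intro u _; exact LieSubmodule.mem_top _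
  | succ k ih =>
    intro u hu
    rw [LieAlgebra.derivedSeries_def, LieAlgebra.derivedSeriesOfIdeal_succ] at hu ⊢
    rw [← LieSubmodule.mem_toSubmodule, LieSubmodule.lieIdeal_oper_eq_linear_span'] at hu
    induction hu using Submodule.span_induction with
    | mem u hu =>
      obtain ⟨x, hx, y, hy, rfl⟩ := hu
      rw [LieDerivation.apply_lie_eq_add]
      exact add_mem (LieSubmodule.lie_mem_lie hx (ih y hy)) (LieSubmodule.lie_mem_lie (ih x hx) hy)
    | zero => rw [map_zero]; exact zero_mem _
    | add u v _ _ hu hv => rw [map_add]; exact add_mem hu hv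
    | smul n u _ hu => rw [map_smul]; exact Submodule.smul_mem (LieSubmodule.toSubmodule _) n hu

/-- The second derived ideal `L(A)''`, as a `U`-submodule of `L(A)`. -/
def secondDerived : Submodule (MvPolynomial X ℤ) (FreeLieRing A) :=
  submoduleOfStable X (LieAlgebra.derivedSeries ℤ (FreeLieRing A) 2).toSubmodule.toAddSubgroup
    (fun x u hu => der_mem_derivedSeries (varDer A x) 2 u hu)

/-- The metabelian Lie power `M^c(A) = L^c(A) / (L^c(A) ∩ L(A)'')`. -/
abbrev metabelianLiePower (c : ℕ) : Type _ :=
  liePower X A c ⧸ (secondDerived X A).submoduleOf (liePower X A c)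

variable {A}

/-- The left-normed product `[a₁, …, a_c]` as an element of `L^c(A)`. -/
def lieMon {c : ℕ} (a : Fin c → A) : liePower X A c :=
  ⟨lieProd a, AddSubgroup.subset_closure ⟨a, rfl⟩⟩

/-- The left-normed product `[a₁, …, a_c]` as an element of `M^c(A)`. -/
def metabelianMon {c : ℕ} (a : Fin c → A) : metabelianLiePower X A c :=
  Submodule.Quotient.mk (lieMon X a)

variable {X}

/-- The additive map `θ` is the symmetrization map `θ_c : M^c(A) → L^c(A)`, that is,
`c · θ[a₁, …, a_c] = ∑_σ [a₁, a_{σ(2)}, …, a_{σ(c)}] - ∑_τ [a₂, a_{τ(1)}, a_{τ(3)}, …, a_{τ(c)}]`,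
where `σ` and `τ` run over the permutations of `{2, 3, …, c}` and `{1, 3, …, c}`. The sums are
written over the permutations of all indices whose first value is the first, respectively the
second, index. -/
def IsSymmetrization {c : ℕ} (hc : 2 ≤ c) (θ : metabelianLiePower X A c →+ liePower X A c) :
    Prop :=
  ∀ a : Fin c → A, c • θ (metabelianMon X a) =
    (∑ σ : Equiv.Perm (Fin c) with σ ⟨0, by omega⟩ = ⟨0, by omega⟩, lieMon X (a ∘ σ)) -
    ∑ τ : Equiv.Perm (Fin c) with τ ⟨0, by omega⟩ = ⟨1, by omega⟩, lieMon X (a ∘ τ)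

end FreeLieRing

/-- `ℤ` as a trivial `U`-module: every variable acts as `0`. -/
instance trivialIntModule (X : Type*) : Module (MvPolynomial X ℤ) ℤ :=
  Module.compHom ℤ (MvPolynomial.constantCoeff : MvPolynomial X ℤ →+* ℤ)

end

/-!
Write `L^p`, `M^p` for the Lie and metabelian Lie powers of `A`, and `T(A)`, `S(A)` for the tensor
ring and the symmetric ring. All constructions start from the Fox derivative `fox`, which splits off
the first letter, `T(A) → A ⊗ T(A)`. Restricted to `L(A)` it satisfies
`∂[u, v] = ∂u · v - ∂v · u`. Every derivation `der d` factors through it (`evalAct_fox_toTensor`),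
and on `L^n` the derivation `der id` is multiplication by `n`. With `S(A)` in place of `T(A)` it
becomes the Magnus embedding `magnus` of `L' / L''`; it kills `L''`, and modulo `L''` the derivations
can still be recovered from it (`metabEval_fox_toTensor`).

*Existence of `θ`.* Symmetrizing the second tensor factor of the Fox derivative and evaluating
`a ⊗ x ↦ [a, x]` in `L(A)` gives the map `symmetrize`, whose value at `[a₁, …, aₚ]` is the
right-hand side of the formula that defines `p θ`. It kills `L''`, as the symmetrization operator
kills commutators. It is divisible by `p`: by polarization only symmetrized words `b^{p-1}` matter,
and in `T(A)` the coefficients of `[a, b, …, b]` are, up to sign, the binomial coefficients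
`(p - 1).choose i ≡ (-1)^i` modulo `p`, so that modulo `p` the result is a full symmetrization, which
vanishes on Lie elements (`exists_toTensor_symmetrize_eq`). That divisibility by `p` in `T(A)`
implies divisibility in `L^p`, and that `L^p` and `M^p` are torsion-free, follows from
`mem_of_der_mem`: in prime degree, membership in an invariant subgroup can be tested on derivations.
This replaces the Poincaré-Birkhoff-Witt theorem. Modulo `L''`, the map `θ` is multiplication by
`(p - 2)!` (`toMetab_theta`).

*Torsion.* Both `A ⊗ T(A)` and `A ⊗ S(A)` have torsion-free coinvariants, because `A` is a free
`U`-module (`mem_augSub_of_zsmul_mem`). Since multiplication by `p` on `L^p` and `M^p` factors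
through these modules, the torsion of the coinvariants of `L^p` and of `M^p` is annihilated by `p`
(`nsmul_mem_lieAug`, `exists_sub_mem_derived₂`). Consequently `θ ⊗ 1` is injective on torsion: its
composite with the projection `L^p → M^p` is multiplication by `(p - 2)!`, which is prime to `p`.
For surjectivity, let `u ∈ L^p` represent a torsion class. Then `w = θ(u) - (p - 2)! u` lies in `L''`
and represents a torsion class as well, and it remains to see that `w` represents `0`. To this end,
filter `L'` by the weight, the number of factors of degree at least two (`IsWt`); elements of `L''`
have weight at least two. The operator `weightOp` is a derivation of `L'`, acts on elements of weight
`r` as `r (p - 1)!` modulo larger weights (`IsWt.weightOp_sub`), and kills torsion classes since it,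
too, factors through the Fox derivative. As `2 ≤ r < p`, the class of `w` is killed by an integer
prime to `p` (`exists_coprime_smul_mem_lieAug`), while it is also killed by `p`.
-/

noncomputable section

namespace FreeLieRing

/-! ### Right actions of the tensor ring -/

section RightAction

variable {A : Type*} [AddCommGroup A] {V W : Type*} [AddCommGroup V] [AddCommGroup W]

/-- A biadditive map `A × V → V` as a family of endomorphisms of `V`. -/
def genAct (F : A → V → V) (h₁ : ∀ a v w, F a (v + w) = F a v + F a w)
    (h₂ : ∀ a b v, F (a + b) v = F a v + F b v) : A →+ AddMonoid.End V :=
  AddMonoidHom.mk' (fun a => AddMonoidHom.mk' (F a) (h₁ a)) fun a b => AddMonoidHom.ext (h₂ a b)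

theorem gen_add (f : A →+ AddMonoid.End V) (a b : A) (v : V) : f (a + b) v = f a v + f b v := by
  rw [map_add]; rfl

/-- The ring homomorphism `T(A) → End(V)ᵐᵒᵖ` that extends `f`. -/
def rightActHom (f : A →+ AddMonoid.End V) : TensorAlgebra ℤ A →ₐ[ℤ] (AddMonoid.End V)ᵐᵒᵖ :=
  TensorAlgebra.lift ℤ
    ((MulOpposite.opAddEquiv (α := AddMonoid.End V)).toAddMonoidHom.comp f).toIntLinearMap

/-- The right action of the tensor ring `T(A)` on `V` in which the generator `a ∈ A` acts as the
endomorphism `f a`. -/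
def rightAct (f : A →+ AddMonoid.End V) (x : TensorAlgebra ℤ A) : V →+ V :=
  (rightActHom f x).unop

@[simp]
theorem rightAct_one (f : A →+ AddMonoid.End V) (v : V) : rightAct f 1 v = v := by
  rw [rightAct, map_one]; rfl

theorem rightAct_mul (f : A →+ AddMonoid.End V) (x y : TensorAlgebra ℤ A) (v : V) :
    rightAct f (x * y) v = rightAct f y (rightAct f x v) := by
  rw [rightAct, map_mul]; rfl

@[simp]
theorem rightAct_ι (f : A →+ AddMonoid.End V) (a : A) (v : V) :
    rightAct f (TensorAlgebra.ι ℤ a) v = f a v := by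
  rw [rightAct, rightActHom, TensorAlgebra.lift_ι_apply]; rfl

@[simp]
theorem rightAct_mul_ι (f : A →+ AddMonoid.End V) (x : TensorAlgebra ℤ A) (a : A) (v : V) :
    rightAct f (x * TensorAlgebra.ι ℤ a) v = f a (rightAct f x v) := by
  rw [rightAct_mul, rightAct_ι]

theorem rightAct_add (f : A →+ AddMonoid.End V) (x y : TensorAlgebra ℤ A) (v : V) :
    rightAct f (x + y) v = rightAct f x v + rightAct f y v := by
  rw [rightAct, map_add]; rfl

theorem rightAct_zero (f : A →+ AddMonoid.End V) (v : V) : rightAct f 0 v = 0 := by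
  rw [rightAct, map_zero]; rfl

theorem rightAct_neg (f : A →+ AddMonoid.End V) (x : TensorAlgebra ℤ A) (v : V) :
    rightAct f (-x) v = -rightAct f x v := by
  rw [eq_neg_iff_add_eq_zero, ← rightAct_add, neg_add_cancel, rightAct_zero]

theorem rightAct_sub (f : A →+ AddMonoid.End V) (x y : TensorAlgebra ℤ A) (v : V) :
    rightAct f (x - y) v = rightAct f x v - rightAct f y v := by
  rw [sub_eq_add_neg, rightAct_add, rightAct_neg, sub_eq_add_neg]

/-- The orbit map `x ↦ v x` of the right action. -/
def orbit (f : A →+ AddMonoid.End V) (v : V) : TensorAlgebra ℤ A →+ V :=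
  AddMonoidHom.mk' (fun x => rightAct f x v) fun x y => rightAct_add f x y v

@[simp]
theorem orbit_apply (f : A →+ AddMonoid.End V) (v : V) (x : TensorAlgebra ℤ A) :
    orbit f v x = rightAct f x v := rfl

/-- Induction on the number of factors on the right of a monomial in the tensor ring. -/
theorem tensor_induction {P : TensorAlgebra ℤ A → Prop} (one : P 1)
    (add : ∀ x y, P x → P y → P (x + y)) (neg : ∀ x, P x → P (-x))
    (mul_ι : ∀ x a, P x → P (x * TensorAlgebra.ι ℤ a)) (x : TensorAlgebra ℤ A) : P x := by
  have zero : P 0 := by simpa using add _ _ one (neg _ one)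
  have key : ∀ y x, P x → P (x * y) := by
    intro y
    induction y using TensorAlgebra.induction with
    | algebraMap n =>
      intro x hx
      have h : x * algebraMap ℤ _ n = n • x := by
        rw [← Algebra.commutes, ← Algebra.smul_def]
      rw [h]
      induction n with
      | zero => simpa using zero
      | succ n ih =>
        rw [add_smul, one_smul]
        exact add _ _ (ih (by rw [← Algebra.commutes, ← Algebra.smul_def])) hx
      | pred n ih =>
        rw [sub_smul, one_smul, sub_eq_add_neg]
        exact add _ _ (ih (by rw [← Algebra.commutes, ← Algebra.smul_def])) (neg _ hx)
    | ι a => exact fun x hx => mul_ι x a hx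
    | mul a b ha hb => intro x hx; rw [← mul_assoc]; exact hb _ (ha _ hx)
    | add a b ha hb => intro x hx; rw [mul_add]; exact add _ _ (ha _ hx) (hb _ hx)
  simpa using key x 1 one

theorem map_rightAct (f : A →+ AddMonoid.End V) (f' : A →+ AddMonoid.End W) (g : V →+ W)
    (h : ∀ a v, g (f a v) = f' a (g v)) (x : TensorAlgebra ℤ A) (v : V) :
    g (rightAct f x v) = rightAct f' x (g v) := by
  induction x using tensor_induction generalizing v with
  | one => simp
  | add x y hx hy => rw [rightAct_add, map_add, hx, hy, rightAct_add]
  | neg x hx => rw [rightAct_neg, map_neg, hx, rightAct_neg]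
  | mul_ι x a hx => rw [rightAct_mul_ι, h, hx, rightAct_mul_ι]

/-- An auxiliary right action on `T(A) × T(A)` for extending `d` to a derivation. -/
def derTAux (d : A →+ A) : A →+ AddMonoid.End (TensorAlgebra ℤ A × TensorAlgebra ℤ A) :=
  genAct (fun a z => (z.1 * TensorAlgebra.ι ℤ a,
      z.2 * TensorAlgebra.ι ℤ a + z.1 * TensorAlgebra.ι ℤ (d a)))
    (fun a z w => by ext <;> simp [add_mul]; abel)
    (fun a b z => by ext <;> simp [mul_add]; abel)

/-- The derivation of the tensor ring `T(A)` that extends the endomorphism `d` of `A`. -/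
def derT (d : A →+ A) : TensorAlgebra ℤ A →+ TensorAlgebra ℤ A :=
  (AddMonoidHom.snd _ _).comp (orbit (derTAux d) (1, 0))

theorem derTAux_fst (d : A →+ A) (x : TensorAlgebra ℤ A) :
    (rightAct (derTAux d) x (1, 0)).1 = x := by
  induction x using tensor_induction with
  | one => simp
  | add x y hx hy => rw [rightAct_add, Prod.fst_add, hx, hy]
  | neg x hx => rw [rightAct_neg, Prod.fst_neg, hx]
  | mul_ι x a hx => rw [rightAct_mul_ι]; exact congrArg (· * _) hx

@[simp]
theorem derT_one (d : A →+ A) : derT d 1 = 0 := by simp [derT]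

theorem derT_mul_ι (d : A →+ A) (x : TensorAlgebra ℤ A) (a : A) :
    derT d (x * TensorAlgebra.ι ℤ a) =
      derT d x * TensorAlgebra.ι ℤ a + x * TensorAlgebra.ι ℤ (d a) := by
  have h : derT d (x * TensorAlgebra.ι ℤ a) =
      derT d x * TensorAlgebra.ι ℤ a +
        (rightAct (derTAux d) x (1, 0)).1 * TensorAlgebra.ι ℤ (d a) := by
    simp only [derT, AddMonoidHom.comp_apply, orbit_apply, rightAct_mul_ι]; rfl
  rw [h, derTAux_fst]

@[simp]
theorem derT_ι (d : A →+ A) (a : A) :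
    derT d (TensorAlgebra.ι ℤ a) = TensorAlgebra.ι ℤ (d a) := by
  simpa using derT_mul_ι d 1 a

theorem derT_mul (d : A →+ A) (x y : TensorAlgebra ℤ A) :
    derT d (x * y) = derT d x * y + x * derT d y := by
  induction y using tensor_induction with
  | one => simp
  | add y z hy hz => rw [mul_add, map_add, hy, hz, map_add]; noncomm_ring
  | neg y hy => rw [mul_neg, map_neg, hy, map_neg]; noncomm_ring
  | mul_ι y a hy => rw [← mul_assoc, derT_mul_ι, hy, derT_mul_ι]; noncomm_ring

/-- The right action is compatible with derivations as soon as the action of generators is. -/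
theorem der_rightAct (f : A →+ AddMonoid.End V) (d : A →+ A) (dV : V →+ V)
    (h : ∀ a v, dV (f a v) = f (d a) v + f a (dV v)) (x : TensorAlgebra ℤ A) (v : V) :
    dV (rightAct f x v) = rightAct f (derT d x) v + rightAct f x (dV v) := by
  induction x using tensor_induction with
  | one => simp [rightAct_zero]
  | add x y hx hy => simp only [rightAct_add, map_add, hx, hy]; abel
  | neg x hx => simp only [rightAct_neg, map_neg, hx]; abel
  | mul_ι x a hx =>
    rw [rightAct_mul_ι, h, hx, derT_mul_ι, rightAct_add, rightAct_mul_ι, rightAct_mul_ι,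
      rightAct_mul_ι, map_add]
    abel

theorem derT_comm (d e : A →+ A) (h : ∀ a, d (e a) = e (d a)) (x : TensorAlgebra ℤ A) :
    derT d (derT e x) = derT e (derT d x) := by
  induction x using tensor_induction with
  | one => simp
  | add x y hx hy => simp only [map_add, hx, hy]
  | neg x hx => simp only [map_neg, hx]
  | mul_ι x a hx => simp only [derT_mul_ι, map_add, hx, h]; abel

/-- If the generators act by commuting endomorphisms, then so does all of `T(A)`. -/
theorem rightAct_comm (f : A →+ AddMonoid.End V) (h : ∀ a b v, f a (f b v) = f b (f a v))
    (x y : TensorAlgebra ℤ A) (v : V) :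
    rightAct f x (rightAct f y v) = rightAct f y (rightAct f x v) := by
  refine map_rightAct f f (rightAct f x) (fun b v => ?_) y v
  exact (map_rightAct f f (f b) (fun a v => h b a v) x v).symm

end RightAction

/-! ### The free Lie ring inside the tensor ring -/

section ToTensor

variable {A : Type*} [AddCommGroup A]

theorem lie_induction {P : FreeLieRing A → Prop} (ι : ∀ a, P (ι A a))
    (add : ∀ u v, P u → P v → P (u + v)) (neg : ∀ u, P u → P (-u))
    (lie : ∀ u v, P u → P v → P ⁅u, v⁆) (u : FreeLieRing A) : P u := by
  have zero : P 0 := by simpa using add _ _ (ι 0) (neg _ (ι 0))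
  let S : LieSubalgebra ℤ (FreeLieRing A) :=
    { carrier := {u | P u}
      add_mem' := fun {u v} hu hv => add u v hu hv
      zero_mem' := zero
      smul_mem' := fun n u hu => by
        induction n with
        | zero => simpa using zero
        | succ n ih => rw [add_smul, one_smul]; exact add _ _ ih hu
        | pred n ih => rw [sub_smul, one_smul, sub_eq_add_neg]; exact add _ _ ih (neg _ hu)
      lie_mem' := fun {u v} hu hv => lie u v hu hv }
  have h : LieSubalgebra.lieSpan ℤ (FreeLieRing A) (Set.range (FreeLieRing.ι A)) ≤ S :=
    LieSubalgebra.lieSpan_le.2 (by rintro _ ⟨a, rfl⟩; exact ι a)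
  rw [lieSpan_range_ι] at h
  exact h (LieSubalgebra.mem_top u)

variable (A) in
/-- The canonical Lie ring homomorphism from `L(A)` to the tensor ring `T(A)`, as an additive
map. -/
def toTensor : FreeLieRing A →+ TensorAlgebra ℤ A :=
  letI : LieRing (TensorAlgebra ℤ A) := LieRing.ofAssociativeRing
  (lift (TensorAlgebra.ι ℤ : A →ₗ[ℤ] TensorAlgebra ℤ A).toAddMonoidHom).toLinearMap.toAddMonoidHom

@[simp]
theorem toTensor_ι (a : A) : toTensor A (ι A a) = TensorAlgebra.ι ℤ a :=
  letI : LieRing (TensorAlgebra ℤ A) := LieRing.ofAssociativeRing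
  lift_ι (TensorAlgebra.ι ℤ : A →ₗ[ℤ] TensorAlgebra ℤ A).toAddMonoidHom a

theorem toTensor_lie (u v : FreeLieRing A) :
    toTensor A ⁅u, v⁆ = toTensor A u * toTensor A v - toTensor A v * toTensor A u :=
  letI : LieRing (TensorAlgebra ℤ A) := LieRing.ofAssociativeRing
  LieHom.map_lie (lift (TensorAlgebra.ι ℤ : A →ₗ[ℤ] TensorAlgebra ℤ A).toAddMonoidHom) u v

theorem toTensor_der (d : A →+ A) (u : FreeLieRing A) :
    toTensor A (der d u) = derT d (toTensor A u) := by
  induction u using lie_induction with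
  | ι a => simp
  | add u v hu hv => simp only [map_add, hu, hv]
  | neg u hu => simp only [map_neg, hu]
  | lie u v hu hv =>
    rw [LieDerivation.apply_lie_eq_add, map_add, toTensor_lie, toTensor_lie, toTensor_lie, map_sub,
      derT_mul, derT_mul, hu, hv]
    abel

variable (A) in
/-- The right adjoint action of the generators: `a` acts on `L(A)` as `u ↦ [u, a]`. -/
def adGen : A →+ AddMonoid.End (FreeLieRing A) :=
  genAct (fun a u => ⁅u, ι A a⁆) (fun a u v => add_lie u v _) fun a b u => by simp

@[simp]
theorem adGen_apply (a : A) (u : FreeLieRing A) : adGen A a u = ⁅u, ι A a⁆ := rfl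

/-- The right adjoint action of `T(A)` on `L(A)`. -/
abbrev adAct (x : TensorAlgebra ℤ A) : FreeLieRing A →+ FreeLieRing A := rightAct (adGen A) x

theorem adAct_toTensor (u v : FreeLieRing A) : adAct (toTensor A u) v = ⁅v, u⁆ := by
  induction u using lie_induction generalizing v with
  | ι a => simp
  | add u w hu hw => rw [map_add, rightAct_add, hu, hw, lie_add]
  | neg u hu => rw [map_neg, rightAct_neg, hu, lie_neg]
  | lie u w hu hw =>
    rw [toTensor_lie, rightAct_sub, rightAct_mul, rightAct_mul, hu, hw, hw, hu,
      leibniz_lie v u w, ← lie_skew u ⁅v, w⁆]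
    abel

end ToTensor

/-! ### Splitting off the first letter -/

section Fox

variable {A : Type*} [AddCommGroup A] {V W : Type*} [AddCommGroup V] [AddCommGroup W]

/-- The right action of the generators on `A ⊗ T(A)` by multiplication on the second factor. -/
def mulGen : A →+ AddMonoid.End (A ⊗[ℤ] TensorAlgebra ℤ A) :=
  genAct (fun a m => LinearMap.lTensor A (LinearMap.mulRight ℤ (TensorAlgebra.ι ℤ a)) m)
    (fun _ _ _ => map_add _ _ _) fun a b m => by
      rw [← LinearMap.add_apply, ← LinearMap.lTensor_add, map_add]; congr 2; ext; simp [mul_add]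

@[simp]
theorem mulGen_tmul (a b : A) (x : TensorAlgebra ℤ A) :
    mulGen a (b ⊗ₜ[ℤ] x) = b ⊗ₜ[ℤ] (x * TensorAlgebra.ι ℤ a) := rfl

@[simp]
theorem mulGen_act_tmul (b : A) (x y : TensorAlgebra ℤ A) :
    rightAct mulGen y (b ⊗ₜ[ℤ] x) = b ⊗ₜ[ℤ] (x * y) := by
  induction y using tensor_induction with
  | one => simp
  | add y z hy hz => rw [rightAct_add, hy, hz, mul_add, TensorProduct.tmul_add]
  | neg y hy => rw [rightAct_neg, hy, mul_neg, TensorProduct.tmul_neg]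
  | mul_ι y a hy => rw [rightAct_mul_ι, hy, mulGen_tmul, mul_assoc]

/-- An auxiliary right action on `(A ⊗ T(A)) × ℤ` for splitting off first letters. -/
def foxAux : A →+ AddMonoid.End ((A ⊗[ℤ] TensorAlgebra ℤ A) × ℤ) :=
  genAct (fun a z => (mulGen a z.1 + z.2 • (a ⊗ₜ[ℤ] (1 : TensorAlgebra ℤ A)), 0))
    (fun a z w => by ext <;> simp [add_smul]; abel)
    (fun a b z => by
      refine Prod.ext ?_ (add_zero 0).symm
      change mulGen (a + b) z.1 + z.2 • ((a + b) ⊗ₜ[ℤ] (1 : TensorAlgebra ℤ A)) =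
        (mulGen a z.1 + z.2 • (a ⊗ₜ[ℤ] (1 : TensorAlgebra ℤ A))) +
        (mulGen b z.1 + z.2 • (b ⊗ₜ[ℤ] (1 : TensorAlgebra ℤ A)))
      rw [gen_add, TensorProduct.add_tmul, smul_add]; abel)

variable (A) in
/-- The additive map `T(A) → A ⊗ T(A)` that splits off the first letter: it sends
`a₁ a₂ ⋯ aₙ` to `a₁ ⊗ a₂ ⋯ aₙ` and `1` to `0`. -/
def fox : TensorAlgebra ℤ A →+ A ⊗[ℤ] TensorAlgebra ℤ A :=
  (AddMonoidHom.fst _ _).comp (orbit foxAux (0, 1))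

variable (A) in
/-- The augmentation of the tensor ring. -/
abbrev aug : TensorAlgebra ℤ A →ₐ[ℤ] ℤ := TensorAlgebra.algebraMapInv

theorem aug_ι (a : A) : aug A (TensorAlgebra.ι ℤ a) = 0 := by
  simp [TensorAlgebra.algebraMapInv]

theorem foxAux_snd (x : TensorAlgebra ℤ A) : (rightAct foxAux x (0, 1)).2 = aug A x := by
  induction x using tensor_induction with
  | one => simp
  | add x y hx hy => rw [rightAct_add, Prod.snd_add, hx, hy, map_add]
  | neg x hx => rw [rightAct_neg, Prod.snd_neg, hx, map_neg]
  | mul_ι x a hx => rw [rightAct_mul_ι, map_mul, aug_ι, mul_zero]; rfl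

@[simp]
theorem fox_one : fox A 1 = 0 := by simp [fox]

theorem fox_mul_ι (x : TensorAlgebra ℤ A) (a : A) :
    fox A (x * TensorAlgebra.ι ℤ a) = mulGen a (fox A x) + aug A x • (a ⊗ₜ[ℤ] 1) := by
  have h : fox A (x * TensorAlgebra.ι ℤ a) =
      mulGen a (fox A x) + (rightAct foxAux x (0, 1)).2 • (a ⊗ₜ[ℤ] 1) := by
    simp only [fox, AddMonoidHom.comp_apply, orbit_apply, rightAct_mul_ι]; rfl
  rw [h, foxAux_snd]

theorem fox_mul (x y : TensorAlgebra ℤ A) :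
    fox A (x * y) = rightAct mulGen y (fox A x) + aug A x • fox A y := by
  induction y using tensor_induction with
  | one => simp
  | add y z hy hz => rw [mul_add, map_add, hy, hz, rightAct_add, map_add, smul_add]; abel
  | neg y hy => rw [mul_neg, map_neg, hy, rightAct_neg, map_neg, smul_neg]; abel
  | mul_ι y a hy =>
    rw [← mul_assoc, fox_mul_ι, hy, rightAct_mul_ι, fox_mul_ι, map_add, smul_add, map_mul,
      map_zsmul, mul_smul]
    abel

@[simp]
theorem fox_ι (a : A) : fox A (TensorAlgebra.ι ℤ a) = a ⊗ₜ[ℤ] 1 := by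
  simpa using fox_mul_ι (1 : TensorAlgebra ℤ A) a

theorem aug_toTensor (u : FreeLieRing A) : aug A (toTensor A u) = 0 := by
  induction u using lie_induction with
  | ι a => rw [toTensor_ι, aug_ι]
  | add u v hu hv => rw [map_add, map_add, hu, hv, add_zero]
  | neg u hu => rw [map_neg, map_neg, hu, neg_zero]
  | lie u v hu hv => rw [toTensor_lie, map_sub, map_mul, map_mul, hu, hv, mul_zero, sub_self]

theorem fox_toTensor_lie (u v : FreeLieRing A) :
    fox A (toTensor A ⁅u, v⁆) = rightAct mulGen (toTensor A v) (fox A (toTensor A u)) -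
      rightAct mulGen (toTensor A u) (fox A (toTensor A v)) := by
  rw [toTensor_lie, map_sub, fox_mul, fox_mul, aug_toTensor, aug_toTensor, zero_smul, zero_smul,
    add_zero, add_zero]

/-- An additive map `A → T(A) → V`, biadditive, as a map out of `A ⊗ T(A)`. -/
def liftAT (F : A →+ TensorAlgebra ℤ A →+ V) : A ⊗[ℤ] TensorAlgebra ℤ A →+ V :=
  TensorProduct.liftAddHom F fun n a x => by
    rw [map_zsmul, AddMonoidHom.coe_smul, Pi.smul_apply]; exact (map_zsmul (F a) n x).symm

/-- The additive map `A ⊗ T(A) → V`, `a ⊗ x ↦ g(a) x`. -/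
def evalAct (g : A →+ V) (f : A →+ AddMonoid.End V) : A ⊗[ℤ] TensorAlgebra ℤ A →+ V :=
  liftAT (AddMonoidHom.mk' (fun a => orbit f (g a)) fun a b => by ext x; simp)

@[simp]
theorem evalAct_tmul (g : A →+ V) (f : A →+ AddMonoid.End V) (a : A) (x : TensorAlgebra ℤ A) :
    evalAct g f (a ⊗ₜ[ℤ] x) = rightAct f x (g a) := rfl

theorem evalAct_rightAct (g : A →+ V) (f : A →+ AddMonoid.End V) (y : TensorAlgebra ℤ A)
    (m : A ⊗[ℤ] TensorAlgebra ℤ A) :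
    evalAct g f (rightAct mulGen y m) = rightAct f y (evalAct g f m) := by
  induction m using TensorProduct.induction_on with
  | zero => simp
  | tmul a x => rw [mulGen_act_tmul, evalAct_tmul, evalAct_tmul, rightAct_mul]
  | add m n hm hn => simp only [map_add, hm, hn]

variable (A) in
/-- The multiplication map `A ⊗ T(A) → T(A)`. -/
def unfox : A ⊗[ℤ] TensorAlgebra ℤ A →+ TensorAlgebra ℤ A :=
  liftAT (AddMonoidHom.mk' (fun a => AddMonoidHom.mulLeft (TensorAlgebra.ι ℤ a))
    fun a b => by ext x; simp [add_mul])

@[simp]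
theorem unfox_tmul (a : A) (x : TensorAlgebra ℤ A) :
    unfox A (a ⊗ₜ[ℤ] x) = TensorAlgebra.ι ℤ a * x := rfl

theorem unfox_mulGen (a : A) (m : A ⊗[ℤ] TensorAlgebra ℤ A) :
    unfox A (mulGen a m) = unfox A m * TensorAlgebra.ι ℤ a := by
  induction m using TensorProduct.induction_on with
  | zero => simp
  | tmul b x => simp [mul_assoc]
  | add m n hm hn => simp only [map_add, hm, hn, add_mul]

theorem unfox_fox (x : TensorAlgebra ℤ A) : unfox A (fox A x) = x - aug A x • 1 := by
  induction x using tensor_induction with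
  | one => simp
  | add x y hx hy => rw [map_add, map_add, hx, hy, map_add, add_smul]; abel
  | neg x hx => rw [map_neg, map_neg, hx, map_neg, neg_smul]; abel
  | mul_ι x a hx =>
    rw [fox_mul_ι, map_add, unfox_mulGen, hx, map_zsmul, unfox_tmul, map_mul, aug_ι]
    simp [sub_mul]

/-- Every derivation of `L(A)` that preserves `A` factors through the embedding into the tensor
ring; for `d = id` this is the Dynkin-Specht-Wever formula. -/
theorem evalAct_fox_toTensor (d : A →+ A) (u : FreeLieRing A) :
    evalAct ((ι A).comp d) (adGen A) (fox A (toTensor A u)) = der d u := by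
  induction u using lie_induction with
  | ι a => simp
  | add u v hu hv => simp only [map_add, hu, hv]
  | neg u hu => simp only [map_neg, hu]
  | lie u v hu hv =>
    rw [fox_toTensor_lie, map_sub, evalAct_rightAct, evalAct_rightAct, hu, hv, adAct_toTensor,
      adAct_toTensor, LieDerivation.apply_lie_eq_add, ← lie_skew (der d v) u]
    abel

/-- The operator on `A ⊗ T(A)` induced by the endomorphism `d` of `A`, acting as a derivation. -/
def derAT (d : A →+ A) : A ⊗[ℤ] TensorAlgebra ℤ A →+ A ⊗[ℤ] TensorAlgebra ℤ A :=
  (TensorProduct.map d.toIntLinearMap LinearMap.id).toAddMonoidHom +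
    (TensorProduct.map LinearMap.id (derT d).toIntLinearMap).toAddMonoidHom

@[simp]
theorem derAT_tmul (d : A →+ A) (a : A) (x : TensorAlgebra ℤ A) :
    derAT d (a ⊗ₜ[ℤ] x) = d a ⊗ₜ[ℤ] x + a ⊗ₜ[ℤ] derT d x := rfl

theorem derAT_mulGen (d : A →+ A) (a : A) (m : A ⊗[ℤ] TensorAlgebra ℤ A) :
    derAT d (mulGen a m) = mulGen (d a) m + mulGen a (derAT d m) := by
  induction m using TensorProduct.induction_on with
  | zero => simp
  | tmul b x => simp [derT_mul_ι, TensorProduct.tmul_add]; abel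
  | add m n hm hn => simp only [map_add, hm, hn]; abel

theorem aug_derT (d : A →+ A) (x : TensorAlgebra ℤ A) : aug A (derT d x) = 0 := by
  induction x using tensor_induction with
  | one => simp
  | add x y hx hy => rw [map_add, map_add, hx, hy, add_zero]
  | neg x hx => rw [map_neg, map_neg, hx, neg_zero]
  | mul_ι x a hx => rw [derT_mul_ι, map_add, map_mul, map_mul, aug_ι, aug_ι]; simp

theorem fox_derT (d : A →+ A) (x : TensorAlgebra ℤ A) :
    fox A (derT d x) = derAT d (fox A x) := by
  induction x using tensor_induction with
  | one => simp
  | add x y hx hy => simp only [map_add, hx, hy]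
  | neg x hx => simp only [map_neg, hx]
  | mul_ι x a hx =>
    rw [derT_mul_ι, map_add, fox_mul_ι, fox_mul_ι, fox_mul_ι, hx, map_add, derAT_mulGen,
      map_zsmul, derAT_tmul, derT_one, TensorProduct.tmul_zero, aug_derT, zero_smul]
    abel

/-- Equivariance of `evalAct` under derivations. -/
theorem evalAct_derAT (g : A →+ V) (f : A →+ AddMonoid.End V) (d : A →+ A) (dV : V →+ V)
    (hg : ∀ a, dV (g a) = g (d a)) (h : ∀ a v, dV (f a v) = f (d a) v + f a (dV v))
    (m : A ⊗[ℤ] TensorAlgebra ℤ A) : evalAct g f (derAT d m) = dV (evalAct g f m) := by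
  induction m using TensorProduct.induction_on with
  | zero => simp
  | tmul b x =>
    rw [derAT_tmul, map_add, evalAct_tmul, evalAct_tmul, evalAct_tmul, der_rightAct f d dV h, hg,
      add_comm]
  | add m n hm hn => simp only [map_add, hm, hn]

theorem der_adGen (d : A →+ A) (a : A) (u : FreeLieRing A) :
    der d (adGen A a u) = adGen A (d a) u + adGen A a (der d u) := by
  simp only [adGen_apply, LieDerivation.apply_lie_eq_add, der_ι]

end Fox

/-! ### Homogeneous components -/

section Degree

variable {A : Type*} [AddCommGroup A]

variable (A) in
/-- The homogeneous elements of degree `n` of the tensor ring. -/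
abbrev tensorDeg (n : ℕ) : Submodule ℤ (TensorAlgebra ℤ A) :=
  LinearMap.range (TensorAlgebra.ι ℤ : A →ₗ[ℤ] TensorAlgebra ℤ A) ^ n

theorem one_mem_tensorDeg : (1 : TensorAlgebra ℤ A) ∈ tensorDeg A 0 := by
  rw [tensorDeg, pow_zero]; exact Submodule.one_le.1 le_rfl

theorem mul_ι_mem_tensorDeg {n : ℕ} {x : TensorAlgebra ℤ A} (hx : x ∈ tensorDeg A n) (a : A) :
    x * TensorAlgebra.ι ℤ a ∈ tensorDeg A (n + 1) := by
  rw [tensorDeg, pow_succ]; exact Submodule.mul_mem_mul hx ⟨a, rfl⟩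

theorem ι_mul_mem_tensorDeg {n : ℕ} {x : TensorAlgebra ℤ A} (hx : x ∈ tensorDeg A n) (a : A) :
    TensorAlgebra.ι ℤ a * x ∈ tensorDeg A (n + 1) := by
  rw [tensorDeg, pow_succ']; exact Submodule.mul_mem_mul ⟨a, rfl⟩ hx

theorem tensorDeg_induction {P : ℕ → TensorAlgebra ℤ A → Prop} (one : P 0 1)
    (add : ∀ n x y, P n x → P n y → P n (x + y)) (neg : ∀ n x, P n x → P n (-x))
    (mul_ι : ∀ n x a, x ∈ tensorDeg A n → P n x → P (n + 1) (x * TensorAlgebra.ι ℤ a))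
    {n : ℕ} {x : TensorAlgebra ℤ A} (hx : x ∈ tensorDeg A n) : P n x := by
  induction n generalizing x with
  | zero =>
    rw [tensorDeg, pow_zero] at hx
    obtain ⟨n, rfl⟩ := Submodule.mem_one.1 hx
    have zero : P 0 0 := by simpa using add _ _ _ one (neg _ _ one)
    induction n with
    | zero => simpa using zero
    | succ n ih =>
      rw [map_add, map_one]
      exact add _ _ _ (ih (Submodule.mem_one.2 ⟨_, rfl⟩)) one
    | pred n ih =>
      rw [map_sub, map_one, sub_eq_add_neg]
      exact add _ _ _ (ih (Submodule.mem_one.2 ⟨_, rfl⟩)) (neg _ _ one)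
  | succ n ih =>
    rw [tensorDeg, pow_succ] at hx
    induction hx using Submodule.mul_induction_on' with
    | mem_mul_mem x hx y hy =>
      obtain ⟨a, rfl⟩ := hy
      exact mul_ι n x a hx (ih hx)
    | add x _ y _ hx hy => exact add _ _ _ hx hy

variable (A) in
/-- The additive group spanned by the left-normed Lie products of length `n`. -/
def lieDeg (n : ℕ) : AddSubgroup (FreeLieRing A) :=
  AddSubgroup.closure (Set.range fun a : Fin n → A => lieProd a)

theorem lieProd_mem {n : ℕ} (a : Fin n → A) : lieProd a ∈ lieDeg A n :=
  AddSubgroup.subset_closure ⟨a, rfl⟩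

theorem lieProd_snoc {n : ℕ} (a : Fin (n + 1) → A) (b : A) :
    lieProd (Fin.snoc a b : Fin (n + 2) → A) = ⁅lieProd a, ι A b⁆ := by
  simp [lieProd, leftNormed]

theorem lieProd_one (a : Fin 1 → A) : lieProd a = ι A (a 0) := rfl

theorem lieProd_succ_succ {n : ℕ} (a : Fin (n + 2) → A) :
    lieProd a = ⁅lieProd (fun i => a i.castSucc), ι A (a (Fin.last _))⁆ := rfl

theorem ι_mem_lieDeg (a : A) : ι A a ∈ lieDeg A 1 := lieProd_mem fun _ : Fin 1 => a

theorem lieDeg_zero : lieDeg A 0 = ⊥ := by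
  refine AddSubgroup.closure_eq_bot_iff.2 ?_
  rintro _ ⟨a, rfl⟩
  rfl

theorem lie_ι_mem_lieDeg {n : ℕ} {u : FreeLieRing A} (hu : u ∈ lieDeg A n) (a : A) :
    ⁅u, ι A a⁆ ∈ lieDeg A (n + 1) := by
  induction hu using AddSubgroup.closure_induction with
  | mem u hu =>
    obtain ⟨b, rfl⟩ := hu
    cases n with
    | zero => change ⁅(0 : FreeLieRing A), _⁆ ∈ _; rw [zero_lie]; exact zero_mem _
    | succ n => dsimp only; rw [← lieProd_snoc]; exact lieProd_mem _
  | zero => rw [zero_lie]; exact zero_mem _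
  | add u v _ _ hu hv => rw [add_lie]; exact add_mem hu hv
  | neg u _ hu => rw [neg_lie]; exact neg_mem hu

theorem lieDeg_induction {P : ℕ → FreeLieRing A → Prop} (ι_mem : ∀ a, P 1 (ι A a))
    (zero : ∀ n, P n 0) (add : ∀ n u v, P n u → P n v → P n (u + v))
    (neg : ∀ n u, P n u → P n (-u))
    (lie : ∀ n u a, u ∈ lieDeg A (n + 1) → P (n + 1) u → P (n + 2) ⁅u, ι A a⁆)
    {n : ℕ} {u : FreeLieRing A} (hu : u ∈ lieDeg A n) : P n u := by
  have key : ∀ (n : ℕ) (a : Fin n → A), P n (lieProd a) := by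
    intro n a
    match n with
    | 0 => exact zero 0
    | n + 1 =>
      induction n with
      | zero => exact ι_mem _
      | succ n ih => exact lie n _ _ (lieProd_mem _) (ih _)
  induction hu using AddSubgroup.closure_induction with
  | mem u hu => obtain ⟨a, rfl⟩ := hu; exact key n a
  | zero => exact zero n
  | add u v _ _ hu hv => exact add _ _ _ hu hv
  | neg u _ hu => exact neg _ _ hu

theorem toTensor_mem {n : ℕ} {u : FreeLieRing A} (hu : u ∈ lieDeg A n) :
    toTensor A u ∈ tensorDeg A n := by
  refine lieDeg_induction (P := fun n u => toTensor A u ∈ tensorDeg A n) ?_ ?_ ?_ ?_ ?_ hu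
  · intro a
    rw [toTensor_ι, ← one_mul (TensorAlgebra.ι ℤ a)]
    exact mul_ι_mem_tensorDeg one_mem_tensorDeg a
  · intro n; rw [map_zero]; exact zero_mem _
  · intro n u v hu hv; rw [map_add]; exact add_mem hu hv
  · intro n u hu; rw [map_neg]; exact neg_mem hu
  · intro n u a _ hu
    rw [toTensor_lie, toTensor_ι]
    exact sub_mem (mul_ι_mem_tensorDeg hu a) (ι_mul_mem_tensorDeg hu a)

theorem adAct_mem_lieDeg {m n : ℕ} {u : FreeLieRing A} (hu : u ∈ lieDeg A m)
    {x : TensorAlgebra ℤ A} (hx : x ∈ tensorDeg A n) : adAct x u ∈ lieDeg A (m + n) := by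
  refine tensorDeg_induction (P := fun n x => adAct x u ∈ lieDeg A (m + n)) ?_ ?_ ?_ ?_ hx
  · simpa using hu
  · intro n x y hx hy; rw [adAct, rightAct_add]; exact add_mem hx hy
  · intro n x hx; rw [adAct, rightAct_neg]; exact neg_mem hx
  · intro n x a _ hx; rw [adAct, rightAct_mul_ι]; exact lie_ι_mem_lieDeg hx a

theorem lie_mem_lieDeg {m n : ℕ} {u v : FreeLieRing A} (hu : u ∈ lieDeg A m)
    (hv : v ∈ lieDeg A n) : ⁅u, v⁆ ∈ lieDeg A (m + n) := by
  rw [← adAct_toTensor]; exact adAct_mem_lieDeg hu (toTensor_mem hv)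

theorem der_mem_lieDeg (d : A →+ A) {n : ℕ} {u : FreeLieRing A} (hu : u ∈ lieDeg A n) :
    der d u ∈ lieDeg A n := by
  refine lieDeg_induction (P := fun n u => der d u ∈ lieDeg A n) ?_ ?_ ?_ ?_ ?_ hu
  · intro a; rw [der_ι]; exact ι_mem_lieDeg _
  · intro n; rw [map_zero]; exact zero_mem _
  · intro n u v hu hv; rw [map_add]; exact add_mem hu hv
  · intro n u hu; rw [map_neg]; exact neg_mem hu
  · intro n u a hu hu'
    have h := der_adGen d a u
    rw [adGen_apply, adGen_apply, adGen_apply] at h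
    rw [h]
    exact add_mem (lie_ι_mem_lieDeg hu _) (lie_ι_mem_lieDeg hu' _)

theorem der_id {n : ℕ} {u : FreeLieRing A} (hu : u ∈ lieDeg A n) :
    der (AddMonoidHom.id A) u = n • u := by
  refine lieDeg_induction (P := fun n u => der (AddMonoidHom.id A) u = n • u) ?_ ?_ ?_ ?_ ?_ hu
  · intro a; simp
  · intro n; simp
  · intro n u v hu hv; rw [map_add, hu, hv, smul_add]
  · intro n u hu; rw [map_neg, hu, smul_neg]
  · intro n u a _ hu
    have h := der_adGen (AddMonoidHom.id A) a u
    rw [adGen_apply, adGen_apply, adGen_apply, hu, AddMonoidHom.id_apply] at h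
    rw [h, succ_nsmul' _ (n + 1), nsmul_lie]

theorem mem_derivedSeries_one_of_mem_lieDeg {n : ℕ} {u : FreeLieRing A}
    (hu : u ∈ lieDeg A (n + 2)) : u ∈ LieAlgebra.derivedSeries ℤ (FreeLieRing A) 1 := by
  induction hu using AddSubgroup.closure_induction with
  | mem u hu =>
    obtain ⟨b, rfl⟩ := hu
    exact LieSubmodule.lie_mem_lie (LieSubmodule.mem_top _) (LieSubmodule.mem_top _)
  | zero => exact zero_mem _
  | add u v _ _ hu hv => exact add_mem hu hv
  | neg u _ hu => exact neg_mem hu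

theorem derivedSeries_succ_induction (k : ℕ) {P : FreeLieRing A → Prop} (zero : P 0)
    (add : ∀ u v, P u → P v → P (u + v)) (neg : ∀ u, P u → P (-u))
    (lie : ∀ u v, u ∈ LieAlgebra.derivedSeries ℤ (FreeLieRing A) k →
      v ∈ LieAlgebra.derivedSeries ℤ (FreeLieRing A) k → P ⁅u, v⁆)
    {u : FreeLieRing A} (hu : u ∈ LieAlgebra.derivedSeries ℤ (FreeLieRing A) (k + 1)) : P u := by
  rw [LieAlgebra.derivedSeries_def, LieAlgebra.derivedSeriesOfIdeal_succ,
    ← LieSubmodule.mem_toSubmodule, LieSubmodule.lieIdeal_oper_eq_linear_span'] at hu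
  induction hu using Submodule.span_induction with
  | mem u hu => obtain ⟨x, hx, y, hy, rfl⟩ := hu; exact lie x y hx hy
  | zero => exact zero
  | add u v _ _ hu hv => exact add _ _ hu hv
  | smul n u _ hu =>
    induction n with
    | zero => simpa using zero
    | succ n ih => rw [add_smul, one_smul]; exact add _ _ ih hu
    | pred n ih => rw [sub_smul, one_smul, sub_eq_add_neg]; exact add _ _ ih (neg _ hu)

variable (A) in
/-- The derived ideal `L(A)'`, as an additive group. -/
abbrev derived₁ : AddSubgroup (FreeLieRing A) :=
  (LieAlgebra.derivedSeries ℤ (FreeLieRing A) 1).toSubmodule.toAddSubgroup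

variable (A) in
/-- The second derived ideal `L(A)''`, as an additive group. -/
abbrev derived₂ : AddSubgroup (FreeLieRing A) :=
  (LieAlgebra.derivedSeries ℤ (FreeLieRing A) 2).toSubmodule.toAddSubgroup

theorem lie_mem_derived₁ (u v : FreeLieRing A) : ⁅u, v⁆ ∈ derived₁ A :=
  LieSubmodule.lie_mem_lie (LieSubmodule.mem_top u) (LieSubmodule.mem_top v)

theorem lie_mem_derived₂ {u v : FreeLieRing A} (hu : u ∈ derived₁ A) (hv : v ∈ derived₁ A) :
    ⁅u, v⁆ ∈ derived₂ A :=
  LieSubmodule.lie_mem_lie hu hv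

theorem adAct_mem_derived₂ (x : TensorAlgebra ℤ A) {u : FreeLieRing A} (hu : u ∈ derived₂ A) :
    adAct x u ∈ derived₂ A := by
  induction x using tensor_induction with
  | one => simpa using hu
  | add x y hx hy => rw [adAct, rightAct_add]; exact add_mem hx hy
  | neg x hx => rw [adAct, rightAct_neg]; exact neg_mem hx
  | mul_ι x a hx =>
    rw [adAct, rightAct_mul_ι, adGen_apply]
    exact lie_mem_left ℤ _ (LieAlgebra.derivedSeries ℤ (FreeLieRing A) 2) _ _ hx

end Degree

/-! ### The grading -/

section Grading

variable {A : Type*} [AddCommGroup A]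

open Polynomial in
variable (A) in
/-- The Lie ring homomorphism `L(A) → ℤ[t] ⊗ L(A)` that sends `a ∈ A` to `t ⊗ a`. -/
def gradHom : FreeLieRing A →ₗ⁅ℤ⁆ ℤ[X] ⊗[ℤ] FreeLieRing A :=
  lift (AddMonoidHom.mk' (fun a => (X : ℤ[X]) ⊗ₜ[ℤ] ι A a)
    fun a b => by rw [map_add, TensorProduct.tmul_add])

open Polynomial in
variable (A) in
/-- The coefficient of `tⁿ` in an element of `ℤ[t] ⊗ L(A)`. -/
def coeffL (n : ℕ) : ℤ[X] ⊗[ℤ] FreeLieRing A →ₗ[ℤ] FreeLieRing A :=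
  (TensorProduct.lid ℤ _).toLinearMap ∘ₗ LinearMap.rTensor _ (Polynomial.lcoeff ℤ n)

open Polynomial in
theorem coeffL_tmul (n : ℕ) (q : ℤ[X]) (u : FreeLieRing A) :
    coeffL A n (q ⊗ₜ u) = q.coeff n • u := rfl

open Polynomial in
theorem coeffL_lie (n : ℕ) (y z : ℤ[X] ⊗[ℤ] FreeLieRing A) :
    coeffL A n ⁅y, z⁆ =
      ∑ ij ∈ Finset.HasAntidiagonal.antidiagonal n, ⁅coeffL A ij.1 y, coeffL A ij.2 z⁆ := by
  induction y using TensorProduct.induction_on with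
  | zero => simp
  | add y y' hy hy' => simp only [add_lie, map_add, hy, hy', Finset.sum_add_distrib]
  | tmul q u =>
    induction z using TensorProduct.induction_on with
    | zero =>
      have h : ⁅q ⊗ₜ[ℤ] u, (0 : ℤ[X] ⊗[ℤ] FreeLieRing A)⁆ = 0 := by
        have h := LieRing.lie_add (q ⊗ₜ[ℤ] u) (0 : ℤ[X] ⊗[ℤ] FreeLieRing A) 0
        rwa [add_zero, left_eq_add] at h
      simp [h]
    | add y y' hy hy' =>
      have h : ⁅q ⊗ₜ[ℤ] u, y + y'⁆ = ⁅q ⊗ₜ[ℤ] u, y⁆ + ⁅q ⊗ₜ[ℤ] u, y'⁆ := LieRing.lie_add _ _ _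
      simp only [h, lie_add, map_add, hy, hy', Finset.sum_add_distrib]
    | tmul r v =>
      rw [LieAlgebra.ExtendScalars.bracket_tmul, coeffL_tmul, Polynomial.coeff_mul,
        Finset.sum_smul]
      refine Finset.sum_congr rfl fun ij _ => ?_
      rw [coeffL_tmul, coeffL_tmul, zsmul_lie, lie_zsmul, mul_smul]

variable (A) in
/-- The projection of `L(A)` onto its homogeneous component of degree `n`. -/
def gradProj (n : ℕ) : FreeLieRing A →+ FreeLieRing A :=
  ((coeffL A n) ∘ₗ (gradHom A : FreeLieRing A →ₗ[ℤ] _)).toAddMonoidHom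

theorem gradProj_ι (n : ℕ) (a : A) : gradProj A n (ι A a) = if n = 1 then ι A a else 0 := by
  have h : gradProj A n (ι A a) = coeffL A n (Polynomial.X ⊗ₜ ι A a) :=
    congrArg (coeffL A n) (lift_ι _ a)
  rw [h, coeffL_tmul, Polynomial.coeff_X]
  by_cases h : n = 1
  · simp [h]
  · simp [h, Ne.symm h]

theorem gradProj_lie (n : ℕ) (u v : FreeLieRing A) :
    gradProj A n ⁅u, v⁆ =
      ∑ ij ∈ Finset.HasAntidiagonal.antidiagonal n, ⁅gradProj A ij.1 u, gradProj A ij.2 v⁆ := by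
  have h : gradProj A n ⁅u, v⁆ = coeffL A n ⁅gradHom A u, gradHom A v⁆ :=
    congrArg (coeffL A n) (LieHom.map_lie _ u v)
  rw [h, coeffL_lie]; rfl

theorem gradProj_mem (n : ℕ) (u : FreeLieRing A) : gradProj A n u ∈ lieDeg A n := by
  induction u using lie_induction generalizing n with
  | ι a =>
    rw [gradProj_ι]
    split_ifs with h
    · subst h; exact ι_mem_lieDeg a
    · exact zero_mem _
  | add u v hu hv => rw [map_add]; exact add_mem (hu n) (hv n)
  | neg u hu => rw [map_neg]; exact neg_mem (hu n)
  | lie u v hu hv =>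
    rw [gradProj_lie]
    refine sum_mem fun ij hij => ?_
    rw [← Finset.HasAntidiagonal.mem_antidiagonal.1 hij]
    exact lie_mem_lieDeg (hu _) (hv _)

theorem gradProj_zero (u : FreeLieRing A) : gradProj A 0 u = 0 := by
  have h := gradProj_mem 0 u
  rwa [lieDeg_zero, AddSubgroup.mem_bot] at h

theorem gradProj_lie_ι (n : ℕ) (u : FreeLieRing A) (a : A) :
    gradProj A (n + 1) ⁅u, ι A a⁆ = ⁅gradProj A n u, ι A a⁆ := by
  rw [gradProj_lie, Finset.sum_eq_single (n, 1)]
  · rw [gradProj_ι, if_pos rfl]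
  · rintro ⟨i, j⟩ hij hne
    have hj : j ≠ 1 := by
      rintro rfl
      have := Finset.HasAntidiagonal.mem_antidiagonal.1 hij
      exact hne (Prod.ext (by simpa using this) rfl)
    rw [gradProj_ι, if_neg hj, lie_zero]
  · intro h; exact (h (Finset.HasAntidiagonal.mem_antidiagonal.2 rfl)).elim

theorem gradProj_of_mem {n : ℕ} {u : FreeLieRing A} (hu : u ∈ lieDeg A n) :
    gradProj A n u = u := by
  refine lieDeg_induction (P := fun n u => gradProj A n u = u) ?_ ?_ ?_ ?_ ?_ hu
  · intro a; rw [gradProj_ι, if_pos rfl]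
  · intro n; rw [map_zero]
  · intro n u v hu hv; rw [map_add, hu, hv]
  · intro n u hu; rw [map_neg, hu]
  · intro n u a _ hu; rw [gradProj_lie_ι, hu]

theorem gradProj_der (d : A →+ A) (n : ℕ) (u : FreeLieRing A) :
    gradProj A n (der d u) = der d (gradProj A n u) := by
  induction u using lie_induction generalizing n with
  | ι a => rw [der_ι, gradProj_ι, gradProj_ι]; split_ifs <;> simp
  | add u v hu hv => simp only [map_add, hu, hv]
  | neg u hu => simp only [map_neg, hu]
  | lie u v hu hv =>
    rw [LieDerivation.apply_lie_eq_add, map_add, gradProj_lie, gradProj_lie, gradProj_lie, map_sum,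
      ← Finset.sum_add_distrib]
    refine Finset.sum_congr rfl fun ij _ => ?_
    rw [LieDerivation.apply_lie_eq_add, hu, hv]

theorem gradProj_one_of_mem_derived₁ {u : FreeLieRing A} (hu : u ∈ derived₁ A) :
    gradProj A 1 u = 0 := by
  refine derivedSeries_succ_induction 0 (P := fun u => gradProj A 1 u = 0) (map_zero _) ?_ ?_ ?_ hu
  · intro u v hu hv; rw [map_add, hu, hv, add_zero]
  · intro u hu; rw [map_neg, hu, neg_zero]
  · intro u v _ _
    rw [gradProj_lie]
    refine Finset.sum_eq_zero fun ij hij => ?_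
    have h := Finset.HasAntidiagonal.mem_antidiagonal.1 hij
    have h' : ij.1 = 0 ∨ ij.2 = 0 := by omega
    rcases h' with h' | h' <;> rw [h', gradProj_zero] <;> simp

/-- The elements of `L(A)''` of degree `n` are sums of brackets of homogeneous elements of degree
at least two. -/
theorem gradProj_derived₂_mem_closure (n : ℕ) {u : FreeLieRing A} (hu : u ∈ derived₂ A) :
    gradProj A n u ∈ AddSubgroup.closure {w | ∃ i j, i + 2 + (j + 2) = n ∧
      ∃ v ∈ lieDeg A (i + 2), ∃ v' ∈ lieDeg A (j + 2), w = ⁅v, v'⁆} := by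
  refine derivedSeries_succ_induction 1 (P := fun u => gradProj A n u ∈ _) ?_ ?_ ?_ ?_ hu
  · rw [map_zero]; exact zero_mem _
  · intro u v hu hv; rw [map_add]; exact add_mem hu hv
  · intro u hu; rw [map_neg]; exact neg_mem hu
  · intro u v hu hv
    rw [gradProj_lie]
    refine sum_mem fun ij hij => ?_
    obtain ⟨i, j⟩ := ij
    have h := Finset.HasAntidiagonal.mem_antidiagonal.1 hij
    dsimp only at h ⊢
    match i, j with
    | 0, j => rw [gradProj_zero, zero_lie]; exact zero_mem _
    | 1, j => rw [gradProj_one_of_mem_derived₁ hu, zero_lie]; exact zero_mem _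
    | i + 2, 0 => rw [gradProj_zero, lie_zero]; exact zero_mem _
    | i + 2, 1 => rw [gradProj_one_of_mem_derived₁ hv, lie_zero]; exact zero_mem _
    | i + 2, j + 2 =>
      exact AddSubgroup.subset_closure
        ⟨i, j, h, _, gradProj_mem _ u, _, gradProj_mem _ v, rfl⟩

theorem gradProj_mem_derived₂ (n : ℕ) {u : FreeLieRing A} (hu : u ∈ derived₂ A) :
    gradProj A n u ∈ derived₂ A := by
  have h := gradProj_derived₂_mem_closure n hu
  refine (AddSubgroup.closure_le _).2 ?_ h
  rintro _ ⟨i, j, -, v, hv, v', hv', rfl⟩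
  exact lie_mem_derived₂ (mem_derivedSeries_one_of_mem_lieDeg hv)
    (mem_derivedSeries_one_of_mem_lieDeg hv')

end Grading

/-! ### Coinvariants -/

section Coinvariants

variable {X : Type*} {N N' : Type*} [AddCommGroup N] [AddCommGroup N']

/-- The subgroup `∑ₓ N x` of an abelian group `N` with operators `x ∈ X`; the quotient by it is the
group of coinvariants `N ⊗_U ℤ`. -/
def augSub (f : X → N →+ N) : AddSubgroup N := AddSubgroup.closure {m | ∃ x n, m = f x n}

theorem apply_mem_augSub (f : X → N →+ N) (x : X) (n : N) : f x n ∈ augSub f :=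
  AddSubgroup.subset_closure ⟨x, n, rfl⟩

theorem map_mem_augSub {f : X → N →+ N} {f' : X → N' →+ N'} (g : N →+ N')
    (h : ∀ x n, g (f x n) = f' x (g n)) {n : N} (hn : n ∈ augSub f) : g n ∈ augSub f' := by
  induction hn using AddSubgroup.closure_induction with
  | mem n hn => obtain ⟨x, m, rfl⟩ := hn; rw [h]; exact apply_mem_augSub f' x _
  | zero => rw [map_zero]; exact zero_mem _
  | add u v _ _ hu hv => rw [map_add]; exact add_mem hu hv
  | neg u _ hu => rw [map_neg]; exact neg_mem hu

open scoped IsMulCommutative in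
/-- The action of the polynomial ring by pairwise commuting endomorphisms. -/
theorem exists_polynomial_action (f : X → AddMonoid.End N) (h : ∀ x y, f x * f y = f y * f x) :
    ∃ ρ : MvPolynomial X ℤ →ₐ[ℤ] AddMonoid.End N, ∀ x, ρ (MvPolynomial.X x) = f x := by
  have : IsMulCommutative (Algebra.adjoin ℤ (Set.range f)) :=
    Algebra.isMulCommutative_adjoin ℤ (by rintro _ ⟨x, rfl⟩ _ ⟨y, rfl⟩; exact h x y)
  refine ⟨(Algebra.adjoin ℤ (Set.range f)).val.comp (MvPolynomial.aeval fun x : X =>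
      (⟨f x, Algebra.subset_adjoin ⟨x, rfl⟩⟩ : Algebra.adjoin ℤ (Set.range f))), fun x => ?_⟩
  simp

theorem repr_smul_apply {Y U A : Type*} [CommRing U] [AddCommGroup A] [Module U A]
    (e : Module.Basis Y U A) (q : U) (a : A) (y : Y) : e.repr (q • a) y = q * e.repr a y := by
  simp

/-- If `A` is a free `U`-module and `B` is a torsion-free abelian group on which `U` acts, then the
coinvariants of `A ⊗ B` under the diagonal action form a torsion-free group. The reason is that
`U ⊗ B` with the diagonal action is isomorphic to `U ⊗ B` with the action on the first factor,
by means of the antipode `x ↦ -x` of `U`. -/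
theorem mem_augSub_of_zsmul_mem {A B : Type*} [AddCommGroup A] [Module (MvPolynomial X ℤ) A]
    [Module.Free (MvPolynomial X ℤ) A] [AddCommGroup B] [Module.IsTorsionFree ℤ B]
    (fB : X → B →+ B) (hB : ∀ x y b, fB x (fB y b) = fB y (fB x b))
    (f : X → A ⊗[ℤ] B →+ A ⊗[ℤ] B)
    (hf : ∀ x a b, f x (a ⊗ₜ b) = ((MvPolynomial.X x : MvPolynomial X ℤ) • a) ⊗ₜ b +
      a ⊗ₜ fB x b)
    {k : ℤ} (hk : k ≠ 0) {n : A ⊗[ℤ] B} (hn : k • n ∈ augSub f) : n ∈ augSub f := by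
  classical
  obtain ⟨ρ, hρ⟩ := exists_polynomial_action (fun x => -(fB x : AddMonoid.End B))
    (fun x y => AddMonoidHom.ext fun b => by
      change -(fB x (-(fB y b))) = -(fB y (-(fB x b)))
      rw [map_neg, map_neg, hB])
  have hρX : ∀ u x b, ρ (u * MvPolynomial.X x) b = -ρ u (fB x b) := fun u x b => by
    rw [map_mul, hρ]
    change ρ u (-(fB x b)) = _
    rw [map_neg]
  have hρadd : ∀ u v b, ρ (u + v) b = ρ u b + ρ v b := fun u v b => by rw [map_add]; rfl
  let e := Module.Free.chooseBasis (MvPolynomial X ℤ) A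
  let Y := Module.Free.ChooseBasisIndex (MvPolynomial X ℤ) A
  -- The coinvariants are identified with the torsion-free group `Y →₀ B` by the mutually inverse
  -- maps `r` and `s`; here `ρ` is the action of `U` on `B` twisted by the antipode.
  let r : A ⊗[ℤ] B →+ (Y →₀ B) := TensorProduct.liftAddHom
    (AddMonoidHom.mk' (fun a => AddMonoidHom.mk'
      (fun b => Finsupp.mapRange (fun u => ρ u b) (by rw [map_zero]; rfl) (e.repr a))
      fun b b' => by ext y; simp)
      fun a a' => by
        ext b y
        simp only [AddMonoidHom.mk'_apply, AddMonoidHom.add_apply, Finsupp.mapRange_apply,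
          Finsupp.add_apply, map_add e.repr, hρadd])
    (fun k a b => by
      ext y
      change ρ (e.repr (k • a) y) b = ρ (e.repr a y) (k • b)
      rw [map_zsmul, Finsupp.smul_apply, map_zsmul, map_zsmul]
      rfl)
  have hr : ∀ a b y, r (a ⊗ₜ b) y = ρ (e.repr a y) b := fun _ _ _ => rfl
  have hr0 : ∀ n ∈ augSub f, r n = 0 := by
    intro n hn
    induction hn using AddSubgroup.closure_induction with
    | mem n hn =>
      obtain ⟨x, m, rfl⟩ := hn
      induction m using TensorProduct.induction_on with
      | zero => simp
      | tmul a b =>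
        ext y
        rw [hf, map_add, Finsupp.add_apply, hr, hr, repr_smul_apply, mul_comm, hρX, neg_add_cancel]
        rfl
      | add m m' hm hm' => rw [map_add, map_add, hm, hm', add_zero]
    | zero => rw [map_zero]
    | add u v _ _ hu hv => rw [map_add, hu, hv, add_zero]
    | neg u _ hu => rw [map_neg, hu, neg_zero]
  let s : (Y →₀ B) →+ A ⊗[ℤ] B := Finsupp.liftAddHom fun y =>
    AddMonoidHom.mk' (fun b => e y ⊗ₜ b) fun b b' => TensorProduct.tmul_add _ _ _
  have key : ∀ (y : Y) (u : MvPolynomial X ℤ) (b : B),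
      (u • e y) ⊗ₜ[ℤ] b - e y ⊗ₜ[ℤ] ρ u b ∈ augSub f := by
    intro y u
    induction u using MvPolynomial.induction_on with
    | C m =>
      intro b
      have h1 : (MvPolynomial.C m : MvPolynomial X ℤ) = algebraMap ℤ _ m := rfl
      have h2 : ρ (algebraMap ℤ _ m) b = m • b := by
        rw [AlgHom.commutes, Algebra.algebraMap_eq_smul_one]
        rfl
      rw [h1, h2, algebraMap_smul, TensorProduct.smul_tmul, sub_self]
      exact zero_mem _
    | add u v hu hv =>
      intro b
      rw [hρadd, add_smul, TensorProduct.add_tmul, TensorProduct.tmul_add, add_sub_add_comm]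
      exact add_mem (hu b) (hv b)
    | mul_X u x hu =>
      intro b
      have h := hf x (u • e y) b
      rw [hρX, mul_comm, mul_smul, ← sub_eq_iff_eq_add.2 h, TensorProduct.tmul_neg, sub_neg_eq_add,
        sub_add]
      exact sub_mem (apply_mem_augSub f x _) (hu _)
  have hsr : ∀ n, n - s (r n) ∈ augSub f := by
    intro n
    induction n using TensorProduct.induction_on with
    | zero => simp
    | add m m' hm hm' => rw [map_add, map_add, add_sub_add_comm]; exact add_mem hm hm'
    | tmul a b =>
      rw [← e.linearCombination_repr a]
      induction e.repr a using Finsupp.induction_linear with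
      | zero => simp
      | add l l' hl hl' =>
        rw [map_add, TensorProduct.add_tmul, map_add, map_add, add_sub_add_comm]
        exact add_mem hl hl'
      | single y u =>
        have h1 : r ((u • e y) ⊗ₜ b) = Finsupp.single y (ρ u b) := by
          ext y'
          rw [hr, repr_smul_apply, Module.Basis.repr_self]
          by_cases h : y = y'
          · subst h; rw [Finsupp.single_eq_same, Finsupp.single_eq_same, mul_one]
          · rw [Finsupp.single_eq_of_ne (Ne.symm h), Finsupp.single_eq_of_ne (Ne.symm h), mul_zero,
              map_zero]
            rfl
        rw [Finsupp.linearCombination_single, h1]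
        have h2 : s (Finsupp.single y (ρ u b)) = e y ⊗ₜ[ℤ] ρ u b :=
          Finsupp.liftAddHom_apply_single _ _ _
        rw [h2]
        exact key y u b
  have h0 : r n = 0 := by
    have h1 := hr0 _ hn
    rw [map_zsmul] at h1
    ext y
    exact (smul_eq_zero_iff_right hk).1 (DFunLike.congr_fun h1 y)
  have h := hsr n
  rwa [h0, map_zero, sub_zero] at h

end Coinvariants

section TensorInt

variable {X : Type*} {N : Type*} [AddCommGroup N] [Module (MvPolynomial X ℤ) N]

variable (X N) in
/-- The variables as operators on a `U`-module. -/
def varOp (x : X) : N →+ N := DistribSMul.toAddMonoidHom N (MvPolynomial.X x : MvPolynomial X ℤ)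

@[simp]
theorem varOp_apply (x : X) (n : N) :
    varOp X N x n = (MvPolynomial.X x : MvPolynomial X ℤ) • n := rfl

theorem trivial_smul (q : MvPolynomial X ℤ) (z : ℤ) : q • z = MvPolynomial.constantCoeff q * z :=
  rfl

theorem smul_sub_constantCoeff_mem (q : MvPolynomial X ℤ) (n : N) :
    q • n - MvPolynomial.constantCoeff q • n ∈ augSub (varOp X N) := by
  induction q using MvPolynomial.induction_on generalizing n with
  | C m =>
    have h1 : (MvPolynomial.C m : MvPolynomial X ℤ) = algebraMap ℤ _ m := rfl
    rw [MvPolynomial.constantCoeff_C, h1, algebraMap_smul, sub_self]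
    exact zero_mem _
  | add u v hu hv =>
    rw [map_add, add_smul, add_smul, add_sub_add_comm]
    exact add_mem (hu n) (hv n)
  | mul_X u x hu =>
    rw [map_mul, MvPolynomial.constantCoeff_X, mul_zero, zero_smul, sub_zero, mul_comm, mul_smul]
    exact apply_mem_augSub (varOp X N) x (u • n)

/-- `N ⊗_U ℤ` is the quotient of `N` by the subgroup `∑ₓ x N`. -/
theorem tmul_one_eq_zero_iff (n : N) :
    n ⊗ₜ[MvPolynomial X ℤ] (1 : ℤ) = 0 ↔ n ∈ augSub (varOp X N) := by
  constructor
  · intro h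
    let g : N ⊗[MvPolynomial X ℤ] ℤ →+ N ⧸ augSub (varOp X N) :=
      TensorProduct.liftAddHom
        (AddMonoidHom.mk' (fun n => AddMonoidHom.mk'
          (fun z : ℤ => z • (QuotientAddGroup.mk n : N ⧸ augSub (varOp X N)))
          fun z w => add_smul _ _ _)
          fun n m => by ext; simp)
        (fun q n z => by
          simp only [AddMonoidHom.mk'_apply, trivial_smul]
          rw [mul_comm, mul_smul]
          congr 1
          rw [← sub_eq_zero, ← QuotientAddGroup.mk_zsmul, ← QuotientAddGroup.mk_sub,
            QuotientAddGroup.eq_zero_iff]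
          exact smul_sub_constantCoeff_mem q n)
    have h1 : g (n ⊗ₜ 1) = (1 : ℤ) • (QuotientAddGroup.mk n : N ⧸ augSub (varOp X N)) := rfl
    rw [h, map_zero, one_smul] at h1
    exact (QuotientAddGroup.eq_zero_iff n).1 h1.symm
  · intro h
    induction h using AddSubgroup.closure_induction with
    | mem n hn =>
      obtain ⟨x, m, rfl⟩ := hn
      rw [varOp_apply, TensorProduct.smul_tmul, trivial_smul, MvPolynomial.constantCoeff_X,
        zero_mul, TensorProduct.tmul_zero]
    | zero => rw [TensorProduct.zero_tmul]
    | add u v _ _ hu hv => rw [TensorProduct.add_tmul, hu, hv, add_zero]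
    | neg u _ hu => rw [TensorProduct.neg_tmul, hu, neg_zero]

theorem exists_tmul_one (t : N ⊗[MvPolynomial X ℤ] ℤ) : ∃ n : N, t = n ⊗ₜ 1 := by
  induction t using TensorProduct.induction_on with
  | zero => exact ⟨0, (TensorProduct.zero_tmul _ _).symm⟩
  | tmul n z =>
    refine ⟨(MvPolynomial.C z : MvPolynomial X ℤ) • n, ?_⟩
    rw [TensorProduct.smul_tmul, trivial_smul, MvPolynomial.constantCoeff_C, mul_one]
  | add t t' ht ht' =>
    obtain ⟨n, rfl⟩ := ht
    obtain ⟨n', rfl⟩ := ht'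
    exact ⟨n + n', (TensorProduct.add_tmul _ _ _).symm⟩

/-- An additive map that commutes with the action of the variables is `U`-linear. -/
def linearOfVarOp {N' : Type*} [AddCommGroup N'] [Module (MvPolynomial X ℤ) N'] (g : N →+ N')
    (h : ∀ (x : X) n, g ((MvPolynomial.X x : MvPolynomial X ℤ) • n) =
      (MvPolynomial.X x : MvPolynomial X ℤ) • g n) : N →ₗ[MvPolynomial X ℤ] N' where
  toFun := g
  map_add' := map_add g
  map_smul' q := by
    induction q using MvPolynomial.induction_on with
    | C m =>
      intro n
      have h1 : (MvPolynomial.C m : MvPolynomial X ℤ) = algebraMap ℤ _ m := rfl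
      rw [RingHom.id_apply, h1, algebraMap_smul, algebraMap_smul, map_zsmul]
    | add u v hu hv =>
      intro n
      rw [add_smul, map_add, hu, hv, RingHom.id_apply, RingHom.id_apply, RingHom.id_apply, add_smul]
    | mul_X u x hu =>
      intro n
      rw [mul_smul, hu, h, RingHom.id_apply, RingHom.id_apply, mul_smul]

end TensorInt

/-! ### A criterion for vanishing in prime degree -/

section PrimeDegree

variable {A : Type*} [AddCommGroup A]

/-- The endomorphism of `L(A)` induced by an endomorphism of `A`. -/
def mapL (s : A →+ A) : FreeLieRing A →ₗ⁅ℤ⁆ FreeLieRing A := lift ((ι A).comp s)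

@[simp]
theorem mapL_ι (s : A →+ A) (a : A) : mapL s (ι A a) = ι A (s a) := lift_ι _ a

theorem mapL_comp (s t : A →+ A) (u : FreeLieRing A) : mapL (s.comp t) u = mapL s (mapL t u) := by
  have h : mapL (s.comp t) = (mapL s).comp (mapL t) := hom_ext fun a => by simp
  rw [h]; rfl

theorem mapL_id (u : FreeLieRing A) : mapL (AddMonoidHom.id A) u = u := by
  have h : mapL (AddMonoidHom.id A) = LieHom.id := hom_ext fun a => by simp
  rw [h]; rfl

theorem mapL_lieProd (s : A →+ A) {n : ℕ} (a : Fin n → A) :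
    mapL s (lieProd a) = lieProd fun i => s (a i) := by
  match n with
  | 0 => exact map_zero _
  | n + 1 =>
    induction n with
    | zero => simp [lieProd_one]
    | succ n ih => rw [lieProd_succ_succ, LieHom.map_lie, ih, mapL_ι, lieProd_succ_succ]

theorem lieProd_eq_zero {n : ℕ} (a : Fin n → A) (i : Fin n) (h : a i = 0) : lieProd a = 0 := by
  match n with
  | 0 => exact i.elim0
  | n + 1 =>
    induction n with
    | zero => rw [lieProd_one, ← Fin.fin_one_eq_zero i, h, map_zero]
    | succ n ih =>
      rw [lieProd_succ_succ]
      induction i using Fin.lastCases with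
      | last => rw [h, map_zero, lie_zero]
      | cast i => rw [ih _ i h, zero_lie]

theorem lieProd_const {n : ℕ} (a : A) : lieProd (fun _ : Fin (n + 2) => a) = 0 := by
  induction n with
  | zero => exact lie_self _
  | succ n ih => rw [lieProd_succ_succ, ih, zero_lie]

theorem der_lieProd (d : A →+ A) {n : ℕ} (a : Fin n → A) :
    der d (lieProd a) = ∑ i, lieProd (Function.update a i (d (a i))) := by
  rw [lieProd, leftNormed_derivation]
  refine Finset.sum_congr rfl fun i _ => ?_
  rw [lieProd, der_ι]
  congr 1
  funext j
  by_cases h : j = i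
  · subst h; simp
  · simp [Function.update_of_ne h]

variable {Y : Type*} (b : Module.Basis Y ℤ A)

theorem basis_induction {P : A → Prop} (zero : P 0) (add : ∀ a a', P a → P a' → P (a + a'))
    (neg : ∀ a, P a → P (-a)) (mem : ∀ y, P (b y)) (a : A) : P a := by
  have h : a ∈ Submodule.span ℤ (Set.range b) := by rw [b.span_eq]; trivial
  rw [← Submodule.mem_toAddSubgroup, Submodule.span_int_eq_addSubgroupClosure] at h
  induction h using AddSubgroup.closure_induction with
  | mem a h => obtain ⟨y, rfl⟩ := h; exact mem y
  | zero => exact zero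
  | add a a' _ _ h h' => exact add _ _ h h'
  | neg a _ h => exact neg _ h

theorem lieDeg_eq_closure_basis (n : ℕ) {u : FreeLieRing A} (hu : u ∈ lieDeg A n) :
    u ∈ AddSubgroup.closure (Set.range fun f : Fin n → Y => lieProd fun i => b (f i)) := by
  refine lieDeg_induction (P := fun n u => u ∈ AddSubgroup.closure
    (Set.range fun f : Fin n → Y => lieProd fun i => b (f i))) ?_ ?_ ?_ ?_ ?_ hu
  · intro a
    induction a using basis_induction b with
    | zero => rw [map_zero]; exact zero_mem _
    | add a a' h h' => rw [map_add]; exact add_mem h h'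
    | neg a h => rw [map_neg]; exact neg_mem h
    | mem y => exact AddSubgroup.subset_closure ⟨fun _ => y, rfl⟩
  · intro n; exact zero_mem _
  · intro n u v hu hv; exact add_mem hu hv
  · intro n u hu; exact neg_mem hu
  · intro n u a hu0 hu
    clear hu0
    induction a using basis_induction b with
    | zero => rw [map_zero, lie_zero]; exact zero_mem _
    | add a a' h h' => rw [map_add, lie_add]; exact add_mem h h'
    | neg a h => rw [map_neg, lie_neg]; exact neg_mem h
    | mem y =>
      induction hu using AddSubgroup.closure_induction with
      | mem u hu =>
        obtain ⟨f, rfl⟩ := hu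
        refine AddSubgroup.subset_closure ⟨Fin.snoc f y, ?_⟩
        dsimp only
        rw [← lieProd_snoc]
        congr 1
        funext i
        induction i using Fin.lastCases with
        | last => simp
        | cast i => simp
      | zero => rw [zero_lie]; exact zero_mem _
      | add u v _ _ hu hv => rw [add_lie]; exact add_mem hu hv
      | neg u _ hu => rw [neg_lie]; exact neg_mem hu

/-- The projection of `A` onto the span of the basis element `y`. -/
def coordProj (y : Y) : A →+ A :=
  AddMonoidHom.mk' (fun a => b.repr a y • b y) fun a a' => by
    rw [map_add, Finsupp.add_apply, add_smul]

theorem coordProj_self (y : Y) : coordProj b y (b y) = b y := by simp [coordProj]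

theorem coordProj_of_ne {y y' : Y} (h : y' ≠ y) : coordProj b y (b y') = 0 := by
  simp [coordProj, h]

/-- The projection of `A` that kills the basis element `y`. -/
def coordKill (y : Y) : A →+ A := AddMonoidHom.id A - coordProj b y

theorem coordKill_self (y : Y) : coordKill b y (b y) = 0 := by
  simp [coordKill, coordProj_self]

theorem coordKill_of_ne {y y' : Y} (h : y' ≠ y) : coordKill b y (b y') = b y' := by
  simp [coordKill, coordProj_of_ne b h]

open Classical in
theorem der_coordProj_lieProd (y : Y) {n : ℕ} (f : Fin n → Y) :
    der (coordProj b y) (lieProd fun i => b (f i)) =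
      (Finset.univ.filter fun i => f i = y).card • lieProd fun i => b (f i) := by
  rw [der_lieProd, ← Finset.sum_filter_add_sum_filter_not _ (fun i => f i = y)]
  have h1 : ∀ i ∈ Finset.univ.filter (fun i => f i = y),
      lieProd (Function.update (fun i => b (f i)) i (coordProj b y (b (f i)))) =
        lieProd fun i => b (f i) := by
    intro i hi
    have hi := (Finset.mem_filter.1 hi).2
    rw [hi, coordProj_self, ← hi]
    congr 1
    exact Function.update_eq_self i _
  have h2 : ∀ i ∈ Finset.univ.filter (fun i => ¬ f i = y),
      lieProd (Function.update (fun i => b (f i)) i (coordProj b y (b (f i)))) = 0 := by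
    intro i hi
    refine lieProd_eq_zero _ i ?_
    rw [Function.update_self, coordProj_of_ne b (Finset.mem_filter.1 hi).2]
  rw [Finset.sum_congr rfl h1, Finset.sum_congr rfl h2, Finset.sum_const_zero, add_zero,
    Finset.sum_const]

/-- The operator `(D - 1) (D - 2) ⋯ (D - k)` for `D = der d`, which annihilates the eigenvectors of
`D` with eigenvalues `1, …, k`. -/
def fallingDer (d : A →+ A) : ℕ → FreeLieRing A → FreeLieRing A
  | 0, u => u
  | k + 1, u => der d (fallingDer d k u) - ((k : ℤ) + 1) • fallingDer d k u

theorem fallingDer_add (d : A →+ A) (k : ℕ) (u v : FreeLieRing A) :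
    fallingDer d k (u + v) = fallingDer d k u + fallingDer d k v := by
  induction k with
  | zero => rfl
  | succ k ih => simp only [fallingDer, ih, map_add, smul_add]; abel

theorem fallingDer_neg (d : A →+ A) (k : ℕ) (u : FreeLieRing A) :
    fallingDer d k (-u) = -fallingDer d k u := by
  induction k with
  | zero => rfl
  | succ k ih => simp only [fallingDer, ih, map_neg, smul_neg]; abel

theorem fallingDer_of_eigen (d : A →+ A) (k i : ℕ) {u : FreeLieRing A} (h : der d u = i • u) :
    fallingDer d k u = (∏ j ∈ Finset.range k, ((i : ℤ) - (j + 1))) • u := by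
  induction k with
  | zero => simp [fallingDer]
  | succ k ih =>
    rw [fallingDer, ih, map_smul, h, Finset.prod_range_succ, smul_smul, ← natCast_zsmul, smul_smul,
      ← sub_smul]
    congr 1; ring

theorem fallingDer_sub_mem (d : A →+ A) (k : ℕ) (J : AddSubgroup (FreeLieRing A))
    (hJ : ∀ u ∈ J, der d u ∈ J) {v : FreeLieRing A} (hv : der d v ∈ J) :
    fallingDer d k v - (∏ j ∈ Finset.range k, ((0 : ℤ) - (j + 1))) • v ∈ J := by
  induction k with
  | zero => simp [fallingDer]
  | succ k ih =>
    set c := ∏ j ∈ Finset.range k, ((0 : ℤ) - (j + 1))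
    have h1 : der d (fallingDer d k v) ∈ J := by
      have h2 := add_mem (hJ _ ih) (J.zsmul_mem hv c)
      rwa [map_sub, map_smul, sub_add_cancel] at h2
    rw [fallingDer, Finset.prod_range_succ]
    have h3 : der d (fallingDer d k v) - ((k : ℤ) + 1) • fallingDer d k v -
        (c * (0 - ((k : ℤ) + 1))) • v = der d (fallingDer d k v) -
          ((k : ℤ) + 1) • (fallingDer d k v - c • v) := by
      rw [smul_sub, smul_smul, zero_sub, mul_neg, neg_smul, mul_comm c]; abel
    rw [h3]
    exact sub_mem h1 (J.zsmul_mem ih _)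

/-- On `L^{n+2}(A)`, the operator `(D - 1) ⋯ (D - (n + 1))` for the derivation `D` that counts the
occurrences of `y` is a multiple of the projection onto the part free of `y`. The eigenvalue `n + 2`
is missing from the product, but it belongs to `[y, …, y] = 0`. -/
theorem fallingDer_coordProj (y : Y) (n : ℕ) {u : FreeLieRing A} (hu : u ∈ lieDeg A (n + 2)) :
    fallingDer (coordProj b y) (n + 1) u =
      (∏ j ∈ Finset.range (n + 1), ((0 : ℤ) - (j + 1))) • mapL (coordKill b y) u := by
  classical
  replace hu := lieDeg_eq_closure_basis b _ hu
  induction hu using AddSubgroup.closure_induction with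
  | mem u hu =>
    obtain ⟨f, rfl⟩ := hu
    dsimp only
    rw [fallingDer_of_eigen _ _ _ (der_coordProj_lieProd b y f), mapL_lieProd]
    by_cases h : ∃ i, f i = y
    · obtain ⟨i, hi⟩ := h
      have h1 : (lieProd fun i => coordKill b y (b (f i))) = 0 :=
        lieProd_eq_zero _ i (by rw [hi, coordKill_self])
      rw [h1, smul_zero]
      set c := (Finset.univ.filter fun i => f i = y).card with hc
      have hc0 : 0 < c := Finset.card_pos.2 ⟨i, Finset.mem_filter.2 ⟨Finset.mem_univ _, hi⟩⟩
      have hcn : c ≤ n + 2 := by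
        simpa using Finset.card_le_univ (Finset.univ.filter fun i => f i = y)
      -- Either one of the factors `c - (j + 1)` vanishes, or all letters are equal to `y`.
      rcases hcn.lt_or_eq with hlt | heq
      · have h2 : ∏ j ∈ Finset.range (n + 1), ((c : ℤ) - (j + 1)) = 0 := by
          refine Finset.prod_eq_zero (Finset.mem_range.2 (show c - 1 < n + 1 by omega)) ?_
          omega
        rw [h2, zero_smul]
      · have h2 : ∀ i, f i = y := by
          have h3 : (Finset.univ.filter fun i => f i = y) = Finset.univ :=
            (Finset.card_eq_iff_eq_univ _).1 (by simpa using heq)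
          intro i
          have h4 : i ∈ Finset.univ.filter fun i => f i = y := by rw [h3]; exact Finset.mem_univ i
          exact (Finset.mem_filter.1 h4).2
        simp only [h2, lieProd_const, smul_zero]
    · push Not at h
      have h1 : (Finset.univ.filter fun i => f i = y) = ∅ :=
        Finset.filter_eq_empty_iff.2 fun i _ => h i
      rw [h1, Finset.card_empty]
      simp only [coordKill_of_ne b (h _), Nat.cast_zero]
  | zero => simpa [fallingDer_neg, fallingDer_add] using fallingDer_add (coordProj b y) (n + 1) 0 0
  | add u v _ _ hu hv => rw [fallingDer_add, hu, hv, map_add, smul_add]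
  | neg u _ hu => rw [fallingDer_neg, hu, map_neg, smul_neg]

theorem isCoprime_prod {p : ℕ} (hp : p.Prime) (k : ℕ) (hk : k < p) :
    IsCoprime (∏ j ∈ Finset.range k, ((0 : ℤ) - (j + 1))) (p : ℤ) := by
  refine IsCoprime.prod_left fun j hj => ?_
  rw [zero_sub, IsCoprime.neg_left_iff]
  have h : Nat.Coprime (j + 1) p :=
    (hp.coprime_iff_not_dvd.2 (Nat.not_dvd_of_pos_of_lt (Nat.succ_pos j)
      (by have := Finset.mem_range.1 hj; omega))).symm
  exact_mod_cast Nat.isCoprime_iff_coprime.2 h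

theorem mem_of_coprime_smul_mem {M : Type*} [AddCommGroup M] (J : AddSubgroup M) {m n : ℤ}
    (h : IsCoprime m n) {v : M} (hm : m • v ∈ J) (hn : n • v ∈ J) : v ∈ J := by
  obtain ⟨a, b, hab⟩ := h
  have h1 := add_mem (J.zsmul_mem hm a) (J.zsmul_mem hn b)
  rwa [smul_smul, smul_smul, ← add_smul, hab, one_smul] at h1

theorem sub_mapL_coordKill_mem {p : ℕ} (hp : p.Prime) (J : AddSubgroup (FreeLieRing A))
    (hJd : ∀ (d : A →+ A), ∀ u ∈ J, der d u ∈ J) (hJs : ∀ (s : A →+ A), ∀ u ∈ J, mapL s u ∈ J)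
    {v : FreeLieRing A} (hv : v ∈ lieDeg A p) (hpv : p • v ∈ J) (hder : ∀ d, der d v ∈ J) (y : Y) :
    v - mapL (coordKill b y) v ∈ J := by
  obtain ⟨n, rfl⟩ : ∃ n, p = n + 2 := ⟨p - 2, by have := hp.two_le; omega⟩
  refine mem_of_coprime_smul_mem J (isCoprime_prod hp (n + 1) (by omega)) ?_ ?_
  · have h := fallingDer_sub_mem (coordProj b y) (n + 1) J (hJd _) (hder _)
    rw [fallingDer_coordProj b y n hv, ← neg_mem_iff, neg_sub, ← smul_sub] at h
    exact h
  · rw [natCast_zsmul, smul_sub, ← map_nsmul]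
    exact sub_mem hpv (hJs _ _ hpv)

theorem exists_finset_mapL_eq_zero [DecidableEq Y] (n : ℕ) {v : FreeLieRing A}
    (hv : v ∈ lieDeg A (n + 1)) : ∃ F : Finset Y, ∀ s : A →+ A, (∀ y ∈ F, s (b y) = 0) →
      mapL s v = 0 := by
  replace hv := lieDeg_eq_closure_basis b _ hv
  induction hv using AddSubgroup.closure_induction with
  | mem u hu =>
    obtain ⟨f, rfl⟩ := hu
    refine ⟨{f 0}, fun s hs => ?_⟩
    dsimp only
    rw [mapL_lieProd]
    exact lieProd_eq_zero _ 0 (hs _ (Finset.mem_singleton_self _))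
  | zero => exact ⟨∅, fun s _ => map_zero _⟩
  | add u v _ _ hu hv =>
    obtain ⟨F, hF⟩ := hu
    obtain ⟨F', hF'⟩ := hv
    refine ⟨F ∪ F', fun s hs => ?_⟩
    rw [map_add, hF s fun y hy => hs y (Finset.mem_union_left _ hy),
      hF' s fun y hy => hs y (Finset.mem_union_right _ hy), add_zero]
  | neg u _ hu =>
    obtain ⟨F, hF⟩ := hu
    exact ⟨F, fun s hs => by rw [map_neg, hF s hs, neg_zero]⟩

/-- An element `v` of prime degree `p` belongs to a subgroup `J` of `L(A)` that is invariant under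
the endomorphisms and derivations coming from `A` as soon as `p v` and all `der d v` do.

The point is that on `L^p(A)` the derivation `D` counting the occurrences of a basis element has
eigenvalues between `0` and `p - 1`, as there is no nonzero Lie product of degree `p` in
a single letter. Since `D v = 0` modulo `J`, only the part of eigenvalue `0` of `v`, which does
not involve the chosen basis element, survives. -/
theorem mem_of_der_mem [Module.Free ℤ A] {p : ℕ} (hp : p.Prime) (J : AddSubgroup (FreeLieRing A))
    (hJd : ∀ (d : A →+ A), ∀ u ∈ J, der d u ∈ J) (hJs : ∀ (s : A →+ A), ∀ u ∈ J, mapL s u ∈ J)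
    {v : FreeLieRing A} (hv : v ∈ lieDeg A p) (hpv : p • v ∈ J) (hder : ∀ d, der d v ∈ J) :
    v ∈ J := by
  classical
  let b := Module.Free.chooseBasis ℤ A
  -- Kill the basis elements in a finite set one after another; only finitely many occur in `v`.
  have key : ∀ F : Finset (Module.Free.ChooseBasisIndex ℤ A), ∃ s : A →+ A,
      (∀ y ∈ F, s (b y) = 0) ∧ (∀ y ∉ F, s (b y) = b y) ∧ v - mapL s v ∈ J := by
    intro F
    induction F using Finset.induction_on with
    | empty =>
      exact ⟨AddMonoidHom.id A, by simp, by simp, by rw [mapL_id, sub_self]; exact zero_mem _⟩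
    | insert y F hy ih =>
      obtain ⟨s, hs, hs', hsv⟩ := ih
      refine ⟨(coordKill b y).comp s, ?_, ?_, ?_⟩
      · intro z hz
        rw [AddMonoidHom.comp_apply]
        rcases Finset.mem_insert.1 hz with rfl | hz
        · rw [hs' _ hy, coordKill_self]
        · rw [hs _ hz, map_zero]
      · intro z hz
        rw [Finset.mem_insert, not_or] at hz
        rw [AddMonoidHom.comp_apply, hs' _ hz.2, coordKill_of_ne b hz.1]
      · have h := add_mem (sub_mapL_coordKill_mem b hp J hJd hJs hv hpv hder y)
          (hJs (coordKill b y) _ hsv)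
        rwa [map_sub, sub_add_sub_cancel, ← mapL_comp] at h
  obtain ⟨n, rfl⟩ : ∃ n, p = n + 1 := ⟨p - 1, by have := hp.two_le; omega⟩
  obtain ⟨F, hF⟩ := exists_finset_mapL_eq_zero b n hv
  obtain ⟨s, hs, -, hsv⟩ := key F
  rwa [hF s hs, sub_zero] at hsv

theorem der_eq_zero_of_toTensor_eq_zero {u : FreeLieRing A} (h : toTensor A u = 0) (d : A →+ A) :
    der d u = 0 := by
  rw [← evalAct_fox_toTensor, h, map_zero, map_zero]

/-- In prime degree, the canonical map from the Lie power to the tensor ring is injective. -/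
theorem eq_zero_of_toTensor_eq_zero [Module.Free ℤ A] {p : ℕ} (hp : p.Prime) {u : FreeLieRing A}
    (hu : u ∈ lieDeg A p) (h : toTensor A u = 0) : u = 0 := by
  have h1 := der_eq_zero_of_toTensor_eq_zero h
  refine AddSubgroup.mem_bot.1 (mem_of_der_mem hp ⊥ ?_ ?_ hu ?_ ?_)
  · intro d u hu; rw [AddSubgroup.mem_bot.1 hu, map_zero]; exact zero_mem _
  · intro d u hu; rw [AddSubgroup.mem_bot.1 hu, map_zero]; exact zero_mem _
  · rw [← der_id hu, h1]; exact zero_mem _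
  · intro d; rw [h1]; exact zero_mem _

theorem eq_zero_of_zsmul_eq_zero [Module.Free ℤ A] {p : ℕ} (hp : p.Prime) {u : FreeLieRing A}
    (hu : u ∈ lieDeg A p) {k : ℤ} (hk : k ≠ 0) (h : k • u = 0) : u = 0 := by
  refine eq_zero_of_toTensor_eq_zero hp hu ?_
  have h1 : k • toTensor A u = 0 := by rw [← map_zsmul, h, map_zero]
  exact (smul_eq_zero_iff_right hk).1 h1

/-- In prime degree `p`, the canonical map from the Lie power to the tensor ring remains injective
modulo `p`. -/
theorem exists_nsmul_eq_of_toTensor_eq [Module.Free ℤ A] {p : ℕ} (hp : p.Prime)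
    {u : FreeLieRing A} (hu : u ∈ lieDeg A p) {x : TensorAlgebra ℤ A}
    (h : toTensor A u = p • x) : ∃ v ∈ lieDeg A p, p • v = u := by
  have h1 : u ∈ (nsmulAddMonoidHom (α := FreeLieRing A) p).range := by
    refine mem_of_der_mem hp _ ?_ ?_ hu ⟨u, rfl⟩ ?_
    · rintro d _ ⟨w, rfl⟩
      exact ⟨der d w, (map_nsmul (der d) p w).symm⟩
    · rintro s _ ⟨w, rfl⟩
      exact ⟨mapL s w, (map_nsmul (mapL s) p w).symm⟩
    · intro d
      rw [← evalAct_fox_toTensor, h, map_nsmul, map_nsmul]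
      exact ⟨_, rfl⟩
  obtain ⟨w, hw⟩ := h1
  refine ⟨gradProj A p w, gradProj_mem p w, ?_⟩
  rw [← map_nsmul, ← gradProj_of_mem hu, ← hw]
  rfl

end PrimeDegree

/-! ### Symmetrization in the tensor ring -/

section Symmetrization

variable {A : Type*} [AddCommGroup A] {V : Type*} [AddCommGroup V]

/-- If the generators act by commuting endomorphisms, then `L(A)'` acts trivially. -/
theorem rightAct_toTensor_eq_zero (f : A →+ AddMonoid.End V)
    (h : ∀ a b v, f a (f b v) = f b (f a v)) {u : FreeLieRing A} (hu : u ∈ derived₁ A) (v : V) :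
    rightAct f (toTensor A u) v = 0 := by
  refine derivedSeries_succ_induction 0 (P := fun u => rightAct f (toTensor A u) v = 0)
    ?_ ?_ ?_ ?_ hu
  · rw [map_zero, rightAct_zero]
  · intro u w hu hw; rw [map_add, rightAct_add, hu, hw, add_zero]
  · intro u hu; rw [map_neg, rightAct_neg, hu, neg_zero]
  · intro u w _ _
    rw [toTensor_lie, rightAct_sub, rightAct_mul, rightAct_mul, rightAct_comm f h, sub_self]

/-- An auxiliary right action on `T(A) × T(A)` for defining the insertion operators. -/
def insertAux (a : A) : A →+ AddMonoid.End (TensorAlgebra ℤ A × TensorAlgebra ℤ A) :=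
  genAct (fun b z => (z.1 * TensorAlgebra.ι ℤ b + z.2 * TensorAlgebra.ι ℤ b * TensorAlgebra.ι ℤ a,
      z.2 * TensorAlgebra.ι ℤ b))
    (fun b z w => by ext <;> simp [add_mul]; abel)
    (fun b c z => by ext <;> simp [mul_add, add_mul]; abel)

theorem insertAux_snd (a : A) (x : TensorAlgebra ℤ A) :
    (rightAct (insertAux a) x (TensorAlgebra.ι ℤ a, 1)).2 = x := by
  induction x using tensor_induction with
  | one => simp
  | add x y hx hy => rw [rightAct_add, Prod.snd_add, hx, hy]
  | neg x hx => rw [rightAct_neg, Prod.snd_neg, hx]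
  | mul_ι x a hx => rw [rightAct_mul_ι]; exact congrArg (· * _) hx

/-- The operator on `T(A)` that sends a word to the sum of the words obtained by inserting the
letter `a` at all possible positions. -/
def insertOp (a : A) : TensorAlgebra ℤ A →+ TensorAlgebra ℤ A :=
  (AddMonoidHom.fst _ _).comp (orbit (insertAux a) (TensorAlgebra.ι ℤ a, 1))

@[simp]
theorem insertOp_one (a : A) : insertOp a 1 = TensorAlgebra.ι ℤ a := by simp [insertOp]

theorem insertOp_mul_ι (a b : A) (x : TensorAlgebra ℤ A) :
    insertOp a (x * TensorAlgebra.ι ℤ b) = insertOp a x * TensorAlgebra.ι ℤ b +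
      x * TensorAlgebra.ι ℤ b * TensorAlgebra.ι ℤ a := by
  have h : insertOp a (x * TensorAlgebra.ι ℤ b) = insertOp a x * TensorAlgebra.ι ℤ b +
      (rightAct (insertAux a) x (TensorAlgebra.ι ℤ a, 1)).2 * TensorAlgebra.ι ℤ b *
        TensorAlgebra.ι ℤ a := by
    simp only [insertOp, AddMonoidHom.comp_apply, orbit_apply, rightAct_mul_ι]; rfl
  rw [h, insertAux_snd]

theorem insertOp_add (a b : A) (x : TensorAlgebra ℤ A) :
    insertOp (a + b) x = insertOp a x + insertOp b x := by
  induction x using tensor_induction with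
  | one => simp
  | add x y hx hy => simp only [map_add, hx, hy]; abel
  | neg x hx => simp only [map_neg, hx]; abel
  | mul_ι x c hx => simp only [insertOp_mul_ι, hx, map_add]; noncomm_ring

theorem insertOp_comm (a c : A) (x : TensorAlgebra ℤ A) :
    insertOp a (insertOp c x) = insertOp c (insertOp a x) := by
  induction x using tensor_induction with
  | one =>
    have h1 := insertOp_mul_ι a c 1
    have h2 := insertOp_mul_ι c a 1
    simp only [one_mul, insertOp_one] at h1 h2 ⊢
    rw [h1, h2, add_comm]
  | add x y hx hy => simp only [map_add, hx, hy]
  | neg x hx => simp only [map_neg, hx]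
  | mul_ι x b hx => simp only [insertOp_mul_ι, map_add, hx, add_mul]; abel

theorem derT_insertOp (d : A →+ A) (a : A) (x : TensorAlgebra ℤ A) :
    derT d (insertOp a x) = insertOp (d a) x + insertOp a (derT d x) := by
  induction x using tensor_induction with
  | one => simp
  | add x y hx hy => simp only [map_add, hx, hy]; abel
  | neg x hx => simp only [map_neg, hx]; abel
  | mul_ι x b hx => simp only [insertOp_mul_ι, map_add, derT_mul_ι, hx, add_mul]; abel

/-- The generators acting on sequences in `T(A)` by insertion, with a shift to record degrees. -/
def insertSeq : A →+ AddMonoid.End (ℕ → TensorAlgebra ℤ A) :=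
  genAct (fun a s k => k.casesOn 0 fun k => insertOp a (s k))
    (fun a s t => by funext k; cases k <;> simp)
    (fun a b s => by funext k; cases k <;> simp [insertOp_add])

theorem insertSeq_succ (a : A) (s : ℕ → TensorAlgebra ℤ A) (k : ℕ) :
    insertSeq a s (k + 1) = insertOp a (s k) := rfl

theorem insertSeq_zero (a : A) (s : ℕ → TensorAlgebra ℤ A) : insertSeq a s 0 = 0 := rfl

theorem insertSeq_comm (a b : A) (s : ℕ → TensorAlgebra ℤ A) :
    insertSeq a (insertSeq b s) = insertSeq b (insertSeq a s) := by
  funext k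
  match k with
  | 0 => rw [insertSeq_zero, insertSeq_zero]
  | 1 => simp only [insertSeq_succ, insertSeq_zero, map_zero]
  | k + 2 => simp only [insertSeq_succ, insertOp_comm]

variable (A) in
/-- The symmetrization operator in degree `k`: it sends a word of length `k` to the sum of its
rearrangements, and kills words of any other length. -/
def symmT (k : ℕ) : TensorAlgebra ℤ A →+ TensorAlgebra ℤ A :=
  (Pi.evalAddMonoidHom (fun _ => TensorAlgebra ℤ A) k).comp (orbit insertSeq (Pi.single 0 1))

theorem symmT_apply (k : ℕ) (x : TensorAlgebra ℤ A) :
    symmT A k x = rightAct insertSeq x (Pi.single 0 1) k := rfl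

@[simp]
theorem symmT_zero_one : symmT A 0 1 = 1 := by simp [symmT_apply]

@[simp]
theorem symmT_succ_one (k : ℕ) : symmT A (k + 1) 1 = 0 := by simp [symmT_apply]

theorem symmT_succ_mul_ι (k : ℕ) (x : TensorAlgebra ℤ A) (a : A) :
    symmT A (k + 1) (x * TensorAlgebra.ι ℤ a) = insertOp a (symmT A k x) := by
  rw [symmT_apply, rightAct_mul_ι]; rfl

theorem symmT_zero_mul_ι (x : TensorAlgebra ℤ A) (a : A) :
    symmT A 0 (x * TensorAlgebra.ι ℤ a) = 0 := by
  rw [symmT_apply, rightAct_mul_ι]; rfl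

theorem symmT_mul_toTensor (k : ℕ) (x : TensorAlgebra ℤ A) {u : FreeLieRing A}
    (hu : u ∈ derived₁ A) : symmT A k (x * toTensor A u) = 0 := by
  rw [symmT_apply, rightAct_mul, rightAct_toTensor_eq_zero _ insertSeq_comm hu]; rfl

theorem symmT_toTensor_mul (k : ℕ) (x : TensorAlgebra ℤ A) {u : FreeLieRing A}
    (hu : u ∈ derived₁ A) : symmT A k (toTensor A u * x) = 0 := by
  rw [symmT_apply, rightAct_mul, rightAct_toTensor_eq_zero _ insertSeq_comm hu, map_zero]; rfl

theorem symmT_derT (d : A →+ A) (k : ℕ) (x : TensorAlgebra ℤ A) :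
    symmT A k (derT d x) = derT d (symmT A k x) := by
  let dV : (ℕ → TensorAlgebra ℤ A) →+ (ℕ → TensorAlgebra ℤ A) :=
    AddMonoidHom.mk' (fun s k => derT d (s k)) fun s t => by funext k; simp
  have h := der_rightAct insertSeq d dV (fun a s => by
    funext k
    match k with
    | 0 => simp [dV, insertSeq_zero]
    | k + 1 => exact derT_insertOp d a (s k)) x (Pi.single 0 1)
  have h0 : dV (Pi.single 0 1) = 0 := by
    funext k
    match k with
    | 0 => simp [dV]
    | k + 1 => simp [dV]
  rw [h0, map_zero, add_zero] at h
  exact (congrFun h k).symm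

theorem insertOp_mem_tensorDeg (a : A) {n : ℕ} {x : TensorAlgebra ℤ A} (hx : x ∈ tensorDeg A n) :
    insertOp a x ∈ tensorDeg A (n + 1) := by
  refine tensorDeg_induction (P := fun n x => x ∈ tensorDeg A n ∧
    insertOp a x ∈ tensorDeg A (n + 1)) ?_ ?_ ?_ ?_ hx |>.2
  · refine ⟨one_mem_tensorDeg, ?_⟩
    rw [insertOp_one, ← one_mul (TensorAlgebra.ι ℤ a)]
    exact mul_ι_mem_tensorDeg one_mem_tensorDeg a
  · rintro n x y ⟨hx, hx'⟩ ⟨hy, hy'⟩; rw [map_add]; exact ⟨add_mem hx hy, add_mem hx' hy'⟩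
  · rintro n x ⟨hx, hx'⟩; rw [map_neg]; exact ⟨neg_mem hx, neg_mem hx'⟩
  · rintro n x b hx ⟨-, hx'⟩
    rw [insertOp_mul_ι]
    exact ⟨mul_ι_mem_tensorDeg hx b, add_mem (mul_ι_mem_tensorDeg hx' b)
      (mul_ι_mem_tensorDeg (mul_ι_mem_tensorDeg hx b) a)⟩

theorem symmT_mem_tensorDeg {n : ℕ} {x : TensorAlgebra ℤ A} (hx : x ∈ tensorDeg A n) :
    symmT A n x ∈ tensorDeg A n := by
  refine tensorDeg_induction (P := fun n x => symmT A n x ∈ tensorDeg A n) ?_ ?_ ?_ ?_ hx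
  · rw [symmT_zero_one]; exact one_mem_tensorDeg
  · intro n x y hx hy; rw [map_add]; exact add_mem hx hy
  · intro n x hx; rw [map_neg]; exact neg_mem hx
  · intro n x a _ hx; rw [symmT_succ_mul_ι]; exact insertOp_mem_tensorDeg a hx

theorem symmT_eq_zero {n : ℕ} {x : TensorAlgebra ℤ A} (hx : x ∈ tensorDeg A n) {k : ℕ}
    (hk : k ≠ n) : symmT A k x = 0 := by
  refine tensorDeg_induction (P := fun n x => ∀ k ≠ n, symmT A k x = 0) ?_ ?_ ?_ ?_ hx k hk
  · intro k hk
    obtain ⟨k, rfl⟩ := Nat.exists_eq_succ_of_ne_zero hk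
    exact symmT_succ_one k
  · intro n x y hx hy k hk; rw [map_add, hx k hk, hy k hk, add_zero]
  · intro n x hx k hk; rw [map_neg, hx k hk, neg_zero]
  · intro n x a _ hx k hk
    match k with
    | 0 => exact symmT_zero_mul_ι x a
    | k + 1 => rw [symmT_succ_mul_ι, hx k (by omega), map_zero]

/-- The map `a ⊗ x ↦ [a, x̃]`, where `x̃` is the symmetrization of `x` in degree `k`. -/
def symmLie (k : ℕ) : A ⊗[ℤ] TensorAlgebra ℤ A →+ FreeLieRing A :=
  liftAT (AddMonoidHom.mk' (fun a => (orbit (adGen A) (ι A a)).comp (symmT A k))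
    fun a b => by ext x; simp)

@[simp]
theorem symmLie_tmul (k : ℕ) (a : A) (x : TensorAlgebra ℤ A) :
    symmLie k (a ⊗ₜ x) = adAct (symmT A k x) (ι A a) := rfl

theorem symmLie_derAT (k : ℕ) (d : A →+ A) (m : A ⊗[ℤ] TensorAlgebra ℤ A) :
    symmLie k (derAT d m) = der d (symmLie k m) := by
  induction m using TensorProduct.induction_on with
  | zero => simp
  | tmul a x =>
    rw [derAT_tmul, map_add, symmLie_tmul, symmLie_tmul, symmLie_tmul, symmT_derT]
    have h := der_rightAct (adGen A) d (der d : FreeLieRing A →ₗ[ℤ] FreeLieRing A).toAddMonoidHom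
      (der_adGen d) (symmT A k x) (ι A a)
    have h' : der d (adAct (symmT A k x) (ι A a)) =
      adAct (derT d (symmT A k x)) (ι A a) + adAct (symmT A k x) (der d (ι A a)) := h
    rw [h', der_ι, add_comm]
  | add m n hm hn => simp only [map_add, hm, hn]

theorem symmLie_rightAct_toTensor (k : ℕ) {u : FreeLieRing A} (hu : u ∈ derived₁ A)
    (m : A ⊗[ℤ] TensorAlgebra ℤ A) : symmLie k (rightAct mulGen (toTensor A u) m) = 0 := by
  induction m using TensorProduct.induction_on with
  | zero => simp
  | tmul a x => rw [mulGen_act_tmul, symmLie_tmul, symmT_mul_toTensor k x hu, adAct, rightAct_zero]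
  | add m n hm hn => rw [map_add, map_add, hm, hn, add_zero]

/-- The map `L(A) → L(A)` that is given by
`[a₁, …, aₖ₊₁] ↦ ∑_σ [a₁, a_{σ(2)}, …] - ∑_τ [a₂, a_{τ(1)}, a_{τ(3)}, …]` in degree `k + 1`. -/
def symmetrize (k : ℕ) : FreeLieRing A →+ FreeLieRing A :=
  (symmLie k).comp ((fox A).comp (toTensor A))

theorem symmetrize_apply (k : ℕ) (u : FreeLieRing A) :
    symmetrize k u = symmLie k (fox A (toTensor A u)) := rfl

theorem symmetrize_der (k : ℕ) (d : A →+ A) (u : FreeLieRing A) :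
    symmetrize k (der d u) = der d (symmetrize k u) := by
  rw [symmetrize_apply, toTensor_der, fox_derT, symmLie_derAT, symmetrize_apply]

theorem symmetrize_derived₂ (k : ℕ) {u : FreeLieRing A} (hu : u ∈ derived₂ A) :
    symmetrize k u = 0 := by
  refine derivedSeries_succ_induction 1 (P := fun u => symmetrize k u = 0) ?_ ?_ ?_ ?_ hu
  · rw [map_zero]
  · intro u w hu hw; rw [map_add, hu, hw, add_zero]
  · intro u hu; rw [map_neg, hu, neg_zero]
  · intro u w hu hw
    rw [symmetrize_apply, fox_toTensor_lie, map_sub, symmLie_rightAct_toTensor k hw,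
      symmLie_rightAct_toTensor k hu, sub_zero]

end Symmetrization

/-! ### The free metabelian Lie ring -/

section Metabelian

variable {A : Type*} [AddCommGroup A]

variable (A) in
/-- The additive group of the free metabelian Lie ring `L(A) / L(A)''`. -/
abbrev Metab : Type _ := FreeLieRing A ⧸ derived₂ A

variable (A) in
/-- The quotient map `L(A) → L(A) / L(A)''`. -/
abbrev toMetab : FreeLieRing A →+ Metab A := QuotientAddGroup.mk' (derived₂ A)

theorem toMetab_surjective : Function.Surjective (toMetab A) := QuotientAddGroup.mk'_surjective _

theorem toMetab_eq_zero {u : FreeLieRing A} : toMetab A u = 0 ↔ u ∈ derived₂ A :=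
  QuotientAddGroup.eq_zero_iff u

theorem toMetab_eq {u v : FreeLieRing A} : toMetab A u = toMetab A v ↔ u - v ∈ derived₂ A := by
  rw [← sub_eq_zero, ← map_sub, toMetab_eq_zero]

theorem lie_ι_mem_derived₂ (a : A) {u : FreeLieRing A} (hu : u ∈ derived₂ A) :
    ⁅u, ι A a⁆ ∈ derived₂ A := by
  simpa using adAct_mem_derived₂ (TensorAlgebra.ι ℤ a) hu

variable (A) in
/-- The right adjoint action of the generators on `L(A) / L(A)''`. -/
def adMetab : A →+ AddMonoid.End (Metab A) :=
  genAct (fun a => QuotientAddGroup.map (derived₂ A) (derived₂ A)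
      (adGen A a : FreeLieRing A →+ FreeLieRing A) fun _ hu => lie_ι_mem_derived₂ a hu)
    (fun _ => map_add _) fun a b q => by
      obtain ⟨u, rfl⟩ := toMetab_surjective q
      change toMetab A (adGen A (a + b) u) = toMetab A (adGen A a u) + toMetab A (adGen A b u)
      rw [gen_add, map_add]

theorem adMetab_toMetab (a : A) (u : FreeLieRing A) :
    adMetab A a (toMetab A u) = toMetab A ⁅u, ι A a⁆ := rfl

variable (A) in
/-- The derived ideal `L(A)' / L(A)''` of the free metabelian Lie ring. -/
abbrev metabDerived : AddSubgroup (Metab A) := (derived₁ A).map (toMetab A)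

theorem adMetab_mem (a : A) (q : Metab A) : adMetab A a q ∈ metabDerived A := by
  obtain ⟨u, rfl⟩ := toMetab_surjective q
  exact ⟨_, lie_mem_derived₁ u (ι A a), rfl⟩

theorem lie_lie_comm {L : Type*} [LieRing L] (u v w : L) :
    ⁅⁅u, v⁆, w⁆ = ⁅⁅u, w⁆, v⁆ + ⁅u, ⁅v, w⁆⁆ := by
  rw [leibniz_lie u v w, ← lie_skew v ⁅u, w⁆]; abel

theorem adMetab_comm (a b : A) {q : Metab A} (hq : q ∈ metabDerived A) :
    adMetab A a (adMetab A b q) = adMetab A b (adMetab A a q) := by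
  obtain ⟨u, hu, rfl⟩ := hq
  rw [adMetab_toMetab, adMetab_toMetab, adMetab_toMetab, adMetab_toMetab, toMetab_eq]
  rw [lie_lie_comm, add_sub_cancel_left]
  exact lie_mem_derived₂ hu (lie_mem_derived₁ _ _)

variable (A) in
/-- The right adjoint action of the generators on `L(A)' / L(A)''`. -/
def adMetabDerived : A →+ AddMonoid.End (metabDerived A) :=
  genAct (fun a q => ⟨adMetab A a q, adMetab_mem a q⟩)
    (fun a q r => Subtype.ext (map_add (adMetab A a) (q : Metab A) r))
    (fun a b q => Subtype.ext (gen_add (adMetab A) a b q))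

theorem coe_adMetabDerived (a : A) (q : metabDerived A) :
    (adMetabDerived A a q : Metab A) = adMetab A a q := rfl

theorem adMetabDerived_comm (a b : A) (q : metabDerived A) :
    adMetabDerived A a (adMetabDerived A b q) = adMetabDerived A b (adMetabDerived A a q) :=
  Subtype.ext (adMetab_comm a b q.2)

/-- The commutator `[a, b]` in the free metabelian Lie ring. -/
def metabLie (a b : A) : metabDerived A := ⟨toMetab A ⁅ι A a, ι A b⁆, _, lie_mem_derived₁ _ _, rfl⟩

theorem coe_metabLie (a b : A) : (metabLie a b : Metab A) = toMetab A ⁅ι A a, ι A b⁆ := rfl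

theorem metabLie_add_left (a a' b : A) : metabLie (a + a') b = metabLie a b + metabLie a' b :=
  Subtype.ext (by rw [AddSubgroup.coe_add]; simp only [coe_metabLie, map_add, add_lie])

theorem metabLie_add_right (a b b' : A) : metabLie a (b + b') = metabLie a b + metabLie a b' :=
  Subtype.ext (by rw [AddSubgroup.coe_add]; simp only [coe_metabLie, map_add, lie_add])

/-- The Jacobi identity. -/
theorem adMetabDerived_metabLie (a b c : A) :
    adMetabDerived A c (metabLie a b) =
      adMetabDerived A b (metabLie a c) + adMetabDerived A a (metabLie c b) := by
  refine Subtype.ext ?_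
  rw [AddSubgroup.coe_add, coe_adMetabDerived, coe_adMetabDerived, coe_adMetabDerived,
    coe_metabLie, coe_metabLie, coe_metabLie, adMetab_toMetab, adMetab_toMetab, adMetab_toMetab,
    ← map_add]
  congr 1
  rw [lie_lie_comm (ι A a), ← lie_skew (ι A a) ⁅ι A b, ι A c⁆, ← lie_skew (ι A b) (ι A c), neg_lie,
    neg_neg]

variable (A) in
/-- The right action of the generators on `(L'/L'') × Hom(A, L'/L'')` by
`(m, φ) b = (m b + φ(b), φ b)`. -/
def pairGen : A →+ AddMonoid.End (metabDerived A × (A →+ metabDerived A)) :=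
  genAct (fun b z => (adMetabDerived A b z.1 + z.2 b,
      (adMetabDerived A b : metabDerived A →+ metabDerived A).comp z.2))
    (fun b z w => Prod.ext (by
        change adMetabDerived A b (z.1 + w.1) + (z.2 b + w.2 b) = _ + _
        rw [map_add]
        change _ = (adMetabDerived A b z.1 + z.2 b) + (adMetabDerived A b w.1 + w.2 b)
        abel)
      (AddMonoidHom.ext fun c => map_add (adMetabDerived A b) (z.2 c) (w.2 c)))
    (fun b c z => Prod.ext (by
        change adMetabDerived A (b + c) z.1 + z.2 (b + c) =
          (adMetabDerived A b z.1 + z.2 b) + (adMetabDerived A c z.1 + z.2 c)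
        rw [gen_add, map_add]; abel)
      (AddMonoidHom.ext fun e => gen_add (adMetabDerived A) b c (z.2 e)))

theorem pairGen_fst (b : A) (z : metabDerived A × (A →+ metabDerived A)) :
    (pairGen A b z).1 = adMetabDerived A b z.1 + z.2 b := rfl

theorem pairGen_snd (b : A) (z : metabDerived A × (A →+ metabDerived A)) (c : A) :
    (pairGen A b z).2 c = adMetabDerived A b (z.2 c) := rfl

theorem pairGen_comm (a b : A) (z : metabDerived A × (A →+ metabDerived A)) :
    pairGen A a (pairGen A b z) = pairGen A b (pairGen A a z) := by
  refine Prod.ext ?_ (AddMonoidHom.ext fun c => ?_)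
  · rw [pairGen_fst, pairGen_fst, pairGen_fst, pairGen_fst, pairGen_snd, pairGen_snd, map_add,
      map_add, adMetabDerived_comm]
    abel
  · rw [pairGen_snd, pairGen_snd, pairGen_snd, pairGen_snd, adMetabDerived_comm]

/-- The pair `(0, [a, d(-)])`. -/
def pairBase (d : A →+ A) : A →+ metabDerived A × (A →+ metabDerived A) :=
  AddMonoidHom.mk' (fun a => (0, AddMonoidHom.mk' (fun c => metabLie a (d c)) fun c c' => by
      rw [map_add, metabLie_add_right]))
    fun a a' => Prod.ext (add_zero 0).symm
      (AddMonoidHom.ext fun c => metabLie_add_left a a' (d c))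

theorem pairBase_fst (d : A →+ A) (a : A) : (pairBase d a).1 = 0 := rfl

theorem pairBase_snd (d : A →+ A) (a c : A) : (pairBase d a).2 c = metabLie a (d c) := rfl

/-- The map on `A ⊗ T(A)` whose first component sends `a ⊗ b₁ ⋯ bₙ` to
`∑ⱼ [a, d bⱼ, b₁, …, b̂ⱼ, …, bₙ]` in the free metabelian Lie ring. -/
def metabEval (d : A →+ A) : A ⊗[ℤ] TensorAlgebra ℤ A →+ metabDerived A × (A →+ metabDerived A) :=
  evalAct (pairBase d) (pairGen A)

theorem metabEval_tmul_one (d : A →+ A) (a : A) : metabEval d (a ⊗ₜ 1) = pairBase d a := by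
  simp [metabEval]

theorem metabEval_mulGen (d : A →+ A) (b : A) (m : A ⊗[ℤ] TensorAlgebra ℤ A) :
    metabEval d (mulGen b m) = pairGen A b (metabEval d m) := by
  have h := evalAct_rightAct (pairBase d) (pairGen A) (TensorAlgebra.ι ℤ b) m
  rwa [rightAct_ι, rightAct_ι] at h

theorem metabEval_tmul_mul_ι (d : A →+ A) (a b : A) (x : TensorAlgebra ℤ A) :
    metabEval d (a ⊗ₜ (x * TensorAlgebra.ι ℤ b)) = pairGen A b (metabEval d (a ⊗ₜ x)) := by
  rw [← mulGen_tmul, metabEval_mulGen]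

theorem metabEval_rightAct_toTensor (d : A →+ A) {u : FreeLieRing A} (hu : u ∈ derived₁ A)
    (m : A ⊗[ℤ] TensorAlgebra ℤ A) : metabEval d (rightAct mulGen (toTensor A u) m) = 0 := by
  rw [metabEval, evalAct_rightAct, rightAct_toTensor_eq_zero (pairGen A) pairGen_comm hu]

theorem metabEval_tmul_snd (d : A →+ A) (a c : A) (x : TensorAlgebra ℤ A) :
    (metabEval d (a ⊗ₜ x)).2 c = rightAct (adMetabDerived A) x (metabLie a (d c)) :=
  map_rightAct (pairGen A) (adMetabDerived A)
    ((AddMonoidHom.eval c).comp (AddMonoidHom.snd (metabDerived A) (A →+ metabDerived A)))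
    (fun _ _ => rfl) x (pairBase d a)

theorem fox_toTensor_lie_ι (u : FreeLieRing A) (a : A) : fox A (toTensor A ⁅u, ι A a⁆) =
    mulGen a (fox A (toTensor A u)) - a ⊗ₜ toTensor A u := by
  rw [fox_toTensor_lie, toTensor_ι, rightAct_ι, fox_ι, mulGen_act_tmul, one_mul]

/-- Modulo `L(A)''`, the derivations of `L(A)` can be recovered from the Fox derivative with
coefficients in the symmetric ring. -/
theorem metabEval_fox_toTensor (d : A →+ A) {n : ℕ} {u : FreeLieRing A}
    (hu : u ∈ lieDeg A (n + 2)) :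
    ((metabEval d (fox A (toTensor A u))).1 : Metab A) = toMetab A (der d u) := by
  -- The second component records the action of `der d` on the last letter, and is needed for the
  -- induction step.
  have key : ∀ {n : ℕ} {u : FreeLieRing A}, u ∈ lieDeg A n →
      (2 ≤ n → ((metabEval d (fox A (toTensor A u))).1 : Metab A) = toMetab A (der d u)) ∧
      (n = 1 → (metabEval d (fox A (toTensor A u))).1 = 0) ∧
      ∀ c, ((metabEval d (fox A (toTensor A u))).2 c : Metab A) = toMetab A ⁅u, ι A (d c)⁆ := by
    intro n u hu
    refine lieDeg_induction (P := fun n u =>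
      (2 ≤ n → ((metabEval d (fox A (toTensor A u))).1 : Metab A) = toMetab A (der d u)) ∧
      (n = 1 → (metabEval d (fox A (toTensor A u))).1 = 0) ∧
      ∀ c, ((metabEval d (fox A (toTensor A u))).2 c : Metab A) = toMetab A ⁅u, ι A (d c)⁆)
      ?_ ?_ ?_ ?_ ?_ hu
    · intro a
      rw [toTensor_ι, fox_ι, metabEval_tmul_one]
      exact ⟨fun h => absurd h (by norm_num), fun _ => rfl, fun c => rfl⟩
    · intro n
      simp only [map_zero, zero_lie]
      exact ⟨fun _ => rfl, fun _ => rfl, fun c => rfl⟩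
    · rintro n u v ⟨h1, h2, h3⟩ ⟨h1', h2', h3'⟩
      simp only [map_add, add_lie, Prod.fst_add, Prod.snd_add]
      refine ⟨fun h => ?_, fun h => by rw [h2 h, h2' h, add_zero], fun c => ?_⟩
      · rw [AddSubgroup.coe_add, h1 h, h1' h]
      · rw [AddMonoidHom.add_apply, AddSubgroup.coe_add, h3, h3']
    · rintro n u ⟨h1, h2, h3⟩
      simp only [map_neg, neg_lie, Prod.fst_neg, Prod.snd_neg]
      refine ⟨fun h => ?_, fun h => by rw [h2 h, neg_zero], fun c => ?_⟩
      · rw [AddSubgroup.coe_neg, h1 h]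
      · rw [AddMonoidHom.neg_apply, AddSubgroup.coe_neg, h3]
    · rintro n u a hu ⟨h1, h2, h3⟩
      have hd := der_adGen d a u
      rw [adGen_apply, adGen_apply, adGen_apply] at hd
      rw [fox_toTensor_lie_ι, map_sub, metabEval_mulGen, Prod.fst_sub, Prod.snd_sub, pairGen_fst,
        hd]
      match n with
      | 0 =>
        obtain ⟨b, rfl⟩ : ∃ b, u = ι A b := by
          refine lieDeg_induction (P := fun n u => n = 1 → ∃ b, u = ι A b) ?_ ?_ ?_ ?_ ?_ hu rfl
          · exact fun a _ => ⟨a, rfl⟩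
          · exact fun _ _ => ⟨0, (map_zero _).symm⟩
          · rintro n u v hu hv h
            obtain ⟨b, rfl⟩ := hu h
            obtain ⟨c, rfl⟩ := hv h
            exact ⟨b + c, (map_add _ _ _).symm⟩
          · rintro n u hu h
            obtain ⟨b, rfl⟩ := hu h
            exact ⟨-b, (map_neg _ _).symm⟩
          · intro n u a _ _ h; omega
        have h4 : metabEval d (a ⊗ₜ toTensor A (ι A b)) = pairGen A b (pairBase d a) := by
          have h := metabEval_tmul_mul_ι d a b 1
          rwa [one_mul, metabEval_tmul_one, ← toTensor_ι] at h
        rw [h4, pairGen_fst, pairBase_fst, h2 rfl, map_zero, map_zero,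
          zero_add (_ : metabDerived A), zero_add (_ : metabDerived A)]
        refine ⟨fun _ => ?_, fun h => by omega, fun c => ?_⟩
        · rw [AddSubgroup.coe_sub, h3, pairBase_snd, coe_metabLie, ← map_sub, der_ι]
          congr 1
          rw [← lie_skew (ι A a)]; abel
        · rw [AddMonoidHom.sub_apply, AddSubgroup.coe_sub, pairGen_snd, pairGen_snd,
            coe_adMetabDerived, coe_adMetabDerived, h3, pairBase_snd, coe_metabLie,
            adMetab_toMetab, adMetab_toMetab, ← map_sub]
          congr 1
          rw [lie_lie_comm, ← lie_skew (ι A b) ⁅ι A (d c), ι A a⁆, ← lie_skew (ι A a) (ι A (d c)),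
            neg_lie]
          abel
      | n + 1 =>
        have hu' := mem_derivedSeries_one_of_mem_lieDeg hu
        have h4 : metabEval d (a ⊗ₜ toTensor A u) = 0 := by
          have h := metabEval_rightAct_toTensor d hu' (a ⊗ₜ 1)
          rwa [mulGen_act_tmul, one_mul] at h
        rw [h4, Prod.fst_zero, Prod.snd_zero, sub_zero, sub_zero]
        refine ⟨fun _ => ?_, fun h => by omega, fun c => ?_⟩
        · rw [AddSubgroup.coe_add, coe_adMetabDerived, h1 (by omega), h3, adMetab_toMetab,
            ← map_add, add_comm]
        · rw [pairGen_snd, coe_adMetabDerived, h3, adMetab_toMetab, toMetab_eq, lie_lie_comm,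
            add_sub_cancel_left]
          exact lie_mem_derived₂ hu' (lie_mem_derived₁ _ _)
  exact (key hu).1 (by omega)

/-- The derivation of `(L'/L'') × Hom(A, L'/L'')` induced by the derivation `der d`. -/
theorem exists_pairDer (d : A →+ A) :
    ∃ dV : metabDerived A × (A →+ metabDerived A) →+ metabDerived A × (A →+ metabDerived A),
      (∀ z u, ((z.1 : metabDerived A) : Metab A) = toMetab A u →
        (((dV z).1 : metabDerived A) : Metab A) = toMetab A (der d u)) ∧
      ∀ m, metabEval (AddMonoidHom.id A) (derAT d m) =
        dV (metabEval (AddMonoidHom.id A) m) := by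
  let dQ : Metab A →+ Metab A := QuotientAddGroup.map (derived₂ A) (derived₂ A)
    (der d : FreeLieRing A →ₗ[ℤ] FreeLieRing A).toAddMonoidHom
    (fun u hu => der_mem_derivedSeries (der d) 2 u hu)
  have hdQ : ∀ u, dQ (toMetab A u) = toMetab A (der d u) := fun u => rfl
  let dM : metabDerived A →+ metabDerived A := AddMonoidHom.mk' (fun q => ⟨dQ q, by
      obtain ⟨_, u, hu, rfl⟩ := q
      exact ⟨_, der_mem_derivedSeries (der d) 1 u hu, rfl⟩⟩)
    fun q r => Subtype.ext (map_add dQ (q : Metab A) r)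
  have hdM : ∀ a q, dM (adMetabDerived A a q) =
      adMetabDerived A (d a) q + adMetabDerived A a (dM q) := by
    rintro a ⟨_, u, hu, rfl⟩
    refine Subtype.ext ?_
    have h := congrArg (toMetab A) (der_adGen d a u)
    rwa [map_add] at h
  have hdL : ∀ a b, dM (metabLie a b) = metabLie (d a) b + metabLie a (d b) := by
    intro a b
    refine Subtype.ext ?_
    have h := congrArg (toMetab A) (der_adGen d b (ι A a))
    rw [map_add, der_ι] at h
    exact h.trans (add_comm _ _)
  let dV : metabDerived A × (A →+ metabDerived A) →+ metabDerived A × (A →+ metabDerived A) :=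
    AddMonoidHom.prodMap dM (AddMonoidHom.mk' (fun φ => dM.comp φ - φ.comp d) fun φ ψ => by
      ext1 c
      change dM (φ c + ψ c) - (φ (d c) + ψ (d c)) = (dM (φ c) - φ (d c)) + (dM (ψ c) - ψ (d c))
      rw [map_add]; abel)
  have hV1 : ∀ z, (dV z).1 = dM z.1 := fun z => rfl
  have hV2 : ∀ z c, (dV z).2 c = dM (z.2 c) - z.2 (d c) := fun z c => rfl
  refine ⟨dV, fun z u hz => ?_, fun m => ?_⟩
  · rw [hV1]
    change dQ z.1 = _
    rw [hz, hdQ]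
  · refine evalAct_derAT _ _ d dV (fun a => ?_) (fun a z => ?_) m
    · refine Prod.ext (map_zero dM) (AddMonoidHom.ext fun c => ?_)
      rw [hV2, pairBase_snd, pairBase_snd, pairBase_snd]
      change dM (metabLie a c) - metabLie a (d c) = metabLie (d a) c
      rw [hdL, add_sub_cancel_right]
    · refine Prod.ext ?_ (AddMonoidHom.ext fun c => ?_)
      · rw [hV1, pairGen_fst, map_add, hdM, Prod.fst_add, pairGen_fst, pairGen_fst, hV1, hV2]
        abel
      · rw [hV2, pairGen_snd, pairGen_snd, hdM, Prod.snd_add, AddMonoidHom.add_apply, pairGen_snd,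
          pairGen_snd, hV2, map_sub]
        abel

/-- If the generators act by commuting endomorphisms, then inserting a letter `a` into a word of
length `k` amounts to acting by `a` and multiplying by the number `k + 1` of positions. -/
theorem rightAct_insertOp {V : Type*} [AddCommGroup V] (f : A →+ AddMonoid.End V)
    (hf : ∀ a b v, f a (f b v) = f b (f a v)) (a : A) {k : ℕ} {x : TensorAlgebra ℤ A}
    (hx : x ∈ tensorDeg A k) (v : V) :
    rightAct f (insertOp a x) v = (k + 1) • f a (rightAct f x v) := by
  refine tensorDeg_induction (P := fun k x =>
    rightAct f (insertOp a x) v = (k + 1) • f a (rightAct f x v)) ?_ ?_ ?_ ?_ hx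
  · simp
  · intro n x y hx hy; rw [map_add, rightAct_add, hx, hy, rightAct_add, map_add, smul_add]
  · intro n x hx; rw [map_neg, rightAct_neg, hx, rightAct_neg, map_neg, smul_neg]
  · intro n x b _ hx
    rw [insertOp_mul_ι, rightAct_add, rightAct_mul_ι, hx, rightAct_mul_ι, rightAct_mul_ι,
      map_nsmul, hf b a, ← succ_nsmul]

theorem rightAct_symmT {V : Type*} [AddCommGroup V] (f : A →+ AddMonoid.End V)
    (hf : ∀ a b v, f a (f b v) = f b (f a v)) {k : ℕ} {x : TensorAlgebra ℤ A}
    (hx : x ∈ tensorDeg A k) (v : V) :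
    rightAct f (symmT A k x) v = k.factorial • rightAct f x v := by
  refine tensorDeg_induction (P := fun k x =>
    rightAct f (symmT A k x) v = k.factorial • rightAct f x v) ?_ ?_ ?_ ?_ hx
  · simp
  · intro n x y hx hy; rw [map_add, rightAct_add, hx, hy, rightAct_add, smul_add]
  · intro n x hx; rw [map_neg, rightAct_neg, hx, rightAct_neg, smul_neg]
  · intro n x b hx hx'
    rw [symmT_succ_mul_ι, rightAct_insertOp f hf b (symmT_mem_tensorDeg hx), hx', map_nsmul,
      smul_smul, rightAct_mul_ι, Nat.factorial_succ]

theorem toMetab_adAct_insertOp (a b : A) {k : ℕ} {x : TensorAlgebra ℤ A}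
    (hx : x ∈ tensorDeg A k) : toMetab A (adAct (insertOp b x) (ι A a)) =
      k • toMetab A ⁅adAct x (ι A a), ι A b⁆ +
        rightAct (adMetabDerived A) x (metabLie a b) := by
  refine tensorDeg_induction (P := fun k x => toMetab A (adAct (insertOp b x) (ι A a)) =
      k • toMetab A ⁅adAct x (ι A a), ι A b⁆ +
        rightAct (adMetabDerived A) x (metabLie a b)) ?_ ?_ ?_ ?_ hx
  · simp [coe_metabLie]
  · intro n x y hx hy
    simp only [adAct, rightAct_add, map_add, add_lie, AddSubgroup.coe_add, smul_add] at hx hy ⊢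
    rw [hx, hy]; abel
  · intro n x hx
    simp only [adAct, rightAct_neg, map_neg, neg_lie, AddSubgroup.coe_neg, smul_neg] at hx ⊢
    rw [hx]; abel
  · intro n x c hx hx'
    rw [insertOp_mul_ι, adAct, rightAct_add, rightAct_mul_ι, map_add, rightAct_mul_ι,
      rightAct_mul_ι, rightAct_mul_ι, adGen_apply, adGen_apply, adGen_apply,
      ← adMetab_toMetab, hx', map_add, map_nsmul, adMetab_toMetab, coe_adMetabDerived]
    have h : n • toMetab A ⁅⁅adAct x (ι A a), ι A b⁆, ι A c⁆ =
        n • toMetab A ⁅⁅adAct x (ι A a), ι A c⁆, ι A b⁆ := by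
      induction n with
      | zero => simp
      | succ n _ =>
        congr 1
        rw [toMetab_eq, lie_lie_comm, add_sub_cancel_left]
        refine lie_mem_derived₂ (mem_derivedSeries_one_of_mem_lieDeg (n := n) ?_)
          (lie_mem_derived₁ _ _)
        have h := adAct_mem_lieDeg (ι_mem_lieDeg a) hx
        rwa [show 1 + (n + 1) = n + 2 by ring] at h
    rw [h, succ_nsmul]
    abel

theorem toMetab_adAct_symmT (a : A) {k : ℕ} {x : TensorAlgebra ℤ A}
    (hx : x ∈ tensorDeg A (k + 1)) : toMetab A (adAct (symmT A (k + 1) x) (ι A a)) =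
      k.factorial • (metabEval (AddMonoidHom.id A) (a ⊗ₜ x)).1 := by
  refine tensorDeg_induction (P := fun n x => ∀ k, n = k + 1 →
      toMetab A (adAct (symmT A (k + 1) x) (ι A a)) =
        k.factorial • ((metabEval (AddMonoidHom.id A) (a ⊗ₜ x)).1 : Metab A)) ?_ ?_ ?_ ?_ hx k rfl
  · intro k hk; omega
  · intro n x y hx hy k hk
    rw [map_add, adAct, rightAct_add, map_add, hx k hk, hy k hk, TensorProduct.tmul_add, map_add,
      Prod.fst_add, AddSubgroup.coe_add, smul_add]
  · intro n x hx k hk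
    rw [map_neg, adAct, rightAct_neg, map_neg, hx k hk, TensorProduct.tmul_neg, map_neg,
      Prod.fst_neg, AddSubgroup.coe_neg, smul_neg]
  · intro n x b hx hx' k hk
    obtain rfl : n = k := by omega
    rw [symmT_succ_mul_ι, toMetab_adAct_insertOp a b (symmT_mem_tensorDeg hx),
      rightAct_symmT _ adMetabDerived_comm hx, metabEval_tmul_mul_ι, pairGen_fst,
      metabEval_tmul_snd, AddSubgroup.coe_add, AddSubgroup.coe_nsmul, smul_add]
    congr 1
    match n with
    | 0 =>
      rw [zero_nsmul, Nat.factorial_zero, one_nsmul, coe_adMetabDerived]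
      have h : (metabEval (AddMonoidHom.id A) (a ⊗ₜ x)).1 = 0 := by
        refine tensorDeg_induction (P := fun n x => n = 0 →
          (metabEval (AddMonoidHom.id A) (a ⊗ₜ x)).1 = 0) ?_ ?_ ?_ ?_ hx rfl
        · intro _; rw [metabEval_tmul_one]; rfl
        · intro n x y hx hy hn
          rw [TensorProduct.tmul_add, map_add, Prod.fst_add, hx hn, hy hn, add_zero]
        · intro n x hx hn
          rw [TensorProduct.tmul_neg, map_neg, Prod.fst_neg, hx hn, neg_zero]
        · intro n x a _ _ hn; omega
      rw [h, AddSubgroup.coe_zero, map_zero]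
    | n + 1 =>
      rw [← adMetab_toMetab, hx' n rfl, map_nsmul, smul_smul, coe_adMetabDerived,
        Nat.factorial_succ]

theorem metabEval_tmul_ι_mul (a c : A) {n : ℕ} {x : TensorAlgebra ℤ A} (hx : x ∈ tensorDeg A n) :
    (metabEval (AddMonoidHom.id A) (a ⊗ₜ (TensorAlgebra.ι ℤ c * x))).1 =
      (n + 1) • rightAct (adMetabDerived A) x (metabLie a c) +
        adMetabDerived A a (metabEval (AddMonoidHom.id A) (c ⊗ₜ x)).1 := by
  refine tensorDeg_induction (P := fun n x =>
    (metabEval (AddMonoidHom.id A) (a ⊗ₜ (TensorAlgebra.ι ℤ c * x))).1 =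
      (n + 1) • rightAct (adMetabDerived A) x (metabLie a c) +
        adMetabDerived A a (metabEval (AddMonoidHom.id A) (c ⊗ₜ x)).1) ?_ ?_ ?_ ?_ hx
  · have h := metabEval_tmul_mul_ι (AddMonoidHom.id A) a c 1
    rw [one_mul] at h
    rw [mul_one, h, pairGen_fst, metabEval_tmul_one, metabEval_tmul_one, pairBase_fst,
      pairBase_fst, pairBase_snd, map_zero, map_zero, rightAct_one]
    simp
  · intro n x y hx hy
    simp only [mul_add, TensorProduct.tmul_add, map_add, Prod.fst_add, hx, hy, rightAct_add,
      smul_add]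
    abel
  · intro n x hx
    simp only [mul_neg, TensorProduct.tmul_neg, map_neg, Prod.fst_neg, hx, rightAct_neg, smul_neg]
    abel
  · intro n x b _ hx
    have hcomm : ∀ a q, adMetabDerived A a (rightAct (adMetabDerived A) x q) =
        rightAct (adMetabDerived A) x (adMetabDerived A a q) := fun a q =>
      map_rightAct (adMetabDerived A) (adMetabDerived A)
        (adMetabDerived A a : metabDerived A →+ metabDerived A)
        (fun c v => adMetabDerived_comm a c v) x q
    rw [← mul_assoc, metabEval_tmul_mul_ι, pairGen_fst, hx, metabEval_tmul_snd,
      metabEval_tmul_mul_ι, pairGen_fst, metabEval_tmul_snd, AddMonoidHom.id_apply, rightAct_mul,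
      rightAct_ι, adMetabDerived_metabLie, map_add, map_add, map_add, map_nsmul, rightAct_mul_ι,
      succ_nsmul _ (n + 1), adMetabDerived_comm b a,
      hcomm b, hcomm a]
    abel

/-- The homogeneous part of degree `n` of `A ⊗ T(A)`, where `A ⊗ ℤ` has degree `0`. -/
def tensorDegAT (A : Type*) [AddCommGroup A] (n : ℕ) : AddSubgroup (A ⊗[ℤ] TensorAlgebra ℤ A) :=
  AddSubgroup.closure {m | ∃ a : A, ∃ x ∈ tensorDeg A n, m = a ⊗ₜ x}

theorem tmul_mem_tensorDegAT (a : A) {n : ℕ} {x : TensorAlgebra ℤ A} (hx : x ∈ tensorDeg A n) :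
    a ⊗ₜ x ∈ tensorDegAT A n := AddSubgroup.subset_closure ⟨a, x, hx, rfl⟩

theorem aug_eq_zero {n : ℕ} (hn : n ≠ 0) {x : TensorAlgebra ℤ A} (hx : x ∈ tensorDeg A n) :
    aug A x = 0 := by
  refine tensorDeg_induction (P := fun m x => m ≠ 0 → aug A x = 0) ?_ ?_ ?_ ?_ hx hn
  · intro h; exact absurd rfl h
  · intro m x y hx hy h; rw [map_add, hx h, hy h, add_zero]
  · intro m x hx h; rw [map_neg, hx h, neg_zero]
  · intro m x a _ _ _; rw [map_mul, aug_ι, mul_zero]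

theorem fox_eq_zero {x : TensorAlgebra ℤ A} (hx : x ∈ tensorDeg A 0) : fox A x = 0 := by
  refine tensorDeg_induction (P := fun m x => m = 0 → fox A x = 0) ?_ ?_ ?_ ?_ hx rfl
  · intro _; exact fox_one
  · intro m x y hx hy h; rw [map_add, hx h, hy h, add_zero]
  · intro m x hx h; rw [map_neg, hx h, neg_zero]
  · intro m x a _ _ h; omega

theorem fox_mem_tensorDegAT {n : ℕ} {x : TensorAlgebra ℤ A} (hx : x ∈ tensorDeg A (n + 1)) :
    fox A x ∈ tensorDegAT A n := by
  refine tensorDeg_induction (P := fun m x => ∀ n, m = n + 1 → fox A x ∈ tensorDegAT A n)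
    ?_ ?_ ?_ ?_ hx n rfl
  · intro n hn; omega
  · intro m x y hx hy n hn; rw [map_add]; exact add_mem (hx n hn) (hy n hn)
  · intro m x hx n hn; rw [map_neg]; exact neg_mem (hx n hn)
  · intro m x a hx hx' n hn
    obtain rfl : m = n := by omega
    rw [fox_mul_ι]
    match m with
    | 0 =>
      rw [fox_eq_zero hx, map_zero, zero_add]
      exact AddSubgroup.zsmul_mem _ (tmul_mem_tensorDegAT a one_mem_tensorDeg) _
    | m + 1 =>
      rw [aug_eq_zero (Nat.succ_ne_zero m) hx, zero_smul, add_zero]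
      have h := hx' m rfl
      generalize fox A x = z at h
      induction h using AddSubgroup.closure_induction with
      | mem m h =>
        obtain ⟨b, y, hy, rfl⟩ := h
        rw [mulGen_tmul]
        exact tmul_mem_tensorDegAT b (mul_ι_mem_tensorDeg hy a)
      | zero => rw [map_zero]; exact zero_mem _
      | add u v _ _ hu hv => rw [map_add]; exact add_mem hu hv
      | neg u _ hu => rw [map_neg]; exact neg_mem hu

theorem symmLie_mem_lieDeg {k : ℕ} {m : A ⊗[ℤ] TensorAlgebra ℤ A} (hm : m ∈ tensorDegAT A k) :
    symmLie k m ∈ lieDeg A (k + 1) := by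
  induction hm using AddSubgroup.closure_induction with
  | mem m h =>
    obtain ⟨b, y, hy, rfl⟩ := h
    rw [symmLie_tmul, add_comm]
    exact adAct_mem_lieDeg (ι_mem_lieDeg b) (symmT_mem_tensorDeg hy)
  | zero => rw [map_zero]; exact zero_mem _
  | add u v _ _ hu hv => rw [map_add]; exact add_mem hu hv
  | neg u _ hu => rw [map_neg]; exact neg_mem hu

theorem symmetrize_mem_lieDeg {k : ℕ} {u : FreeLieRing A} (hu : u ∈ lieDeg A (k + 1)) :
    symmetrize k u ∈ lieDeg A (k + 1) :=
  symmLie_mem_lieDeg (fox_mem_tensorDegAT (toTensor_mem hu))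

theorem toMetab_symmLie {k : ℕ} {m : A ⊗[ℤ] TensorAlgebra ℤ A} (hm : m ∈ tensorDegAT A (k + 1)) :
    toMetab A (symmLie (k + 1) m) =
      k.factorial • ((metabEval (AddMonoidHom.id A) m).1 : Metab A) := by
  induction hm using AddSubgroup.closure_induction with
  | mem m h =>
    obtain ⟨b, y, hy, rfl⟩ := h
    exact toMetab_adAct_symmT b hy
  | zero => simp
  | add u v _ _ hu hv =>
    rw [map_add, map_add, hu, hv, map_add, Prod.fst_add, AddSubgroup.coe_add, smul_add]
  | neg u _ hu => rw [map_neg, map_neg, hu, map_neg, Prod.fst_neg, AddSubgroup.coe_neg, smul_neg]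

/-- Modulo `L(A)''`, the letters after the first two can be permuted freely, so that the
symmetrization is multiplication by an integer. -/
theorem toMetab_symmetrize {k : ℕ} {u : FreeLieRing A} (hu : u ∈ lieDeg A (k + 2)) :
    toMetab A (symmetrize (k + 1) u) = (k.factorial * (k + 2)) • toMetab A u := by
  rw [symmetrize_apply, toMetab_symmLie (fox_mem_tensorDegAT (toTensor_mem hu)),
    metabEval_fox_toTensor _ hu, der_id hu, map_nsmul, smul_smul]

end Metabelian

/-! ### Passage to the symmetric ring -/

section Symmetric

variable {A : Type*} [AddCommGroup A] {V : Type*} [AddCommGroup V]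

variable (A) in
/-- The symmetric ring `S(A)` of the abelian group `A`. This is a type synonym of the symmetric
algebra over `ℤ` that remembers only the ring structure. -/
def SymRing : Type _ := SymmetricAlgebra ℤ A

instance : CommRing (SymRing A) := inferInstanceAs (CommRing (SymmetricAlgebra ℤ A))

instance [Module.Free ℤ A] : Module.Free ℤ (SymRing A) :=
  let e : SymmetricAlgebra ℤ A ≃ₗ[ℤ] SymRing A :=
    { toFun := fun s => s
      invFun := fun s => s
      map_add' := fun _ _ => rfl
      map_smul' := fun n s =>
        int_smul_eq_zsmul (inferInstanceAs (Module ℤ (SymmetricAlgebra ℤ A))) n s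
      left_inv := fun _ => rfl
      right_inv := fun _ => rfl }
  Module.Free.of_equiv e

theorem free_tensorProduct_int (M N : Type*) [AddCommGroup M] [AddCommGroup N] [Module.Free ℤ M]
    [Module.Free ℤ N] : Module.Free ℤ (M ⊗[ℤ] N) := by
  have h : @Module.Free ℤ (M ⊗[ℤ] N) _ _ TensorProduct.leftModule := Module.Free.tensor ..
  have e : (TensorProduct.leftModule : Module ℤ (M ⊗[ℤ] N)) = AddCommGroup.toIntModule _ :=
    Subsingleton.elim _ _
  rwa [e] at h

variable (A) in
/-- The projection of the tensor ring onto the symmetric ring. -/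
def toSym : TensorAlgebra ℤ A →+* SymRing A := (SymmetricAlgebra.algHom ℤ A).toRingHom

theorem toSym_surjective : Function.Surjective (toSym A) := SymmetricAlgebra.algHom_surjective ℤ A

theorem toSym_toTensor {u : FreeLieRing A} (hu : u ∈ derived₁ A) : toSym A (toTensor A u) = 0 := by
  refine derivedSeries_succ_induction 0 (P := fun u => toSym A (toTensor A u) = 0) ?_ ?_ ?_ ?_ hu
  · rw [map_zero, map_zero]
  · intro u v hu hv; rw [map_add, map_add, hu, hv, add_zero]
  · intro u hu; rw [map_neg, map_neg, hu, neg_zero]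
  · intro u v _ _; rw [toTensor_lie, map_sub, map_mul, map_mul, mul_comm, sub_self]

/-- If the generators act by commuting endomorphisms, then the right action of the tensor ring
factors through the symmetric ring. -/
theorem exists_symAct (f : A →+ AddMonoid.End V) (hf : ∀ a b v, f a (f b v) = f b (f a v)) :
    ∃ g : SymRing A →+ V →+ V, ∀ x v, g (toSym A x) v = rightAct f x v := by
  let F : A →ₗ[ℤ] (AddMonoid.End V)ᵐᵒᵖ :=
    ((MulOpposite.opAddEquiv (α := AddMonoid.End V)).toAddMonoidHom.comp f).toIntLinearMap
  have hF : IsMulCommutative (Algebra.adjoin ℤ (Set.range F)) :=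
    Algebra.isMulCommutative_adjoin ℤ (by
      rintro _ ⟨a, rfl⟩ _ ⟨b, rfl⟩
      exact congrArg MulOpposite.op (AddMonoidHom.ext (hf b a)))
  open scoped IsMulCommutative in
  let G : SymmetricAlgebra ℤ A →ₐ[ℤ] Algebra.adjoin ℤ (Set.range F) :=
    SymmetricAlgebra.lift (F.codRestrict (Subalgebra.toSubmodule (Algebra.adjoin ℤ (Set.range F)))
      fun a => Algebra.subset_adjoin ⟨a, rfl⟩)
  let G' : SymmetricAlgebra ℤ A →ₐ[ℤ] (AddMonoid.End V)ᵐᵒᵖ := (Subalgebra.val _).comp G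
  have hG : G'.comp (SymmetricAlgebra.algHom ℤ A) = rightActHom f := by
    refine TensorAlgebra.hom_ext (LinearMap.ext fun a => ?_)
    change ((G (SymmetricAlgebra.ι ℤ A a) : Algebra.adjoin ℤ (Set.range F)) :
      (AddMonoid.End V)ᵐᵒᵖ) = rightActHom f (TensorAlgebra.ι ℤ a)
    rw [rightActHom, TensorAlgebra.lift_ι_apply, SymmetricAlgebra.lift_ι_apply]
    rfl
  refine ⟨AddMonoidHom.mk' (fun s => (G' s).unop) fun s t => ?_, fun x v => ?_⟩
  · exact congrArg MulOpposite.unop (map_add G' (s : SymmetricAlgebra ℤ A) t)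
  · exact congrArg (fun φ => φ.unop v) (AlgHom.congr_fun hG x)

variable (A) in
/-- The projection `A ⊗ T(A) → A ⊗ S(A)`. -/
def toAS : A ⊗[ℤ] TensorAlgebra ℤ A →+ A ⊗[ℤ] SymRing A :=
  liftAT (AddMonoidHom.mk' (fun a => ((TensorProduct.mk ℤ A (SymRing A) a).toAddMonoidHom).comp
      (toSym A).toAddMonoidHom)
    fun a b => by ext x; exact TensorProduct.add_tmul a b (toSym A x))

@[simp]
theorem toAS_tmul (a : A) (x : TensorAlgebra ℤ A) : toAS A (a ⊗ₜ x) = a ⊗ₜ toSym A x := rfl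

theorem exists_symEval (g : A →+ V) (f : A →+ AddMonoid.End V)
    (hf : ∀ a b v, f a (f b v) = f b (f a v)) :
    ∃ G : A ⊗[ℤ] SymRing A →+ V, ∀ m, G (toAS A m) = evalAct g f m := by
  obtain ⟨φ, hφ⟩ := exists_symAct f hf
  refine ⟨TensorProduct.liftAddHom (AddMonoidHom.mk' (fun a => φ.flip (g a)) fun a b => ?_) ?_,
    fun m => ?_⟩
  · rw [map_add, map_add]
  · intro n a s
    change φ s (g (n • a)) = φ (n • s) (g a)
    rw [map_zsmul, map_zsmul, map_zsmul]; rfl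
  · induction m using TensorProduct.induction_on with
    | zero => simp
    | tmul a x => exact hφ x (g a)
    | add m n hm hn => rw [map_add, map_add, hm, hn, map_add]

/-- The derivations of the tensor ring induced by endomorphisms of `A` descend to the symmetric
ring. -/
theorem exists_derS (d : A →+ A) :
    ∃ D : SymRing A →+ SymRing A, ∀ x, D (toSym A x) = toSym A (derT d x) := by
  let f : A →+ AddMonoid.End (SymRing A × SymRing A) :=
    genAct (fun a z => (z.1 * toSym A (TensorAlgebra.ι ℤ a),
        z.2 * toSym A (TensorAlgebra.ι ℤ a) + z.1 * toSym A (TensorAlgebra.ι ℤ (d a))))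
      (fun a z w => by
        refine Prod.ext (add_mul _ _ _) ?_
        dsimp only [Prod.fst_add, Prod.snd_add]
        ring)
      (fun a b z => by
        refine Prod.ext ?_ ?_
        · dsimp only [Prod.fst_add]; rw [map_add, map_add, mul_add]
        · dsimp only [Prod.snd_add]; rw [map_add, map_add, map_add, map_add, map_add]; ring)
  obtain ⟨φ, hφ⟩ := exists_symAct f (fun a b z => by
    refine Prod.ext ?_ ?_
    · exact mul_right_comm _ _ _
    · change (z.2 * _ + z.1 * _) * _ + z.1 * _ * _ = (z.2 * _ + z.1 * _) * _ + z.1 * _ * _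
      ring)
  refine ⟨(AddMonoidHom.snd _ _).comp (φ.flip (1, 0)), fun x => ?_⟩
  change (φ (toSym A x) (1, 0)).2 = _
  rw [hφ]
  have h := map_rightAct (derTAux d) f
    (AddMonoidHom.prodMap (toSym A).toAddMonoidHom (toSym A).toAddMonoidHom) (fun a z => by
      refine Prod.ext ?_ ?_
      · exact map_mul (toSym A) z.1 _
      · change toSym A (_ + _) = toSym A _ * toSym A _ + toSym A _ * toSym A _
        rw [map_add, map_mul, map_mul]; rfl) x (1, 0)
  have h0 : AddMonoidHom.prodMap (toSym A).toAddMonoidHom (toSym A).toAddMonoidHom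
      ((1, 0) : TensorAlgebra ℤ A × TensorAlgebra ℤ A) = (1, 0) :=
    Prod.ext (map_one (toSym A)) (map_zero (toSym A))
  rw [h0] at h
  rw [← h]
  rfl

/-- The derivation of `S(A)` induced by an endomorphism of `A`. -/
def derS (d : A →+ A) : SymRing A →+ SymRing A := (exists_derS d).choose

theorem derS_toSym (d : A →+ A) (x : TensorAlgebra ℤ A) :
    derS d (toSym A x) = toSym A (derT d x) := (exists_derS d).choose_spec x

/-- The diagonal action of an endomorphism of `A` on `A ⊗ S(A)`. -/
def derAS (d : A →+ A) : A ⊗[ℤ] SymRing A →+ A ⊗[ℤ] SymRing A :=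
  (TensorProduct.map d.toIntLinearMap LinearMap.id).toAddMonoidHom +
    (TensorProduct.map LinearMap.id (derS d).toIntLinearMap).toAddMonoidHom

theorem derAS_tmul (d : A →+ A) (a : A) (s : SymRing A) :
    derAS d (a ⊗ₜ s) = d a ⊗ₜ s + a ⊗ₜ derS d s := rfl

theorem derAS_toAS (d : A →+ A) (m : A ⊗[ℤ] TensorAlgebra ℤ A) :
    derAS d (toAS A m) = toAS A (derAT d m) := by
  induction m using TensorProduct.induction_on with
  | zero => simp
  | tmul a x =>
    rw [toAS_tmul, derAS_tmul, derS_toSym, derAT_tmul, map_add, toAS_tmul, toAS_tmul]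
  | add m n hm hn => rw [map_add, map_add, map_add, map_add, hm, hn]

theorem toAS_rightAct_toTensor {u : FreeLieRing A} (hu : u ∈ derived₁ A)
    (m : A ⊗[ℤ] TensorAlgebra ℤ A) : toAS A (rightAct mulGen (toTensor A u) m) = 0 := by
  induction m using TensorProduct.induction_on with
  | zero => simp
  | tmul a x =>
    rw [mulGen_act_tmul, toAS_tmul, map_mul, toSym_toTensor hu, mul_zero, TensorProduct.tmul_zero]
  | add m n hm hn => rw [map_add, map_add, hm, hn, add_zero]

variable (A) in
/-- The Magnus embedding of the derived ideal of the free metabelian Lie ring: the Fox derivative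
with coefficients in the symmetric ring. -/
def magnus : FreeLieRing A →+ A ⊗[ℤ] SymRing A := (toAS A).comp ((fox A).comp (toTensor A))

theorem magnus_apply (u : FreeLieRing A) : magnus A u = toAS A (fox A (toTensor A u)) := rfl

theorem magnus_der (d : A →+ A) (u : FreeLieRing A) :
    magnus A (der d u) = derAS d (magnus A u) := by
  rw [magnus_apply, toTensor_der, fox_derT, magnus_apply, derAS_toAS]

theorem magnus_derived₂ {u : FreeLieRing A} (hu : u ∈ derived₂ A) : magnus A u = 0 := by
  refine derivedSeries_succ_induction 1 (P := fun u => magnus A u = 0) ?_ ?_ ?_ ?_ hu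
  · rw [map_zero]
  · intro u v hu hv; rw [map_add, hu, hv, add_zero]
  · intro u hu; rw [map_neg, hu, neg_zero]
  · intro u v hu hv
    rw [magnus_apply, fox_toTensor_lie, map_sub, toAS_rightAct_toTensor hv,
      toAS_rightAct_toTensor hu, sub_zero]

theorem exists_metabEval_eq (d : A →+ A) : ∃ G : A ⊗[ℤ] SymRing A →+
    metabDerived A × (A →+ metabDerived A), ∀ m, G (toAS A m) = metabEval d m :=
  exists_symEval _ _ pairGen_comm

theorem mapL_mem_derivedSeries (s : A →+ A) (k : ℕ) {u : FreeLieRing A}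
    (hu : u ∈ LieAlgebra.derivedSeries ℤ (FreeLieRing A) k) :
    mapL s u ∈ LieAlgebra.derivedSeries ℤ (FreeLieRing A) k := by
  induction k generalizing u with
  | zero => exact LieSubmodule.mem_top _
  | succ k ih =>
    refine derivedSeries_succ_induction k (P := fun u => mapL s u ∈ _) ?_ ?_ ?_ ?_ hu
    · rw [map_zero]; exact zero_mem _
    · intro u v hu hv; rw [map_add]; exact add_mem hu hv
    · intro u hu; rw [map_neg]; exact neg_mem hu
    · intro u v hu hv
      rw [LieHom.map_lie, LieAlgebra.derivedSeries_def, LieAlgebra.derivedSeriesOfIdeal_succ]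
      exact LieSubmodule.lie_mem_lie (ih hu) (ih hv)

/-- In prime degree, the metabelian Lie power is torsion-free. -/
theorem mem_derived₂_of_zsmul_mem [Module.Free ℤ A] {p : ℕ} (hp : p.Prime) {u : FreeLieRing A}
    (hu : u ∈ lieDeg A p) {k : ℤ} (hk : k ≠ 0) (h : k • u ∈ derived₂ A) : u ∈ derived₂ A := by
  obtain ⟨n, rfl⟩ : ∃ n, p = n + 2 := ⟨p - 2, by have := hp.two_le; omega⟩
  have h0 : magnus A u = 0 := by
    have h1 := magnus_derived₂ h
    rw [map_zsmul] at h1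
    have := free_tensorProduct_int A (SymRing A)
    exact (smul_eq_zero_iff_right hk).1 h1
  have h2 : ∀ d, der d u ∈ derived₂ A := by
    intro d
    obtain ⟨G, hG⟩ := exists_metabEval_eq (A := A) d
    have h3 := hG (fox A (toTensor A u))
    rw [← magnus_apply, h0, map_zero] at h3
    rw [← toMetab_eq_zero, ← metabEval_fox_toTensor d hu, ← h3]; rfl
  refine mem_of_der_mem hp (derived₂ A) (fun d u hu => der_mem_derivedSeries (der d) 2 u hu)
    (fun s u hu => mapL_mem_derivedSeries s 2 hu) hu ?_ h2
  rw [← der_id hu]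
  exact h2 _

end Symmetric

/-! ### Torsion of the metabelian coinvariants -/

section Coinvariants

variable {X A : Type*} [AddCommGroup A] [Module (MvPolynomial X ℤ) A]

variable (X A) in
/-- The subgroup `L(A) X` generated by the images of the derivations `varDer A x`, so that
`L(A) ⊗_U ℤ = L(A) / L(A) X`. -/
def lieAug : AddSubgroup (FreeLieRing A) :=
  augSub fun x : X => (der (varOp X A x) : FreeLieRing A →ₗ[ℤ] FreeLieRing A).toAddMonoidHom

theorem der_mem_lieAug (x : X) (u : FreeLieRing A) : der (varOp X A x) u ∈ lieAug X A :=
  AddSubgroup.subset_closure ⟨x, u, rfl⟩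

/-- The torsion of the coinvariants of the metabelian Lie power of degree `n` is annihilated
by `n`. -/
theorem exists_sub_mem_derived₂ [Module.Free (MvPolynomial X ℤ) A] [Module.Free ℤ A] {n : ℕ}
    {u : FreeLieRing A} (hu : u ∈ lieDeg A (n + 2)) {k : ℤ} (hk : k ≠ 0) {v : FreeLieRing A}
    (hv : v ∈ lieAug X A) (h : k • u - v ∈ derived₂ A) :
    ∃ w ∈ lieAug X A, (n + 2) • u - w ∈ derived₂ A := by
  have h1 : magnus A v ∈ augSub fun x : X => derAS (varOp X A x) :=
    map_mem_augSub (f := fun x : X =>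
        (der (varOp X A x) : FreeLieRing A →ₗ[ℤ] FreeLieRing A).toAddMonoidHom)
      (f' := fun x : X => derAS (varOp X A x)) (magnus A)
      (fun x u => magnus_der (varOp X A x) u) hv
  have h2 : k • magnus A u ∈ augSub fun x : X => derAS (varOp X A x) := by
    have h3 := magnus_derived₂ h
    rw [map_sub, sub_eq_zero, map_zsmul] at h3
    rwa [h3]
  have hcomm : ∀ (x y : X) (s : SymRing A), derS (varOp X A x) (derS (varOp X A y) s) =
      derS (varOp X A y) (derS (varOp X A x) s) := by
    intro x y s
    obtain ⟨t, rfl⟩ := toSym_surjective s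
    rw [derS_toSym, derS_toSym, derS_toSym, derS_toSym, derT_comm]
    exact fun a => smul_comm _ _ _
  have h4 := mem_augSub_of_zsmul_mem (fun x : X => derS (varOp X A x)) hcomm
    (fun x : X => derAS (varOp X A x))
    (fun x a s => derAS_tmul (varOp X A x) a s) hk h2
  obtain ⟨G, hG⟩ := exists_metabEval_eq (A := A) (AddMonoidHom.id A)
  choose dV hdV1 hdV2 using fun x : X => exists_pairDer (varOp X A x)
  have hsurj : Function.Surjective (toAS A) := by
    intro m
    induction m using TensorProduct.induction_on with
    | zero => exact ⟨0, map_zero _⟩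
    | tmul a s => obtain ⟨x, rfl⟩ := toSym_surjective s; exact ⟨a ⊗ₜ x, rfl⟩
    | add m n hm hn =>
      obtain ⟨m, rfl⟩ := hm
      obtain ⟨n, rfl⟩ := hn
      exact ⟨m + n, map_add _ _ _⟩
  have h5 : G (magnus A u) ∈ augSub dV := by
    refine map_mem_augSub G (fun x m => ?_) h4
    obtain ⟨m, rfl⟩ := hsurj m
    rw [derAS_toAS, hG, hG, hdV2]
  have h6 : ∀ z ∈ augSub dV, ∃ w ∈ lieAug X A,
      ((z.1 : metabDerived A) : Metab A) = toMetab A w := by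
    intro z hz
    induction hz using AddSubgroup.closure_induction with
    | mem z hz =>
      obtain ⟨x, z, rfl⟩ := hz
      obtain ⟨w, hw⟩ := toMetab_surjective (z.1 : Metab A)
      exact ⟨_, der_mem_lieAug x w, hdV1 x z w hw.symm⟩
    | zero => exact ⟨0, zero_mem _, (map_zero _).symm⟩
    | add z z' _ _ hz hz' =>
      obtain ⟨w, hw, h⟩ := hz
      obtain ⟨w', hw', h'⟩ := hz'
      exact ⟨w + w', add_mem hw hw', by rw [Prod.fst_add, AddSubgroup.coe_add, h, h', map_add]⟩
    | neg z _ hz =>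
      obtain ⟨w, hw, h⟩ := hz
      exact ⟨-w, neg_mem hw, by rw [Prod.fst_neg, AddSubgroup.coe_neg, h, map_neg]⟩
  obtain ⟨w, hw, h7⟩ := h6 _ h5
  refine ⟨w, hw, ?_⟩
  rw [magnus_apply, hG, metabEval_fox_toTensor _ hu, der_id hu, toMetab_eq] at h7
  exact h7

end Coinvariants

/-! ### Divisibility of the symmetrization by the prime -/

section Polarization

variable {A : Type*} [AddCommGroup A]

open Polynomial in
/-- Polarization: if the values of a polynomial of degree `n` at the elements of `A` lie in a
subgroup of `S(A)`, then `n!` times the polarized leading term lies in this subgroup. The proof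
takes successive differences of the polynomial function. -/
theorem factorial_smul_mul_mem (J : AddSubgroup (SymRing A)) {n : ℕ} {x : TensorAlgebra ℤ A}
    (hx : x ∈ tensorDeg A n) (f : (SymRing A)[X]) (hf : f.natDegree ≤ n)
    (hJ : ∀ b : A, f.eval (toSym A (TensorAlgebra.ι ℤ b)) ∈ J) :
    n.factorial • (f.coeff n * toSym A x) ∈ J := by
  refine tensorDeg_induction (P := fun n x => ∀ f : (SymRing A)[X], f.natDegree ≤ n →
    (∀ b : A, f.eval (toSym A (TensorAlgebra.ι ℤ b)) ∈ J) →
    n.factorial • (f.coeff n * toSym A x) ∈ J) ?_ ?_ ?_ ?_ hx f hf hJ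
  · intro f hf hJ
    have h := hJ 0
    rw [eq_C_of_natDegree_le_zero hf, eval_C] at h
    rwa [Nat.factorial_zero, one_smul, map_one, mul_one]
  · intro n x y hx hy f hf hJ
    rw [map_add, mul_add, smul_add]
    exact add_mem (hx f hf hJ) (hy f hf hJ)
  · intro n x hx f hf hJ
    rw [map_neg, mul_neg, smul_neg]
    exact neg_mem (hx f hf hJ)
  · intro n x a _ hx f hf hJ
    set c := toSym A (TensorAlgebra.ι ℤ a)
    -- The difference `f(t + c) - f(t)` has degree `n`, with leading coefficient `(n + 1) c` times
    -- that of `f`.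
    have hcoeff : ((taylor c f) - f).coeff n = (n + 1 : ℕ) * f.coeff (n + 1) * c := by
      have h2 : (hasseDeriv n f).natDegree < 2 := by
        have := natDegree_hasseDeriv_le f n
        omega
      rw [coeff_sub, taylor_coeff, eval_eq_sum_range' h2, Finset.sum_range_succ,
        Finset.sum_range_one, hasseDeriv_coeff, hasseDeriv_coeff, zero_add, Nat.choose_self,
        add_comm 1 n, Nat.choose_succ_self_right]
      push_cast
      ring
    have hdeg : ((taylor c f) - f).natDegree ≤ n := by
      rw [natDegree_le_iff_coeff_eq_zero]
      intro m hm
      have h2 : (hasseDeriv m f).natDegree < 1 := by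
        have := natDegree_hasseDeriv_le f m
        omega
      rw [coeff_sub, taylor_coeff, eval_eq_sum_range' h2, Finset.sum_range_one, hasseDeriv_coeff,
        zero_add, Nat.choose_self]
      ring
    have h := hx _ hdeg fun b => by
      rw [eval_sub, taylor_eval, ← map_add, ← map_add]
      exact sub_mem (hJ (b + a)) (hJ b)
    rw [hcoeff] at h
    rw [Nat.factorial_succ, map_mul]
    convert h using 1
    rw [nsmul_eq_mul, nsmul_eq_mul]
    push_cast
    ring

theorem factorial_smul_toSym_mem {n : ℕ} {x : TensorAlgebra ℤ A} (hx : x ∈ tensorDeg A n) :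
    n.factorial • toSym A x ∈
      AddSubgroup.closure (Set.range fun b : A => toSym A (TensorAlgebra.ι ℤ b ^ n)) := by
  have h := factorial_smul_mul_mem hx (Polynomial.X ^ n) (Polynomial.natDegree_X_pow_le n)
    (J := AddSubgroup.closure (Set.range fun b : A => toSym A (TensorAlgebra.ι ℤ b ^ n)))
    fun b => by
      rw [Polynomial.eval_pow, Polynomial.eval_X, ← map_pow]
      exact AddSubgroup.subset_closure ⟨b, rfl⟩
  rwa [Polynomial.coeff_X_pow_self, one_mul] at h

theorem insertOp_pow (a b : A) (k : ℕ) : insertOp a (TensorAlgebra.ι ℤ b ^ k) =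
    ∑ m ∈ Finset.range (k + 1),
      TensorAlgebra.ι ℤ b ^ (k - m) * TensorAlgebra.ι ℤ a * TensorAlgebra.ι ℤ b ^ m := by
  induction k with
  | zero => simp
  | succ k ih =>
    rw [pow_succ, insertOp_mul_ι, ih, Finset.sum_range_succ' _ (k + 1), Finset.sum_mul]
    congr 1
    · refine Finset.sum_congr rfl fun m _ => ?_
      rw [mul_assoc, ← pow_succ, Nat.add_sub_add_right]
    · rw [pow_zero, mul_one, ← pow_succ, Nat.sub_zero]

theorem insertOp_pow_self (b : A) (k : ℕ) : insertOp b (TensorAlgebra.ι ℤ b ^ k) =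
    (k + 1) • TensorAlgebra.ι ℤ b ^ (k + 1) := by
  rw [insertOp_pow, Finset.sum_congr rfl (g := fun _ => TensorAlgebra.ι ℤ b ^ (k + 1)),
    Finset.sum_const, Finset.card_range]
  intro m hm
  rw [← pow_succ, ← pow_add]
  congr 1
  have := Finset.mem_range.1 hm
  omega

theorem symmT_pow (b : A) (k : ℕ) :
    symmT A k (TensorAlgebra.ι ℤ b ^ k) = k.factorial • TensorAlgebra.ι ℤ b ^ k := by
  induction k with
  | zero => simp
  | succ k ih =>
    rw [pow_succ, symmT_succ_mul_ι, ih, map_nsmul, insertOp_pow_self, smul_smul, ← pow_succ,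
      Nat.factorial_succ, mul_comm]

/-- Symmetrized words are, up to a factorial, combinations of powers. -/
theorem factorial_smul_symmT_mem {n : ℕ} {x : TensorAlgebra ℤ A} (hx : x ∈ tensorDeg A n) :
    n.factorial • symmT A n x ∈
      AddSubgroup.closure (Set.range fun b : A => TensorAlgebra.ι ℤ b ^ n) := by
  obtain ⟨φ, hφ⟩ := exists_symAct (insertSeq (A := A)) insertSeq_comm
  let g : SymRing A →+ TensorAlgebra ℤ A :=
    (Pi.evalAddMonoidHom (fun _ => TensorAlgebra ℤ A) n).comp (φ.flip (Pi.single 0 1))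
  have hg : ∀ y, g (toSym A y) = symmT A n y := fun y => congrFun (hφ y _) n
  have h := factorial_smul_toSym_mem hx
  rw [← hg, ← map_nsmul]
  refine (AddSubgroup.closure_le (K := (AddSubgroup.closure
    (Set.range fun b : A => TensorAlgebra.ι ℤ b ^ n)).comap g)).2 ?_ h
  rintro _ ⟨b, rfl⟩
  refine AddSubgroup.mem_comap.2 ?_
  rw [hg, symmT_pow]
  exact nsmul_mem (AddSubgroup.subset_closure (Set.mem_range_self b)) _

variable (A) in
/-- The right action of the generators on `T(A)` by commutators. -/
def adTensor : A →+ AddMonoid.End (TensorAlgebra ℤ A) :=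
  genAct (fun b y => y * TensorAlgebra.ι ℤ b - TensorAlgebra.ι ℤ b * y)
    (fun b y z => by rw [add_mul, mul_add]; abel)
    (fun b c y => by rw [map_add, add_mul, mul_add]; abel)

theorem toTensor_adAct (x : TensorAlgebra ℤ A) (u : FreeLieRing A) :
    toTensor A (adAct x u) = rightAct (adTensor A) x (toTensor A u) :=
  map_rightAct _ _ (toTensor A) (fun a v => by
    rw [adGen_apply, toTensor_lie, toTensor_ι]; rfl) x u

theorem rightAct_adTensor_pow (b : A) (k : ℕ) (y : TensorAlgebra ℤ A) :
    rightAct (adTensor A) (TensorAlgebra.ι ℤ b ^ k) y =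
      ∑ m ∈ Finset.range (k + 1), ((-1) ^ (k - m) * (k.choose m : ℤ)) •
        (TensorAlgebra.ι ℤ b ^ (k - m) * y * TensorAlgebra.ι ℤ b ^ m) := by
  let R := LinearMap.mulRight ℤ (TensorAlgebra.ι ℤ b)
  let L := LinearMap.mulLeft ℤ (TensorAlgebra.ι ℤ b)
  have hRL : Commute R L := LinearMap.ext fun z => (mul_assoc _ _ _)
  have h1 : rightAct (adTensor A) (TensorAlgebra.ι ℤ b ^ k) y = ((R + -L) ^ k) y := by
    induction k with
    | zero => simp
    | succ k ih =>
      rw [pow_succ, rightAct_mul_ι, ih, pow_succ', Module.End.mul_apply, LinearMap.add_apply,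
        LinearMap.neg_apply]
      exact sub_eq_add_neg _ _
  rw [h1, hRL.neg_right.add_pow, LinearMap.sum_apply]
  refine Finset.sum_congr rfl fun m _ => ?_
  rw [neg_pow L, LinearMap.pow_mulRight, LinearMap.pow_mulLeft]
  have h2 : ((-1 : Module.End ℤ (TensorAlgebra ℤ A)) ^ (k - m)) =
      ((-1 : ℤ) ^ (k - m)) • (1 : Module.End ℤ (TensorAlgebra ℤ A)) := by
    rcases neg_one_pow_eq_or ℤ (k - m) with h | h <;>
    rcases Nat.even_or_odd (k - m) with h' | h' <;> simp_all [Odd.neg_one_pow]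
  rw [h2, ← nsmul_eq_mul', mul_smul]
  simp only [smul_mul_assoc, one_mul, mul_smul_comm, LinearMap.smul_apply, Module.End.mul_apply,
    LinearMap.mulLeft_apply, LinearMap.mulRight_apply, mul_assoc, natCast_zsmul]
  rw [smul_comm]

theorem dvd_choose_sub_neg_one_pow {p : ℕ} (hp : p.Prime) (i : ℕ) (hi : i < p) :
    (p : ℤ) ∣ ((p - 1).choose i : ℤ) - (-1) ^ i := by
  induction i with
  | zero => simp
  | succ i ih =>
    have h1 : ((p - 1).choose i + (p - 1).choose (i + 1) : ℤ) = p.choose (i + 1) := by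
      obtain ⟨q, rfl⟩ : ∃ q, p = q + 1 := ⟨p - 1, by have := hp.pos; omega⟩
      rw [Nat.add_sub_cancel, Nat.choose_succ_succ]; push_cast; rfl
    have h2 : (p : ℤ) ∣ p.choose (i + 1) := by
      exact_mod_cast hp.dvd_choose_self (Nat.succ_ne_zero i) hi
    have h3 := dvd_sub h2 (ih (by omega))
    rw [← h1] at h3
    have h4 : ((p - 1).choose (i + 1) : ℤ) - (-1) ^ (i + 1) = (p - 1).choose i +
        (p - 1).choose (i + 1) - ((p - 1).choose i - (-1) ^ i) := by
      rw [pow_succ]; ring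
    rwa [h4]

/-- Modulo `p`, the binomial coefficients `(p - 1).choose i` are `±1`, and the commutator with the
`(p - 1)`-st power of a letter agrees with the insertion operator. -/
theorem exists_adAct_pow_eq {p : ℕ} (hp : p.Prime) (a b : A) : ∃ z : TensorAlgebra ℤ A,
    toTensor A (adAct (TensorAlgebra.ι ℤ b ^ (p - 1)) (ι A a)) -
      insertOp a (TensorAlgebra.ι ℤ b ^ (p - 1)) = p • z := by
  rw [toTensor_adAct, rightAct_adTensor_pow, insertOp_pow, ← Finset.sum_sub_distrib, toTensor_ι]
  have h : ∀ m ∈ Finset.range (p - 1 + 1), ∃ c : ℤ,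
      (-1) ^ (p - 1 - m) * ((p - 1).choose m : ℤ) - 1 = p * c := by
    intro m hm
    have hm' : m ≤ p - 1 := Nat.lt_succ_iff.1 (Finset.mem_range.1 hm)
    have h1 := (dvd_choose_sub_neg_one_pow hp (p - 1 - m)
      (by have := hp.pos; omega)).mul_left ((-1) ^ (p - 1 - m))
    rw [Nat.choose_symm hm', mul_sub, ← mul_pow] at h1
    have h2 : (p : ℤ) ∣ (-1) ^ (p - 1 - m) * ((p - 1).choose m : ℤ) - 1 := by simpa using h1
    exact h2
  choose! c hc using h
  refine ⟨∑ m ∈ Finset.range (p - 1 + 1), c m • (TensorAlgebra.ι ℤ b ^ (p - 1 - m) *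
    TensorAlgebra.ι ℤ a * TensorAlgebra.ι ℤ b ^ m), ?_⟩
  rw [Finset.smul_sum]
  refine Finset.sum_congr rfl fun m hm => ?_
  rw [← natCast_zsmul, smul_smul, ← hc m hm, sub_smul, one_smul]

theorem symmT_mul_comm (k : ℕ) (x y : TensorAlgebra ℤ A) :
    symmT A k (x * y) = symmT A k (y * x) := by
  rw [symmT_apply, symmT_apply, rightAct_mul, rightAct_mul, rightAct_comm insertSeq insertSeq_comm]

/-- The congruence for powers extends to symmetrized words by polarization, as `(p - 1)!` is
invertible modulo `p`. -/
theorem exists_adAct_symmT_eq {p : ℕ} (hp : p.Prime) (a : A) {x : TensorAlgebra ℤ A}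
    (hx : x ∈ tensorDeg A (p - 1)) : ∃ z : TensorAlgebra ℤ A,
    toTensor A (adAct (symmT A (p - 1) x) (ι A a)) - insertOp a (symmT A (p - 1) x) = p • z := by
  let F : TensorAlgebra ℤ A →+ TensorAlgebra ℤ A :=
    (toTensor A).comp (orbit (adGen A) (ι A a)) - insertOp a
  let J : AddSubgroup (TensorAlgebra ℤ A) :=
    (nsmulAddMonoidHom (α := TensorAlgebra ℤ A) p).range.comap F
  have h1 : (p - 1).factorial • symmT A (p - 1) x ∈ J := by
    refine (AddSubgroup.closure_le J).2 ?_ (factorial_smul_symmT_mem hx)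
    rintro _ ⟨b, rfl⟩
    obtain ⟨z, hz⟩ := exists_adAct_pow_eq hp a b
    exact ⟨z, hz.symm⟩
  have h2 : (p : ℤ) • symmT A (p - 1) x ∈ J :=
    ⟨F (symmT A (p - 1) x), by rw [map_zsmul, natCast_zsmul]; rfl⟩
  have hcop : IsCoprime ((p - 1).factorial : ℤ) (p : ℤ) :=
    Nat.isCoprime_iff_coprime.2 ((hp.coprime_factorial_of_lt
      (by have := hp.pos; omega)).symm)
  rw [← natCast_zsmul] at h1
  obtain ⟨z, hz⟩ := mem_of_coprime_smul_mem J hcop h1 h2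
  exact ⟨z, hz.symm⟩

/-- In the tensor ring, the symmetrization of `u` is congruent modulo `p` to the full symmetrization
of the tensor `u`, which vanishes as `u` is a sum of commutators. -/
theorem exists_toTensor_symmetrize_eq {p : ℕ} (hp : p.Prime) {u : FreeLieRing A}
    (hu : u ∈ lieDeg A p) :
    ∃ z : TensorAlgebra ℤ A, toTensor A (symmetrize (p - 1) u) = p • z := by
  have hp1 : p - 1 + 1 = p := by have := hp.pos; omega
  have key : ∀ m ∈ tensorDegAT A (p - 1), ∃ z : TensorAlgebra ℤ A,
      toTensor A (symmLie (p - 1) m) - symmT A (p - 1 + 1) (unfox A m) = p • z := by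
    intro m hm
    induction hm using AddSubgroup.closure_induction with
    | mem m hm =>
      obtain ⟨a, x, hx, rfl⟩ := hm
      obtain ⟨z, hz⟩ := exists_adAct_symmT_eq hp a hx
      refine ⟨z, ?_⟩
      rw [← hz, symmLie_tmul, unfox_tmul, ← symmT_succ_mul_ι, symmT_mul_comm]
    | zero => exact ⟨0, by simp⟩
    | add m n _ _ hm hn =>
      obtain ⟨z, hz⟩ := hm
      obtain ⟨z', hz'⟩ := hn
      exact ⟨z + z', by rw [smul_add, ← hz, ← hz']; simp only [map_add]; abel⟩
    | neg m _ hm =>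
      obtain ⟨z, hz⟩ := hm
      exact ⟨-z, by rw [smul_neg, ← hz]; simp only [map_neg]; abel⟩
  obtain ⟨z, hz⟩ := key (fox A (toTensor A u))
    (fox_mem_tensorDegAT (by rw [hp1]; exact toTensor_mem hu))
  refine ⟨z, ?_⟩
  have h1 : u ∈ derived₁ A := by
    obtain ⟨n, rfl⟩ : ∃ n, p = n + 2 := ⟨p - 2, by have := hp.two_le; omega⟩
    exact mem_derivedSeries_one_of_mem_lieDeg hu
  have h2 := symmT_mul_toTensor (p - 1 + 1) 1 h1
  rw [one_mul] at h2
  rw [unfox_fox, aug_toTensor, zero_smul, sub_zero, h2, sub_zero] at hz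
  exact hz

theorem eq_of_nsmul_eq [Module.Free ℤ A] {p : ℕ} (hp : p.Prime) {u v : FreeLieRing A}
    (hu : u ∈ lieDeg A p) (hv : v ∈ lieDeg A p) (h : p • u = p • v) : u = v := by
  refine sub_eq_zero.1 (eq_zero_of_zsmul_eq_zero hp (sub_mem hu hv)
    (Int.natCast_ne_zero.2 hp.ne_zero) ?_)
  rw [smul_sub, natCast_zsmul, natCast_zsmul, h, sub_self]

/-- In prime degree `p`, the symmetrization is divisible by `p`. -/
theorem exists_theta [Module.Free ℤ A] {p : ℕ} (hp : p.Prime) :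
    ∃ θ : lieDeg A p →+ lieDeg A p, ∀ u, p • (θ u : FreeLieRing A) = symmetrize (p - 1) u := by
  have hp1 : p - 1 + 1 = p := by have := hp.pos; omega
  have h : ∀ u : lieDeg A p, ∃ v : lieDeg A p,
      p • (v : FreeLieRing A) = symmetrize (p - 1) (u : FreeLieRing A) := by
    intro u
    obtain ⟨z, hz⟩ := exists_toTensor_symmetrize_eq hp u.2
    have hu : symmetrize (p - 1) (u : FreeLieRing A) ∈ lieDeg A p := by
      have h := symmetrize_mem_lieDeg (k := p - 1) (u := (u : FreeLieRing A))
        (by rw [hp1]; exact u.2)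
      rwa [hp1] at h
    obtain ⟨v, hv, h⟩ := exists_nsmul_eq_of_toTensor_eq hp hu hz
    exact ⟨⟨v, hv⟩, h⟩
  choose θ hθ using h
  refine ⟨AddMonoidHom.mk' θ fun u v => Subtype.ext (eq_of_nsmul_eq hp (θ (u + v)).2
    (θ u + θ v).2 ?_), hθ⟩
  rw [hθ, AddSubgroup.coe_add, AddSubgroup.coe_add, smul_add, hθ, hθ, map_add]

end Polarization

section Theta

variable {A : Type*} [AddCommGroup A] [Module.Free ℤ A] {p : ℕ} {θ : lieDeg A p →+ lieDeg A p}

theorem theta_der (hp : p.Prime)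
    (hθ : ∀ u, p • (θ u : FreeLieRing A) = symmetrize (p - 1) u) (d : A →+ A) (u : lieDeg A p) :
    (θ ⟨der d u, der_mem_lieDeg d u.2⟩ : FreeLieRing A) = der d (θ u : FreeLieRing A) := by
  refine eq_of_nsmul_eq hp (θ _).2 (der_mem_lieDeg d (θ u).2) ?_
  rw [hθ, symmetrize_der, ← hθ, map_nsmul]

theorem theta_eq_zero (hp : p.Prime)
    (hθ : ∀ u, p • (θ u : FreeLieRing A) = symmetrize (p - 1) u) (u : lieDeg A p)
    (hu : (u : FreeLieRing A) ∈ derived₂ A) : θ u = 0 := by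
  refine Subtype.ext (eq_of_nsmul_eq hp (θ u).2 (zero_mem _) ?_)
  rw [hθ, symmetrize_derived₂ _ hu]
  exact (smul_zero p).symm

/-- The factor `(p - 2)! p` of the symmetrization modulo `L(A)''` can be divided by `p`, because
`M^p(A)` is torsion-free. -/
theorem toMetab_theta (hp : p.Prime)
    (hθ : ∀ u, p • (θ u : FreeLieRing A) = symmetrize (p - 1) u) (u : lieDeg A p) :
    toMetab A (θ u : FreeLieRing A) = (p - 2).factorial • toMetab A u := by
  rw [← map_nsmul, toMetab_eq]
  refine mem_derived₂_of_zsmul_mem hp (sub_mem (θ u).2 (nsmul_mem u.2 _))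
    (Int.natCast_ne_zero.2 hp.ne_zero) ?_
  obtain ⟨n, rfl⟩ : ∃ n, p = n + 2 := ⟨p - 2, by have := hp.two_le; omega⟩
  rw [natCast_zsmul, smul_sub, hθ, ← toMetab_eq, Nat.add_sub_cancel, map_nsmul, map_nsmul]
  have h := toMetab_symmetrize u.2
  rw [smul_smul, mul_comm]
  exact h

end Theta

/-! ### An operator that separates weights -/

section Weight

variable {A : Type*} [AddCommGroup A]

/-- The correction term `Y(x)(a)` in the definition of `weightTensor`. -/
def weightCorr (p : ℕ) : A ⊗[ℤ] TensorAlgebra ℤ A →+ FreeLieRing A :=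
  -∑ k ∈ Finset.range (p - 2), ((p - 1).factorial / (k + 2).factorial) • symmLie (k + 1)

theorem weightCorr_apply (p : ℕ) (m : A ⊗[ℤ] TensorAlgebra ℤ A) : weightCorr p m =
    -∑ k ∈ Finset.range (p - 2),
      ((p - 1).factorial / (k + 2).factorial) • symmLie (k + 1) m := by
  rw [weightCorr, AddMonoidHom.neg_apply, AddMonoidHom.finsetSum_apply]
  rfl

theorem weightCorr_derAT (p : ℕ) (d : A →+ A) (m : A ⊗[ℤ] TensorAlgebra ℤ A) :
    weightCorr p (derAT d m) = der d (weightCorr p m) := by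
  simp only [weightCorr_apply, symmLie_derAT, map_neg, map_sum, map_nsmul]

theorem weightCorr_tmul_toTensor_mul (p : ℕ) (a : A) {u : FreeLieRing A} (hu : u ∈ derived₁ A)
    (x : TensorAlgebra ℤ A) : weightCorr p (a ⊗ₜ (toTensor A u * x)) = 0 := by
  rw [weightCorr_apply, neg_eq_zero]
  refine Finset.sum_eq_zero fun k _ => ?_
  rw [symmLie_tmul, symmT_toTensor_mul _ _ hu, adAct, rightAct_zero, smul_zero]

theorem weightCorr_tmul (p : ℕ) (a : A) {n : ℕ} {x : TensorAlgebra ℤ A} (hx : x ∈ tensorDeg A n) :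
    weightCorr p (a ⊗ₜ x) = -∑ k ∈ Finset.range (p - 2),
      if k + 1 = n then ((p - 1).factorial / (n + 1).factorial) • symmLie n (a ⊗ₜ x) else 0 := by
  rw [weightCorr_apply]
  congr 1
  refine Finset.sum_congr rfl fun k _ => ?_
  split_ifs with h
  · rw [← h]
  · rw [symmLie_tmul, symmT_eq_zero hx h, adAct, rightAct_zero, smul_zero]

theorem weightCorr_mem (p : ℕ) (a : A) {n : ℕ} {x : TensorAlgebra ℤ A} (hx : x ∈ tensorDeg A n) :
    weightCorr p (a ⊗ₜ x) ∈ lieDeg A (n + 1) := by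
  rw [weightCorr_tmul p a hx]
  refine neg_mem (sum_mem fun k _ => ?_)
  split_ifs
  · exact nsmul_mem (symmLie_mem_lieDeg (tmul_mem_tensorDegAT a hx)) _
  · exact zero_mem _

/-- An auxiliary right action on `L(A) × T(A)` for defining `weightTensor`. -/
def weightAux (p : ℕ) : A →+ AddMonoid.End (FreeLieRing A × TensorAlgebra ℤ A) :=
  genAct (fun a z => (⁅z.1, ι A a⁆ + weightCorr p (a ⊗ₜ z.2), z.2 * TensorAlgebra.ι ℤ a))
    (fun a z w => by
      refine Prod.ext ?_ (add_mul _ _ _)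
      dsimp only [Prod.fst_add, Prod.snd_add]
      rw [add_lie, TensorProduct.tmul_add, map_add]; abel)
    (fun a b z => by
      refine Prod.ext ?_ ?_
      · dsimp only [Prod.fst_add]
        rw [map_add, lie_add, TensorProduct.add_tmul, map_add]; abel
      · dsimp only [Prod.snd_add]
        rw [map_add, mul_add])

theorem weightAux_snd (p : ℕ) (x : TensorAlgebra ℤ A) :
    (rightAct (weightAux p) x (0, 1)).2 = x := by
  induction x using tensor_induction with
  | one => simp
  | add x y hx hy => rw [rightAct_add, Prod.snd_add, hx, hy]
  | neg x hx => rw [rightAct_neg, Prod.snd_neg, hx]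
  | mul_ι x a hx => rw [rightAct_mul_ι]; exact congrArg (· * _) hx

/-- The additive map `T(A) → L(A)` that is determined by its value `0` at `1` and by
`weightTensor (x a) = [weightTensor x, a] - ∑ₖ ((p - 1)! / (k + 1)!) [a, x̃ₖ]`, where the sum is
over `1 ≤ k ≤ p - 2` and `x̃ₖ` is the symmetrization of `x` in degree `k`. -/
def weightTensor (p : ℕ) : TensorAlgebra ℤ A →+ FreeLieRing A :=
  (AddMonoidHom.fst _ _).comp (orbit (weightAux p) (0, 1))

theorem weightTensor_one (p : ℕ) : weightTensor (A := A) p 1 = 0 := by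
  simp [weightTensor]

theorem weightTensor_mul_ι (p : ℕ) (x : TensorAlgebra ℤ A) (a : A) :
    weightTensor p (x * TensorAlgebra.ι ℤ a) =
      ⁅weightTensor p x, ι A a⁆ + weightCorr p (a ⊗ₜ x) := by
  have h : weightTensor p (x * TensorAlgebra.ι ℤ a) = ⁅weightTensor p x, ι A a⁆ +
      weightCorr p (a ⊗ₜ (rightAct (weightAux p) x (0, 1)).2) := by
    simp only [weightTensor, AddMonoidHom.comp_apply, orbit_apply, rightAct_mul_ι]; rfl
  rw [h, weightAux_snd]

theorem weightTensor_derT (p : ℕ) (d : A →+ A) (x : TensorAlgebra ℤ A) :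
    weightTensor p (derT d x) = der d (weightTensor p x) := by
  induction x using tensor_induction with
  | one => rw [derT_one, weightTensor_one, map_zero, map_zero]
  | add x y hx hy => simp only [map_add, hx, hy]
  | neg x hx => simp only [map_neg, hx]
  | mul_ι x a hx =>
    have h := der_adGen d a (weightTensor p x)
    rw [adGen_apply, adGen_apply, adGen_apply] at h
    have h' := weightCorr_derAT p d (a ⊗ₜ x)
    rw [derAT_tmul, map_add] at h'
    rw [derT_mul_ι, map_add, weightTensor_mul_ι, weightTensor_mul_ι, weightTensor_mul_ι, map_add, h,
      ← h', hx]
    abel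

theorem weightTensor_mem (p : ℕ) {n : ℕ} {x : TensorAlgebra ℤ A} (hx : x ∈ tensorDeg A n) :
    weightTensor p x ∈ lieDeg A n := by
  refine tensorDeg_induction (P := fun n x => weightTensor p x ∈ lieDeg A n) ?_ ?_ ?_ ?_ hx
  · rw [weightTensor_one]; exact zero_mem _
  · intro n x y hx hy; rw [map_add]; exact add_mem hx hy
  · intro n x hx; rw [map_neg]; exact neg_mem hx
  · intro n x a hx hx'
    rw [weightTensor_mul_ι]
    exact add_mem (lie_ι_mem_lieDeg hx' a) (weightCorr_mem p a hx)

theorem weightTensor_toTensor_mul (p : ℕ) {u : FreeLieRing A} (hu : u ∈ derived₁ A)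
    (x : TensorAlgebra ℤ A) :
    weightTensor p (toTensor A u * x) = adAct x (weightTensor p (toTensor A u)) := by
  induction x using tensor_induction with
  | one => simp
  | add x y hx hy => rw [mul_add, map_add, hx, hy, adAct, rightAct_add]
  | neg x hx => rw [mul_neg, map_neg, hx, adAct, rightAct_neg]
  | mul_ι x a hx =>
    rw [← mul_assoc, weightTensor_mul_ι, hx, weightCorr_tmul_toTensor_mul p a hu, add_zero, adAct,
      rightAct_mul_ι, adGen_apply]

/-- An operator on `L(A)` whose restriction to `L(A)'` is a derivation, and which acts on the
homogeneous elements of `L(A)' / L(A)''` of degree less than `p` as multiplication by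
`(p - 1)!`. -/
def weightOp (p : ℕ) : FreeLieRing A →+ FreeLieRing A := (weightTensor p).comp (toTensor A)

theorem weightOp_apply (p : ℕ) (u : FreeLieRing A) :
    weightOp p u = weightTensor p (toTensor A u) := rfl

theorem weightOp_mem (p : ℕ) {n : ℕ} {u : FreeLieRing A} (hu : u ∈ lieDeg A n) :
    weightOp p u ∈ lieDeg A n := weightTensor_mem p (toTensor_mem hu)

theorem weightOp_lie (p : ℕ) {u v : FreeLieRing A} (hu : u ∈ derived₁ A) (hv : v ∈ derived₁ A) :
    weightOp p ⁅u, v⁆ = ⁅weightOp p u, v⁆ + ⁅u, weightOp p v⁆ := by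
  rw [weightOp_apply, toTensor_lie, map_sub, weightTensor_toTensor_mul p hu,
    weightTensor_toTensor_mul p hv, adAct_toTensor, adAct_toTensor, ← weightOp_apply,
    ← weightOp_apply, ← lie_skew u (weightOp p v), sub_eq_add_neg]

theorem metabEval_tmul_unfox (a : A) {n : ℕ} {m : A ⊗[ℤ] TensorAlgebra ℤ A}
    (hm : m ∈ tensorDegAT A n) :
    adMetabDerived A a (metabEval (AddMonoidHom.id A) m).1 =
      (metabEval (AddMonoidHom.id A) (a ⊗ₜ unfox A m)).1 +
        (n + 1) • (metabEval (AddMonoidHom.id A) m).2 a := by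
  induction hm using AddSubgroup.closure_induction with
  | mem m h =>
    obtain ⟨c, x, hx, rfl⟩ := h
    have hskew : metabLie c a = -metabLie a c := by
      refine Subtype.ext ?_
      rw [AddSubgroup.coe_neg, coe_metabLie, coe_metabLie, ← map_neg, lie_skew]
    rw [unfox_tmul, metabEval_tmul_ι_mul a c hx, metabEval_tmul_snd, AddMonoidHom.id_apply, hskew,
      map_neg, smul_neg]
    abel
  | zero => simp
  | add m n _ _ hm hn =>
    simp only [map_add, TensorProduct.tmul_add, Prod.fst_add, Prod.snd_add, AddMonoidHom.add_apply,
      hm, hn, smul_add]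
    abel
  | neg m _ hm =>
    simp only [map_neg, TensorProduct.tmul_neg, Prod.fst_neg, Prod.snd_neg, AddMonoidHom.neg_apply,
      hm, smul_neg]
    abel

/-- Modulo `L(A)''`, `weightTensor` is a multiple of the evaluation of the Fox derivative. In degree
`n + 1` the factor `(p - 1)! / (n + 1)` compensates the factor by which `metabEval` multiplies Lie
elements of that degree. -/
theorem toMetab_weightTensor {p n : ℕ} (hn : n + 2 ≤ p) {x : TensorAlgebra ℤ A}
    (hx : x ∈ tensorDeg A (n + 1)) : toMetab A (weightTensor p x) =
      ((p - 1).factorial / (n + 1)) • ((metabEval (AddMonoidHom.id A) (fox A x)).1 : Metab A) := by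
  refine tensorDeg_induction (P := fun m x => ∀ n, m = n + 1 → n + 2 ≤ p →
    toMetab A (weightTensor p x) =
      ((p - 1).factorial / (n + 1)) • ((metabEval (AddMonoidHom.id A) (fox A x)).1 : Metab A))
    ?_ ?_ ?_ ?_ hx n rfl hn
  · intro n h; omega
  · intro m x y hx hy n h hn
    simp only [map_add, hx n h hn, hy n h hn, Prod.fst_add, AddSubgroup.coe_add, smul_add]
  · intro m x hx n h hn
    simp only [map_neg, hx n h hn, Prod.fst_neg, AddSubgroup.coe_neg, smul_neg]
  · intro m x a hx hx' n h hn
    obtain rfl : m = n := by omega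
    rw [weightTensor_mul_ι, weightCorr_tmul p a hx, map_add]
    match m with
    | 0 =>
      have h1 : weightTensor p x = 0 := by
        have h2 := weightTensor_mem p hx
        rwa [lieDeg_zero, AddSubgroup.mem_bot] at h2
      have h4 : (metabEval (AddMonoidHom.id A) (fox A (x * TensorAlgebra.ι ℤ a))).1 = 0 := by
        rw [fox_mul_ι, fox_eq_zero hx, map_zero, zero_add, map_zsmul, metabEval_tmul_one,
          Prod.smul_fst, pairBase_fst, smul_zero]
      rw [h1, zero_lie, map_zero, h4, AddSubgroup.coe_zero, smul_zero, Finset.sum_eq_zero, neg_zero,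
        map_zero, add_zero]
      intro k _
      rw [if_neg (Nat.succ_ne_zero k)]
    | m + 1 =>
      have h1 : ∑ k ∈ Finset.range (p - 2), (if k + 1 = m + 1 then
          ((p - 1).factorial / (m + 1 + 1).factorial) • symmLie (m + 1) (a ⊗ₜ[ℤ] x) else 0) =
          ((p - 1).factorial / (m + 1 + 1).factorial) • symmLie (m + 1) (a ⊗ₜ[ℤ] x) := by
        rw [Finset.sum_eq_single m, if_pos rfl]
        · intro k _ hk; rw [if_neg (by omega)]
        · intro hm; exact absurd (Finset.mem_range.2 (by omega)) hm
      have h2 := metabEval_tmul_unfox a (fox_mem_tensorDegAT hx)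
      rw [unfox_fox, aug_eq_zero (Nat.succ_ne_zero m) hx, zero_smul, sub_zero] at h2
      replace h2 := congrArg ((↑) : metabDerived A → Metab A) h2
      rw [AddSubgroup.coe_add, AddSubgroup.coe_nsmul, coe_adMetabDerived] at h2
      -- All integers that occur are multiples of `e = (p - 1)! / (m + 2)!`; the numerators of
      -- `weightCorr` are chosen so that these divisions are exact.
      obtain ⟨e, he⟩ := Nat.factorial_dvd_factorial (show m + 2 ≤ p - 1 by omega)
      have e1 : (p - 1).factorial / (m + 1 + 1).factorial = e := by
        rw [he]; exact Nat.mul_div_cancel_left _ (Nat.factorial_pos _)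
      have e2 : (p - 1).factorial / (m + 1) = e * m.factorial * (m + 2) := by
        refine Nat.div_eq_of_eq_mul_left (Nat.succ_pos m) ?_
        rw [he, Nat.factorial_succ, Nat.factorial_succ]; ring
      have e3 : (p - 1).factorial / (m + 1 + 1) = e * m.factorial * (m + 1) := by
        refine Nat.div_eq_of_eq_mul_left (Nat.succ_pos (m + 1)) ?_
        rw [he, Nat.factorial_succ, Nat.factorial_succ]; ring
      rw [h1, fox_mul_ι, aug_eq_zero (Nat.succ_ne_zero m) hx, zero_smul, add_zero, metabEval_mulGen,
        pairGen_fst, AddSubgroup.coe_add, coe_adMetabDerived, map_neg, map_nsmul,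
        toMetab_symmLie (tmul_mem_tensorDegAT a hx), ← adMetab_toMetab, hx' m rfl (by omega),
        map_nsmul, e1, e2, e3]
      generalize adMetab A a ((metabEval (AddMonoidHom.id A) (fox A x)).1 : Metab A) = E1 at h2 ⊢
      generalize (((metabEval (AddMonoidHom.id A) (fox A x)).2 a : metabDerived A) : Metab A) = E2
        at h2 ⊢
      generalize ((metabEval (AddMonoidHom.id A) (a ⊗ₜ[ℤ] x)).1 : Metab A) = E3 at h2 ⊢
      obtain rfl : E3 = E1 - (m + 1) • E2 := by rw [h2, add_sub_cancel_right]
      module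

/-- Modulo `L(A)''`, the operator `weightOp` acts as multiplication by `(p - 1)!` in degrees less
than `p`. -/
theorem toMetab_weightOp {p n : ℕ} (hn : n + 3 ≤ p) {u : FreeLieRing A}
    (hu : u ∈ lieDeg A (n + 2)) :
    toMetab A (weightOp p u) = (p - 1).factorial • toMetab A u := by
  rw [weightOp_apply, toMetab_weightTensor (n := n + 1) hn (toTensor_mem hu),
    metabEval_fox_toTensor _ hu, der_id hu, map_nsmul, smul_smul, Nat.div_mul_cancel]
  exact (Nat.dvd_factorial (Nat.succ_pos _) (show n + 2 ≤ p - 1 by omega))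

/-- The elements of degree `n` that are sums of `r`-fold products of homogeneous elements of degree
at least two, with respect to an arbitrary arrangement of brackets. -/
inductive IsWt : ℕ → ℕ → FreeLieRing A → Prop
  | base (n : ℕ) (u : FreeLieRing A) (hu : u ∈ lieDeg A (n + 2)) : IsWt 1 (n + 2) u
  | lie (i j m n : ℕ) (u v : FreeLieRing A) (hu : IsWt i m u) (hv : IsWt j n v) :
    IsWt (i + j) (m + n) ⁅u, v⁆
  | zero (r n : ℕ) : IsWt r (n + 2) 0
  | add (r n : ℕ) (u v : FreeLieRing A) (hu : IsWt r n u) (hv : IsWt r n v) : IsWt r n (u + v)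
  | neg (r n : ℕ) (u : FreeLieRing A) (hu : IsWt r n u) : IsWt r n (-u)

theorem IsWt.two_le {r n : ℕ} {u : FreeLieRing A} (h : IsWt r n u) : 2 ≤ n := by
  induction h with
  | base n u hu => omega
  | lie i j m n u v _ _ hu hv => omega
  | zero r n => omega
  | add r n u v _ _ hu hv => exact hu
  | neg r n u _ hu => exact hu

theorem IsWt.mem_lieDeg {r n : ℕ} {u : FreeLieRing A} (h : IsWt r n u) : u ∈ lieDeg A n := by
  induction h with
  | base n u hu => exact hu
  | lie i j m n u v _ _ hu hv => exact lie_mem_lieDeg hu hv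
  | zero r n => exact zero_mem _
  | add r n u v _ _ hu hv => exact add_mem hu hv
  | neg r n u _ hu => exact neg_mem hu

theorem IsWt.mem_derived₁ {r n : ℕ} {u : FreeLieRing A} (h : IsWt r n u) : u ∈ derived₁ A := by
  obtain ⟨m, rfl⟩ : ∃ m, n = m + 2 := ⟨n - 2, by have := h.two_le; omega⟩
  exact mem_derivedSeries_one_of_mem_lieDeg h.mem_lieDeg

theorem IsWt.eq_zero {r n : ℕ} {u : FreeLieRing A} (h : IsWt r n u) (hr : n < 2 * r) : u = 0 := by
  induction h with
  | base n u hu => omega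
  | lie i j m n u v _ _ hu hv =>
    rcases lt_or_ge m (2 * i) with h | h
    · rw [hu h, zero_lie]
    · rw [hv (by omega), lie_zero]
  | zero r n => rfl
  | add r n u v _ _ hu hv => rw [hu hr, hv hr, add_zero]
  | neg r n u _ hu => rw [hu hr, neg_zero]

theorem isWt_two_of_mem_derived₂ {n : ℕ} {u : FreeLieRing A} (hu : u ∈ lieDeg A (n + 2))
    (hu' : u ∈ derived₂ A) : IsWt 2 (n + 2) u := by
  have h := gradProj_derived₂_mem_closure (n + 2) hu'
  rw [gradProj_of_mem hu] at h
  clear hu hu'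
  induction h using AddSubgroup.closure_induction with
  | mem u h =>
    obtain ⟨i, j, hij, v, hv, v', hv', rfl⟩ := h
    rw [← hij]
    exact IsWt.lie 1 1 _ _ _ _ (IsWt.base i v hv) (IsWt.base j v' hv')
  | zero => exact IsWt.zero _ _
  | add u v _ _ hu hv => exact IsWt.add _ _ _ _ hu hv
  | neg u _ hu => exact IsWt.neg _ _ _ hu

/-- The operator `weightOp` acts on products of weight `r` as multiplication by `r (p - 1)!`, up to
products of larger weight. -/
theorem IsWt.weightOp_sub {p r n : ℕ} {u : FreeLieRing A} (h : IsWt r n u) (hn : n ≤ p)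
    (hr : n < p ∨ 2 ≤ r) : IsWt (r + 1) n (weightOp p u - ((p - 1).factorial * r) • u) := by
  induction h with
  | base n u hu =>
    refine isWt_two_of_mem_derived₂ (sub_mem (weightOp_mem p hu) (nsmul_mem hu _)) ?_
    rw [← toMetab_eq, toMetab_weightOp (by omega) hu, map_nsmul, mul_one]
  | lie i j m n u v hu hv hu' hv' =>
    have h1 := hu.two_le
    have h2 := hv.two_le
    have h3 := IsWt.lie _ _ _ _ _ _ (hu' (by omega) (by omega)) hv
    have h4 := IsWt.lie _ _ _ _ _ _ hu (hv' (by omega) (by omega))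
    rw [add_right_comm] at h3
    rw [← add_assoc] at h4
    convert IsWt.add _ _ _ _ h3 h4 using 1
    rw [weightOp_lie p hu.mem_derived₁ hv.mem_derived₁, sub_lie, lie_sub, nsmul_lie, lie_nsmul,
      mul_add, add_smul]
    abel
  | zero r n => rw [map_zero, smul_zero, sub_zero]; exact IsWt.zero _ _
  | add r n u v _ _ hu hv =>
    convert IsWt.add _ _ _ _ (hu hn hr) (hv hn hr) using 1
    rw [map_add, smul_add]; abel
  | neg r n u _ hu =>
    convert IsWt.neg _ _ _ (hu hn hr) using 1
    rw [map_neg, smul_neg]; abel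

end Weight

/-! ### Torsion and the Fox derivative -/

section Coinvariants

variable {X A : Type*} [AddCommGroup A] [Module (MvPolynomial X ℤ) A]

theorem unfox_derAT (d : A →+ A) (m : A ⊗[ℤ] TensorAlgebra ℤ A) :
    unfox A (derAT d m) = derT d (unfox A m) := by
  induction m using TensorProduct.induction_on with
  | zero => simp
  | tmul a x => rw [derAT_tmul, map_add, unfox_tmul, unfox_tmul, unfox_tmul, derT_mul, derT_ι]
  | add m n hm hn => simp only [map_add, hm, hn]

/-- The Fox derivative takes values in `A ⊗ T(A)`, whose coinvariants are torsion-free. Hence an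
equivariant map that factors through the Fox derivative annihilates the torsion of the coinvariants
of `L(A)`. -/
theorem map_fox_mem_lieAug [Module.Free (MvPolynomial X ℤ) A] [Module.Free ℤ A]
    (g : A ⊗[ℤ] TensorAlgebra ℤ A →+ FreeLieRing A)
    (hg : ∀ (d : A →+ A) m, g (derAT d m) = der d (g m))
    {u : FreeLieRing A} {k : ℤ} (hk : k ≠ 0) (h : k • u ∈ lieAug X A) :
    g (fox A (toTensor A u)) ∈ lieAug X A := by
  have h1 : k • fox A (toTensor A u) ∈ augSub fun x : X => derAT (varOp X A x) := by
    rw [← map_zsmul, ← map_zsmul]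
    exact map_mem_augSub (f := fun x : X =>
        (der (varOp X A x) : FreeLieRing A →ₗ[ℤ] FreeLieRing A).toAddMonoidHom)
      (f' := fun x : X => derAT (varOp X A x)) ((fox A).comp (toTensor A))
      (fun x v => (congrArg (fox A) (toTensor_der (varOp X A x) v)).trans (fox_derT _ _)) h
  have hcomm : ∀ (x y : X) (s : TensorAlgebra ℤ A),
      derT (varOp X A x) (derT (varOp X A y) s) = derT (varOp X A y) (derT (varOp X A x) s) :=
    fun x y s => derT_comm _ _ (fun a => smul_comm _ _ _) s
  have h2 := mem_augSub_of_zsmul_mem (fun x : X => derT (varOp X A x)) hcomm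
    (fun x : X => derAT (varOp X A x)) (fun x a s => derAT_tmul (varOp X A x) a s) hk h1
  exact map_mem_augSub (f := fun x : X => derAT (varOp X A x)) (f' := fun x : X =>
      (der (varOp X A x) : FreeLieRing A →ₗ[ℤ] FreeLieRing A).toAddMonoidHom) g
    (fun x m => hg (varOp X A x) m) h2

theorem weightOp_mem_lieAug [Module.Free (MvPolynomial X ℤ) A] [Module.Free ℤ A] (p : ℕ)
    {u : FreeLieRing A} {k : ℤ} (hk : k ≠ 0) (h : k • u ∈ lieAug X A) :
    weightOp p u ∈ lieAug X A := by
  have h1 := map_fox_mem_lieAug ((weightTensor p).comp (unfox A)) (fun d m =>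
    (congrArg (weightTensor p) (unfox_derAT d m)).trans (weightTensor_derT p _ _)) hk h
  rwa [AddMonoidHom.comp_apply, unfox_fox, aug_toTensor, zero_smul, sub_zero] at h1

/-- The torsion of the coinvariants of the Lie power of degree `n` is annihilated by `n`. -/
theorem nsmul_mem_lieAug [Module.Free (MvPolynomial X ℤ) A] [Module.Free ℤ A] {n : ℕ}
    {u : FreeLieRing A} (hu : u ∈ lieDeg A n) {k : ℤ} (hk : k ≠ 0) (h : k • u ∈ lieAug X A) :
    n • u ∈ lieAug X A := by
  have h1 := map_fox_mem_lieAug (evalAct ((ι A).comp (AddMonoidHom.id A)) (adGen A)) (fun d m =>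
    evalAct_derAT _ _ d (der d : FreeLieRing A →ₗ[ℤ] FreeLieRing A).toAddMonoidHom
      (fun a => der_ι d a) (der_adGen d) m) hk h
  rwa [evalAct_fox_toTensor, der_id hu] at h1

/-- An element of weight `r ≥ 2` and degree `p` that is torsion modulo `L(A) X` has order coprime to
`p` there: `weightOp` annihilates its class and also multiplies it by `r (p - 1)!`, which is coprime
to `p`, up to terms of weight greater than `r`, and weights greater than `p / 2` do not occur. -/
theorem exists_coprime_smul_mem_lieAug [Module.Free (MvPolynomial X ℤ) A] [Module.Free ℤ A] {p : ℕ}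
    (hp : p.Prime) {r : ℕ} {u : FreeLieRing A} (hr : 2 ≤ r) (hu : IsWt r p u) {k : ℤ} (hk : k ≠ 0)
    (h : k • u ∈ lieAug X A) : ∃ n : ℤ, IsCoprime n p ∧ n • u ∈ lieAug X A := by
  rcases lt_or_ge p (2 * r) with hpr | hpr
  · exact ⟨1, isCoprime_one_left, by rw [hu.eq_zero hpr, smul_zero]; exact zero_mem _⟩
  · have h1 := weightOp_mem_lieAug p hk h
    have h2 : k • (weightOp p u - ((p - 1).factorial * r) • u) ∈ lieAug X A := by
      rw [smul_sub, smul_comm]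
      exact sub_mem (AddSubgroup.zsmul_mem _ h1 _) (nsmul_mem h _)
    obtain ⟨n, hn, h3⟩ := exists_coprime_smul_mem_lieAug hp (by omega)
      (hu.weightOp_sub le_rfl (Or.inr hr)) hk h2
    refine ⟨n * ((p - 1).factorial * r : ℕ), hn.mul_left (Nat.isCoprime_iff_coprime.2 ?_), ?_⟩
    · refine Nat.Coprime.mul_left ?_ ?_
      · exact (hp.coprime_factorial_of_lt (by have := hp.pos; omega)).symm
      · exact (hp.coprime_iff_not_dvd.2 (Nat.not_dvd_of_pos_of_lt (by omega) (by omega))).symm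
    · rw [mul_smul, natCast_zsmul]
      have h4 := sub_mem (AddSubgroup.zsmul_mem _ h1 n) h3
      rwa [smul_sub, sub_sub_cancel] at h4
termination_by p - r

end Coinvariants

/-! ### The symmetrization of left-normed products -/

section Words

variable {A : Type*} [AddCommGroup A]

/-- The product `c₁ ⋯ cₙ` in the tensor ring. -/
def word {n : ℕ} (c : Fin n → A) : TensorAlgebra ℤ A :=
  (List.ofFn fun i => TensorAlgebra.ι ℤ (c i)).prod

theorem word_zero (c : Fin 0 → A) : word c = 1 := by simp [word]

theorem word_succ {n : ℕ} (c : Fin (n + 1) → A) :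
    word c = TensorAlgebra.ι ℤ (c 0) * word (fun i => c i.succ) := by
  rw [word, List.ofFn_succ, List.prod_cons]; rfl

theorem word_succ_last {n : ℕ} (c : Fin (n + 1) → A) :
    word c = word (fun i => c i.castSucc) * TensorAlgebra.ι ℤ (c (Fin.last n)) := by
  rw [word, List.ofFn_succ', List.concat_eq_append, List.prod_append, List.prod_singleton]; rfl

theorem insertOp_ι_mul (a b : A) (x : TensorAlgebra ℤ A) :
    insertOp a (TensorAlgebra.ι ℤ b * x) =
      TensorAlgebra.ι ℤ a * (TensorAlgebra.ι ℤ b * x) + TensorAlgebra.ι ℤ b * insertOp a x := by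
  induction x using tensor_induction with
  | one =>
    have h := insertOp_mul_ι a b 1
    rw [one_mul, insertOp_one] at h
    rw [mul_one, insertOp_one, h]
  | add x y hx hy => rw [mul_add, map_add, hx, hy, map_add, mul_add, mul_add]; abel
  | neg x hx => rw [mul_neg, map_neg, hx, map_neg, mul_neg, mul_neg]; abel
  | mul_ι x c hx =>
    rw [← mul_assoc, insertOp_mul_ι, hx, insertOp_mul_ι, add_mul, mul_add]
    simp only [mul_assoc]
    abel

theorem insertNth_succ_eq_cons {B : Type*} {n : ℕ} (j : Fin (n + 1)) (a : B) (c : Fin (n + 1) → B) :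
    (j.succ.insertNth a c : Fin (n + 2) → B) =
      Fin.cons (c 0) (j.insertNth a fun i => c i.succ : Fin (n + 1) → B) := by
  symm
  rw [Fin.eq_insertNth_iff]
  refine ⟨by simp, funext fun i => ?_⟩
  rw [Fin.removeNth_apply]
  cases i using Fin.cases with
  | zero => simp
  | succ i => simp

theorem insertOp_word (a : A) {n : ℕ} (c : Fin n → A) :
    insertOp a (word c) = ∑ j : Fin (n + 1), word (j.insertNth a c : Fin (n + 1) → A) := by
  induction n with
  | zero =>
    rw [word_zero, insertOp_one, Fin.sum_univ_one, word_succ, word_zero, mul_one]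
    simp
  | succ n ih =>
    rw [word_succ c, insertOp_ι_mul, ih, Finset.mul_sum, Fin.sum_univ_succ (n := n + 1),
      ← word_succ c]
    congr 1
    · rw [word_succ (Fin.insertNth 0 a c)]; simp
    · refine Finset.sum_congr rfl fun j _ => ?_
      rw [insertNth_succ_eq_cons, word_succ (Fin.cons _ _)]
      simp

/-- The permutation of `{0, …, n}` that sends `j` to `0` and agrees with `σ` elsewhere, up to
order-preserving relabelling. -/
def extendPerm {n : ℕ} (j : Fin (n + 1)) (σ : Equiv.Perm (Fin n)) : Equiv.Perm (Fin (n + 1)) :=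
  (finSuccEquiv' j).trans ((Equiv.optionCongr σ).trans (finSuccEquiv' 0).symm)

theorem extendPerm_self {n : ℕ} (j : Fin (n + 1)) (σ : Equiv.Perm (Fin n)) :
    extendPerm j σ j = 0 := by
  simp [extendPerm]

theorem extendPerm_succAbove {n : ℕ} (j : Fin (n + 1)) (σ : Equiv.Perm (Fin n)) (i : Fin n) :
    extendPerm j σ (j.succAbove i) = (σ i).succ := by
  simp [extendPerm]

theorem extendPerm_bijective (n : ℕ) :
    Function.Bijective fun z : Equiv.Perm (Fin n) × Fin (n + 1) => extendPerm z.2 z.1 := by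
  rw [Fintype.bijective_iff_injective_and_card]
  constructor
  · rintro ⟨σ, j⟩ ⟨τ, k⟩ h
    dsimp only at h
    obtain rfl : j = k := by
      refine (extendPerm j σ).injective ?_
      rw [extendPerm_self, h, extendPerm_self]
    refine Prod.ext (Equiv.ext fun i => ?_) rfl
    have h1 := congrArg (fun π : Equiv.Perm (Fin (n + 1)) => π (j.succAbove i)) h
    rwa [extendPerm_succAbove, extendPerm_succAbove, Fin.succ_inj] at h1
  · rw [Fintype.card_prod, Fintype.card_perm, Fintype.card_perm, Fintype.card_fin, Fintype.card_fin,
      Nat.factorial_succ, mul_comm]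

theorem symmT_word {n : ℕ} (c : Fin n → A) :
    symmT A n (word c) = ∑ σ : Equiv.Perm (Fin n), word (c ∘ σ) := by
  induction n with
  | zero => simp [word_zero]
  | succ n ih =>
    rw [word_succ, symmT_mul_comm, symmT_succ_mul_ι, ih, map_sum,
      ← (Equiv.ofBijective _ (extendPerm_bijective n)).sum_comp, Fintype.sum_prod_type]
    refine Finset.sum_congr rfl fun σ _ => ?_
    rw [insertOp_word]
    refine Finset.sum_congr rfl fun j _ => congrArg word ?_
    symm
    rw [Fin.eq_insertNth_iff]
    refine ⟨?_, funext fun i => ?_⟩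
    · exact congrArg c (extendPerm_self j σ)
    · exact congrArg c (extendPerm_succAbove j σ i)

theorem lieProd_eq_adAct {n : ℕ} (a : Fin (n + 1) → A) :
    lieProd a = adAct (word fun i => a i.succ) (ι A (a 0)) := by
  induction n with
  | zero => rw [word_zero, adAct, rightAct_one, lieProd_one]
  | succ n ih =>
    rw [lieProd_succ_succ, ih, word_succ_last, adAct, rightAct_mul_ι, adGen_apply]
    rfl

theorem symmLie_tmul_word {n : ℕ} (a : Fin (n + 1) → A) :
    symmLie n (a 0 ⊗ₜ word fun i => a i.succ) =
      ∑ σ : Equiv.Perm (Fin (n + 1)) with σ 0 = 0, lieProd (a ∘ σ) := by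
  have h1 : ∀ x : TensorAlgebra ℤ A, adAct x (ι A (a 0)) = orbit (adGen A) (ι A (a 0)) x :=
    fun _ => rfl
  rw [symmLie_tmul, symmT_word, h1, map_sum]
  symm
  rw [Finset.sum_filter,
    ← (Equiv.Perm.decomposeFin (n := n)).symm.sum_comp, Fintype.sum_prod_type,
    Finset.sum_eq_single 0]
  · refine Finset.sum_congr rfl fun σ _ => ?_
    rw [Equiv.Perm.decomposeFin_symm_apply_zero, if_pos rfl, lieProd_eq_adAct]
    simp only [Function.comp_apply, Equiv.Perm.decomposeFin_symm_apply_zero,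
      Equiv.Perm.decomposeFin_symm_apply_succ, Equiv.swap_self, Equiv.refl_apply]
    rfl
  · intro j _ hj
    refine Finset.sum_eq_zero fun σ _ => ?_
    rw [Equiv.Perm.decomposeFin_symm_apply_zero, if_neg hj]
  · intro h; exact absurd (Finset.mem_univ _) h

/-- In the Fox derivative of `[a₁, …, aₙ]`, the terms with first letter other than `a₁` and `a₂`
have a Lie product of length at least two as second tensor factor, and are annihilated by
`symmLie`. -/
theorem symmetrize_lieProd (k : ℕ) {n : ℕ} (a : Fin (n + 2) → A) :
    symmetrize k (lieProd a) = symmLie k (a 0 ⊗ₜ word fun i => a i.succ) -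
      symmLie k (a 1 ⊗ₜ word fun i => a (Equiv.swap 0 1 i.succ)) := by
  -- The subgroup `K` of elements with a commutator in the second tensor factor is killed by
  -- `symmLie k`, so that the Fox derivative is needed only modulo `K`.
  let K : AddSubgroup (A ⊗[ℤ] TensorAlgebra ℤ A) :=
    AddSubgroup.closure {m | ∃ b : A, ∃ v ∈ derived₁ A, ∃ y, m = b ⊗ₜ (toTensor A v * y)}
  have hK : ∀ m ∈ K, ∀ b, mulGen b m ∈ K := by
    intro m hm b
    induction hm using AddSubgroup.closure_induction with
    | mem m h =>
      obtain ⟨c, v, hv, y, rfl⟩ := h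
      rw [mulGen_tmul, mul_assoc]
      exact AddSubgroup.subset_closure ⟨c, v, hv, _, rfl⟩
    | zero => rw [map_zero]; exact zero_mem _
    | add m n _ _ hm hn => rw [map_add]; exact add_mem hm hn
    | neg m _ hm => rw [map_neg]; exact neg_mem hm
  have hK0 : ∀ m ∈ K, symmLie k m = 0 := by
    intro m hm
    induction hm using AddSubgroup.closure_induction with
    | mem m h =>
      obtain ⟨c, v, hv, y, rfl⟩ := h
      rw [symmLie_tmul, symmT_toTensor_mul _ _ hv, adAct, rightAct_zero]
    | zero => rw [map_zero]
    | add m n _ _ hm hn => rw [map_add, hm, hn, add_zero]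
    | neg m _ hm => rw [map_neg, hm, neg_zero]
  have key : fox A (toTensor A (lieProd a)) - (a 0 ⊗ₜ (word fun i => a i.succ) -
      a 1 ⊗ₜ word fun i => a (Equiv.swap 0 1 i.succ)) ∈ K := by
    induction n with
    | zero =>
      have h : fox A (toTensor A (lieProd a)) - (a 0 ⊗ₜ (word fun i => a i.succ) -
          a 1 ⊗ₜ word fun i => a (Equiv.swap 0 1 i.succ)) = 0 := by
        rw [lieProd_succ_succ, lieProd_one, fox_toTensor_lie_ι, toTensor_ι, fox_ι, mulGen_tmul,
          word_succ, word_succ, word_zero, word_zero, one_mul, mul_one, mul_one]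
        simp
      rw [h]
      exact zero_mem _
    | succ n ih =>
      have h1 := hK _ (ih fun i => a i.castSucc) (a (Fin.last _))
      have h2 : a (Fin.last _) ⊗ₜ toTensor A (lieProd fun i => a i.castSucc) ∈ K := by
        refine AddSubgroup.subset_closure ⟨_, lieProd fun i => a i.castSucc,
          mem_derivedSeries_one_of_mem_lieDeg (lieProd_mem _), 1, by rw [mul_one]⟩
      have h3 : (Equiv.swap (0 : Fin (n + 3)) 1) (Fin.last (n + 1)).succ = Fin.last (n + 2) := by
        rw [Equiv.swap_apply_of_ne_of_ne]
        · rfl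
        · exact Fin.succ_ne_zero _
        · simp [Fin.ext_iff]
      have h4 : ∀ i : Fin (n + 1), (Equiv.swap (0 : Fin (n + 3)) 1) i.castSucc.succ =
          ((Equiv.swap (0 : Fin (n + 2)) 1) i.succ).castSucc := by
        intro i
        cases i using Fin.cases with
        | zero => simp
        | succ i =>
          rw [Equiv.swap_apply_of_ne_of_ne, Equiv.swap_apply_of_ne_of_ne]
          · rfl
          all_goals simp [Fin.ext_iff]
      convert sub_mem h1 h2 using 1
      rw [lieProd_succ_succ, fox_toTensor_lie_ι, map_sub, map_sub, mulGen_tmul, mulGen_tmul,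
        word_succ_last, word_succ_last (fun i => a (Equiv.swap 0 1 i.succ)), h3]
      simp only [h4]
      simp only [Fin.succ_castSucc, Fin.succ_last, Fin.castSucc_zero]
      have h5 : ((1 : Fin (n + 2)).castSucc) = 1 := rfl
      rw [h5]
      abel
  have h := hK0 _ key
  rwa [map_sub, sub_eq_zero, map_sub] at h

theorem symmetrize_lieProd_eq_sum {n : ℕ} (a : Fin (n + 2) → A) :
    symmetrize (n + 1) (lieProd a) =
      (∑ σ : Equiv.Perm (Fin (n + 2)) with σ 0 = 0, lieProd (a ∘ σ)) -
        ∑ τ : Equiv.Perm (Fin (n + 2)) with τ 0 = 1, lieProd (a ∘ τ) := by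
  have h := symmLie_tmul_word (a ∘ Equiv.swap 0 1)
  rw [Function.comp_apply, Equiv.swap_apply_left] at h
  rw [symmetrize_lieProd, symmLie_tmul_word]
  congr 1
  refine h.trans ?_
  rw [Finset.sum_filter, Finset.sum_filter]
  refine Eq.trans ?_ (Equiv.sum_comp (Equiv.mulLeft (Equiv.swap (0 : Fin (n + 2)) 1))
    fun τ : Equiv.Perm (Fin (n + 2)) => if τ 0 = 1 then lieProd (a ∘ τ) else 0)
  refine Finset.sum_congr rfl fun σ _ => ?_
  have h1 : (Equiv.mulLeft (Equiv.swap (0 : Fin (n + 2)) 1) σ) 0 = 1 ↔ σ 0 = 0 := by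
    rw [Equiv.coe_mulLeft, Equiv.Perm.mul_apply, Equiv.swap_apply_eq_iff, Equiv.swap_apply_right]
  simp only [h1]
  rfl

end Words

/-! ### The symmetrization map on the metabelian Lie power -/

section ThetaLinear

variable {X A : Type*} [AddCommGroup A] [Module (MvPolynomial X ℤ) A]

theorem coe_X_smul (p : ℕ) (x : X) (u : liePower X A p) :
    (((MvPolynomial.X x : MvPolynomial X ℤ) • u : liePower X A p) : FreeLieRing A) =
      der (varOp X A x) (u : FreeLieRing A) :=
  X_smul x (u : FreeLieRing A)

theorem mk_eq_zero_iff {p : ℕ} (u : liePower X A p) :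
    (Submodule.Quotient.mk u : metabelianLiePower X A p) = 0 ↔
      (u : FreeLieRing A) ∈ derived₂ A :=
  Submodule.Quotient.mk_eq_zero _

/-- The homogeneous component of degree `p`, as an element of the Lie power. -/
def liePowerProj (X A : Type*) [AddCommGroup A] [Module (MvPolynomial X ℤ) A] (p : ℕ) :
    FreeLieRing A →+ liePower X A p :=
  AddMonoidHom.mk' (fun u => ⟨gradProj A p u, gradProj_mem p u⟩)
    fun u v => Subtype.ext (map_add (gradProj A p) u v)

theorem coe_liePowerProj (p : ℕ) (u : FreeLieRing A) :
    (liePowerProj X A p u : FreeLieRing A) = gradProj A p u := rfl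

theorem liePowerProj_coe {p : ℕ} (u : liePower X A p) :
    liePowerProj X A p (u : FreeLieRing A) = u := Subtype.ext (gradProj_of_mem u.2)

theorem liePowerProj_mem_augSub (p : ℕ) {u : FreeLieRing A} (hu : u ∈ lieAug X A) :
    liePowerProj X A p u ∈ augSub (varOp X (liePower X A p)) := by
  refine map_mem_augSub (liePowerProj X A p) (fun x v => Subtype.ext ?_) hu
  rw [varOp_apply, coe_X_smul, coe_liePowerProj, coe_liePowerProj]
  exact gradProj_der _ p v

theorem mem_augSub_liePower_iff {p : ℕ} (u : liePower X A p) :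
    u ∈ augSub (varOp X (liePower X A p)) ↔ (u : FreeLieRing A) ∈ lieAug X A := by
  refine ⟨fun h => ?_, fun h => ?_⟩
  · exact map_mem_augSub (f := varOp X (liePower X A p)) (f' := fun x : X =>
        (der (varOp X A x) : FreeLieRing A →ₗ[ℤ] FreeLieRing A).toAddMonoidHom)
      (liePower X A p).subtype.toAddMonoidHom (fun x n => coe_X_smul p x n) h
  · rw [← liePowerProj_coe u]
    exact liePowerProj_mem_augSub p h

theorem mk_mem_augSub_iff {p : ℕ} (u : liePower X A p) :
    (Submodule.Quotient.mk u : metabelianLiePower X A p) ∈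
      augSub (varOp X (metabelianLiePower X A p)) ↔
      ∃ w ∈ lieAug X A, (u : FreeLieRing A) - w ∈ derived₂ A := by
  let π : liePower X A p →+ metabelianLiePower X A p :=
    (Submodule.mkQ ((secondDerived X A).submoduleOf (liePower X A p))).toAddMonoidHom
  refine ⟨fun h => ?_, ?_⟩
  · have key : ∀ m ∈ augSub (varOp X (metabelianLiePower X A p)),
        ∃ w : liePower X A p, π w = m ∧ (w : FreeLieRing A) ∈ lieAug X A := by
      intro m hm
      induction hm using AddSubgroup.closure_induction with
      | mem m hm =>
        obtain ⟨x, m, rfl⟩ := hm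
        obtain ⟨v, rfl⟩ := Submodule.Quotient.mk_surjective _ m
        refine ⟨(MvPolynomial.X x : MvPolynomial X ℤ) • v, rfl, ?_⟩
        rw [coe_X_smul]
        exact der_mem_lieAug x _
      | zero => exact ⟨0, map_zero π, zero_mem _⟩
      | add m n _ _ hm hn =>
        obtain ⟨w, rfl, hw⟩ := hm
        obtain ⟨w', rfl, hw'⟩ := hn
        exact ⟨w + w', map_add π w w', add_mem hw hw'⟩
      | neg m _ hm =>
        obtain ⟨w, rfl, hw⟩ := hm
        exact ⟨-w, map_neg π w, neg_mem hw⟩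
    obtain ⟨w, hw, hw'⟩ := key _ h
    refine ⟨w, hw', ?_⟩
    rw [← Submodule.coe_sub, ← mk_eq_zero_iff, Submodule.Quotient.mk_sub, sub_eq_zero]
    exact hw.symm
  · rintro ⟨w, hw, h⟩
    have h1 : (Submodule.Quotient.mk u : metabelianLiePower X A p) = π (liePowerProj X A p w) := by
      rw [← sub_eq_zero]
      change (Submodule.Quotient.mk (u - liePowerProj X A p w) : metabelianLiePower X A p) = 0
      rw [mk_eq_zero_iff, ← liePowerProj_coe u, ← map_sub, coe_liePowerProj]
      exact gradProj_mem_derived₂ p h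
    rw [h1]
    exact map_mem_augSub π (fun x n => rfl) (liePowerProj_mem_augSub p hw)

theorem isSymmetrization_of_eq {n : ℕ} (hn : 2 ≤ n + 2)
    (θ : metabelianLiePower X A (n + 2) →+ liePower X A (n + 2))
    (hθ : ∀ u : liePower X A (n + 2), (n + 2) • (θ (Submodule.Quotient.mk u) : FreeLieRing A) =
      symmetrize (n + 1) (u : FreeLieRing A)) : IsSymmetrization hn θ := by
  intro a
  refine Subtype.ext ?_
  rw [AddSubgroupClass.coe_sub, AddSubmonoidClass.coe_finsetSum,
    AddSubmonoidClass.coe_finsetSum]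
  exact (hθ (lieMon X a)).trans (symmetrize_lieProd_eq_sum a)

theorem free_int_of_free [Module.Free (MvPolynomial X ℤ) A] : Module.Free ℤ A :=
  Module.Free.trans (S := MvPolynomial X ℤ)

variable [Module.Free (MvPolynomial X ℤ) A]

/-- The symmetrization map as a homomorphism of `U`-modules. -/
theorem exists_thetaLinear {p : ℕ} (hp : p.Prime) :
    ∃ θ : metabelianLiePower X A p →ₗ[MvPolynomial X ℤ] liePower X A p,
      (∀ u : liePower X A p, p • (θ (Submodule.Quotient.mk u) : FreeLieRing A) =
        symmetrize (p - 1) (u : FreeLieRing A)) ∧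
      ∀ u : liePower X A p,
        (Submodule.Quotient.mk (θ (Submodule.Quotient.mk u)) : metabelianLiePower X A p) =
          (p - 2).factorial • Submodule.Quotient.mk u := by
  have := free_int_of_free (X := X) (A := A)
  obtain ⟨θ₀, hθ₀⟩ := exists_theta (A := A) hp
  let θ₁ : liePower X A p →+ liePower X A p :=
    AddMonoidHom.mk' (fun u => ⟨θ₀ ⟨u, u.2⟩, (θ₀ ⟨u, u.2⟩).2⟩) fun u v =>
      Subtype.ext (congrArg Subtype.val (map_add θ₀ ⟨u, u.2⟩ ⟨v, v.2⟩))
  have hθ₁ : ∀ u : liePower X A p, (θ₁ u : FreeLieRing A) = θ₀ ⟨u, u.2⟩ := fun u => rfl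
  let θ₂ : liePower X A p →ₗ[MvPolynomial X ℤ] liePower X A p :=
    linearOfVarOp θ₁ fun x u => by
      refine Subtype.ext ?_
      rw [coe_X_smul, hθ₁, hθ₁, ← theta_der hp hθ₀]
      congr 2
      exact Subtype.ext (coe_X_smul p x u)
  let θ : metabelianLiePower X A p →ₗ[MvPolynomial X ℤ] liePower X A p :=
    Submodule.liftQ _ θ₂ fun u hu => by
      refine LinearMap.mem_ker.2 (Subtype.ext ?_)
      exact congrArg Subtype.val (theta_eq_zero hp hθ₀ ⟨u, u.2⟩ hu)
  have hθ : ∀ u : liePower X A p, θ (Submodule.Quotient.mk u) = θ₁ u := fun u => rfl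
  refine ⟨θ, fun u => ?_, fun u => ?_⟩
  · rw [hθ, hθ₁, hθ₀]
  · rw [hθ, ← sub_eq_zero]
    change (Submodule.Quotient.mk (θ₁ u - (p - 2).factorial • u) : metabelianLiePower X A p) = 0
    rw [mk_eq_zero_iff, Submodule.coe_sub, Submodule.coe_smul_of_tower, ← toMetab_eq, hθ₁,
      map_nsmul]
    exact toMetab_theta hp hθ₀ ⟨u, u.2⟩

theorem liePower_eq_of_nsmul_eq {p : ℕ} (hp : p.Prime) {u v : liePower X A p}
    (h : p • u = p • v) : u = v := by
  have := free_int_of_free (X := X) (A := A)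
  exact Subtype.ext (eq_of_nsmul_eq hp u.2 v.2 (congrArg Subtype.val h))

/-- The symmetrization map is determined by its values on the products `[a₁, …, aₚ]`. -/
theorem IsSymmetrization.eq {p : ℕ} (hp : p.Prime)
    {θ θ' : metabelianLiePower X A p →+ liePower X A p} (h : IsSymmetrization hp.two_le θ)
    (h' : IsSymmetrization hp.two_le θ') : θ = θ' := by
  ext1 m
  obtain ⟨⟨u, hu⟩, rfl⟩ := Submodule.Quotient.mk_surjective _ m
  induction hu using AddSubgroup.closure_induction with
  | mem u hu =>
    obtain ⟨a, rfl⟩ := hu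
    exact liePower_eq_of_nsmul_eq hp ((h a).trans (h' a).symm)
  | zero => exact (map_zero θ).trans (map_zero θ').symm
  | add u v hu hv ihu ihv =>
    exact (map_add θ (Submodule.Quotient.mk ⟨u, hu⟩) (Submodule.Quotient.mk ⟨v, hv⟩)).trans
      ((congrArg₂ (· + ·) ihu ihv).trans (map_add θ' _ _).symm)
  | neg u hu ihu =>
    exact (map_neg θ (Submodule.Quotient.mk ⟨u, hu⟩)).trans
      ((congrArg Neg.neg ihu).trans (map_neg θ' _).symm)

end ThetaLinear

/-! ### Torsion of the coinvariants -/

section Torsion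

variable {X A : Type*} [AddCommGroup A] [Module (MvPolynomial X ℤ) A]
  [Module.Free (MvPolynomial X ℤ) A]

theorem exists_zsmul_eq_zero_of_mem_torsion {G : Type*} [AddCommGroup G] {t : G}
    (ht : t ∈ AddCommGroup.torsion G) : ∃ k : ℤ, k ≠ 0 ∧ k • t = 0 := by
  obtain ⟨n, hn, h⟩ := isOfFinAddOrder_iff_nsmul_eq_zero.1 ht
  exact ⟨n, by omega, by rw [natCast_zsmul, h]⟩

theorem zsmul_zsmul_eq_self {G : Type*} [AddCommGroup G] {t : G} {a b c : ℤ} {p : ℕ}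
    (hab : a * c + b * p = 1) (h : p • t = 0) : a • c • t = t := by
  rw [← mul_smul, eq_sub_of_add_eq hab, sub_smul, one_smul, mul_smul, natCast_zsmul, h, smul_zero,
    sub_zero]

theorem mem_torsion_of_nsmul_eq_zero {G : Type*} [AddCommGroup G] {t : G} {n : ℕ} (hn : n ≠ 0)
    (h : n • t = 0) : t ∈ AddCommGroup.torsion G :=
  isOfFinAddOrder_iff_nsmul_eq_zero.2 ⟨n, Nat.pos_of_ne_zero hn, h⟩

theorem zsmul_tmul_one {M : Type*} [AddCommGroup M] [Module (MvPolynomial X ℤ) M] (k : ℤ) (m : M) :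
    k • (m ⊗ₜ[MvPolynomial X ℤ] (1 : ℤ)) = (k • m) ⊗ₜ 1 :=
  (map_zsmul (AddMonoidHom.mk' (fun m : M => m ⊗ₜ[MvPolynomial X ℤ] (1 : ℤ))
    fun m n => TensorProduct.add_tmul m n 1) k m).symm

theorem nsmul_tmul_one {M : Type*} [AddCommGroup M] [Module (MvPolynomial X ℤ) M] (k : ℕ) (m : M) :
    k • (m ⊗ₜ[MvPolynomial X ℤ] (1 : ℤ)) = (k • m) ⊗ₜ 1 :=
  (map_nsmul (AddMonoidHom.mk' (fun m : M => m ⊗ₜ[MvPolynomial X ℤ] (1 : ℤ))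
    fun m n => TensorProduct.add_tmul m n 1) k m).symm

/-- The torsion of the coinvariants of `L^p(A)` is annihilated by `p`. -/
theorem nsmul_liePower_tmul_one {p : ℕ} (u : liePower X A p)
    (hu : u ⊗ₜ[MvPolynomial X ℤ] (1 : ℤ) ∈ AddCommGroup.torsion _) :
    p • (u : FreeLieRing A) ∈ lieAug X A := by
  have := free_int_of_free (X := X) (A := A)
  obtain ⟨k, hk, h⟩ := exists_zsmul_eq_zero_of_mem_torsion hu
  rw [zsmul_tmul_one, tmul_one_eq_zero_iff, mem_augSub_liePower_iff] at h
  exact nsmul_mem_lieAug u.2 hk h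

/-- The torsion of the coinvariants of `M^p(A)` is annihilated by `p`. -/
theorem nsmul_eq_zero_of_mem_torsion {p : ℕ} (hp : p.Prime)
    {t : metabelianLiePower X A p ⊗[MvPolynomial X ℤ] ℤ} (ht : t ∈ AddCommGroup.torsion _) :
    p • t = 0 := by
  have := free_int_of_free (X := X) (A := A)
  obtain ⟨m, rfl⟩ := exists_tmul_one t
  obtain ⟨u, rfl⟩ := Submodule.Quotient.mk_surjective _ m
  obtain ⟨k, hk, h⟩ := exists_zsmul_eq_zero_of_mem_torsion ht
  rw [zsmul_tmul_one, tmul_one_eq_zero_iff, ← Submodule.Quotient.mk_smul, mk_mem_augSub_iff] at h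
  obtain ⟨w, hw, h⟩ := h
  rw [← natCast_zsmul, zsmul_tmul_one, tmul_one_eq_zero_iff, ← Submodule.Quotient.mk_smul,
    mk_mem_augSub_iff]
  obtain ⟨n, rfl⟩ : ∃ n, p = n + 2 := ⟨p - 2, by have := hp.two_le; omega⟩
  obtain ⟨w', hw', h'⟩ := exists_sub_mem_derived₂ u.2 hk hw h
  refine ⟨w', hw', ?_⟩
  rw [natCast_zsmul]
  exact h'

/-- On the torsion of the coinvariants of `L^p(A)`, the symmetrization map inverts the projection
onto `M^p(A)`, up to the factor `(p - 2)!`. -/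
theorem theta_tmul_one {p : ℕ} (hp : p.Prime)
    (θ : metabelianLiePower X A p →ₗ[MvPolynomial X ℤ] liePower X A p)
    (hθ : ∀ u : liePower X A p,
      (Submodule.Quotient.mk (θ (Submodule.Quotient.mk u)) : metabelianLiePower X A p) =
        (p - 2).factorial • Submodule.Quotient.mk u) (u : liePower X A p)
    (hu : u ⊗ₜ[MvPolynomial X ℤ] (1 : ℤ) ∈ AddCommGroup.torsion _) :
    θ (Submodule.Quotient.mk u) ⊗ₜ[MvPolynomial X ℤ] (1 : ℤ) =
      ((p - 2).factorial • u) ⊗ₜ[MvPolynomial X ℤ] (1 : ℤ) := by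
  have := free_int_of_free (X := X) (A := A)
  have hpu := nsmul_liePower_tmul_one u hu
  have h1 : p • u ∈ augSub (varOp X (liePower X A p)) := (mem_augSub_liePower_iff _).2 hpu
  have h2 : p • θ (Submodule.Quotient.mk u) ∈ augSub (varOp X (liePower X A p)) := by
    have h3 := map_mem_augSub (f := varOp X (liePower X A p)) (f' := varOp X (liePower X A p))
      (θ.comp (Submodule.mkQ _)).toAddMonoidHom (fun x n => map_smul (θ.comp (Submodule.mkQ _)) _ n)
      h1
    rw [map_nsmul] at h3
    exact h3
  set w : liePower X A p := θ (Submodule.Quotient.mk u) - (p - 2).factorial • u with hw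
  have h3 : (w : FreeLieRing A) ∈ derived₂ A := by
    rw [← mk_eq_zero_iff, hw, Submodule.Quotient.mk_sub, hθ, sub_eq_zero]; rfl
  have h4 : (p : ℤ) • (w : FreeLieRing A) ∈ lieAug X A := by
    have h5 : p • w ∈ augSub (varOp X (liePower X A p)) := by
      rw [hw, smul_sub, smul_comm]
      exact sub_mem h2 (nsmul_mem h1 _)
    rw [natCast_zsmul]
    exact (mem_augSub_liePower_iff _).1 h5
  have h5 : (w : FreeLieRing A) ∈ lieAug X A := by
    have h6 : IsWt 2 p (w : FreeLieRing A) := by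
      obtain ⟨n, rfl⟩ : ∃ n, p = n + 2 := ⟨p - 2, by have := hp.two_le; omega⟩
      exact isWt_two_of_mem_derived₂ w.2 h3
    obtain ⟨n, hn, h7⟩ := exists_coprime_smul_mem_lieAug hp le_rfl h6
      (Int.natCast_ne_zero.2 hp.ne_zero) h4
    exact mem_of_coprime_smul_mem _ hn h7 h4
  rw [← sub_eq_zero, ← TensorProduct.sub_tmul, tmul_one_eq_zero_iff]
  exact (mem_augSub_liePower_iff w).2 h5

/-- The symmetrization map induces an isomorphism between the torsion subgroups of the
coinvariants. -/
theorem exists_torsion_addEquiv {p : ℕ} (hp : p.Prime)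
    (θ : metabelianLiePower X A p →ₗ[MvPolynomial X ℤ] liePower X A p)
    (hθ : ∀ u : liePower X A p,
      (Submodule.Quotient.mk (θ (Submodule.Quotient.mk u)) : metabelianLiePower X A p) =
        (p - 2).factorial • Submodule.Quotient.mk u) :
    ∃ e : AddCommGroup.torsion (metabelianLiePower X A p ⊗[MvPolynomial X ℤ] ℤ) ≃+
        AddCommGroup.torsion (liePower X A p ⊗[MvPolynomial X ℤ] ℤ),
      ∀ t, (e t : liePower X A p ⊗[MvPolynomial X ℤ] ℤ) =
        θ.rTensor ℤ (t : metabelianLiePower X A p ⊗[MvPolynomial X ℤ] ℤ) := by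
  let f : metabelianLiePower X A p ⊗[MvPolynomial X ℤ] ℤ →+
      liePower X A p ⊗[MvPolynomial X ℤ] ℤ := (θ.rTensor ℤ).toAddMonoidHom
  have hf : ∀ m, f (m ⊗ₜ 1) = θ m ⊗ₜ 1 := fun m => rfl
  have hcop : IsCoprime ((p - 2).factorial : ℤ) (p : ℤ) :=
    Nat.isCoprime_iff_coprime.2 (hp.coprime_factorial_of_lt (by have := hp.pos; omega)).symm
  have htor : ∀ t ∈ AddCommGroup.torsion (metabelianLiePower X A p ⊗[MvPolynomial X ℤ] ℤ),
      f t ∈ AddCommGroup.torsion (liePower X A p ⊗[MvPolynomial X ℤ] ℤ) := fun t ht =>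
    mem_torsion_of_nsmul_eq_zero hp.ne_zero
      (by rw [← map_nsmul, nsmul_eq_zero_of_mem_torsion hp ht, map_zero])
  let g : AddCommGroup.torsion (metabelianLiePower X A p ⊗[MvPolynomial X ℤ] ℤ) →+
      AddCommGroup.torsion (liePower X A p ⊗[MvPolynomial X ℤ] ℤ) :=
    AddMonoidHom.mk' (fun t => ⟨f t, htor t t.2⟩) fun s t => Subtype.ext (map_add f _ _)
  have hg : Function.Bijective g := by
    constructor
    · refine (injective_iff_map_eq_zero g).2 ?_
      rintro ⟨t, ht⟩ h
      have h1 : f t = 0 := congrArg Subtype.val h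
      have h2 := nsmul_eq_zero_of_mem_torsion hp ht
      refine Subtype.ext (AddSubgroup.mem_bot.1 (mem_of_coprime_smul_mem ⊥ hcop ?_ ?_))
      · obtain ⟨m, rfl⟩ := exists_tmul_one t
        obtain ⟨u, rfl⟩ := Submodule.Quotient.mk_surjective _ m
        rw [zsmul_tmul_one, natCast_zsmul, ← hθ, AddSubgroup.mem_bot, tmul_one_eq_zero_iff]
        rw [hf, tmul_one_eq_zero_iff] at h1
        exact map_mem_augSub (Submodule.mkQ _).toAddMonoidHom (fun x n => rfl) h1
      · rw [AddSubgroup.mem_bot, natCast_zsmul, h2]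
    · rintro ⟨t, ht⟩
      obtain ⟨u, rfl⟩ := exists_tmul_one t
      have hpu := nsmul_liePower_tmul_one u ht
      have h1 : p • (u ⊗ₜ[MvPolynomial X ℤ] (1 : ℤ)) = 0 := by
        rw [nsmul_tmul_one, tmul_one_eq_zero_iff, mem_augSub_liePower_iff]
        exact hpu
      have h2 : p • ((Submodule.Quotient.mk u : metabelianLiePower X A p)
          ⊗ₜ[MvPolynomial X ℤ] (1 : ℤ)) = 0 := by
        rw [← natCast_zsmul, zsmul_tmul_one, tmul_one_eq_zero_iff, ← Submodule.Quotient.mk_smul,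
          mk_mem_augSub_iff]
        refine ⟨_, hpu, ?_⟩
        rw [natCast_zsmul]
        convert zero_mem (derived₂ A)
        exact sub_self _
      obtain ⟨a, b, hab⟩ := hcop
      refine ⟨⟨a • ((Submodule.Quotient.mk u : metabelianLiePower X A p)
          ⊗ₜ[MvPolynomial X ℤ] (1 : ℤ)), AddSubgroup.zsmul_mem _
            (mem_torsion_of_nsmul_eq_zero hp.ne_zero h2) a⟩, Subtype.ext ?_⟩
      change f (a • _) = _
      rw [map_zsmul, hf, theta_tmul_one hp θ hθ u ht, ← natCast_zsmul u, ← zsmul_tmul_one]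
      exact zsmul_zsmul_eq_self hab h1
  exact ⟨AddEquiv.ofBijective g hg, fun t => rfl⟩

end Torsion

end FreeLieRing

end

theorem proposition3p3 {X : Type*} [Finite X] {A : Type*} [AddCommGroup A]
    [Module (MvPolynomial X ℤ) A] [Module.Free (MvPolynomial X ℤ) A] {p : ℕ} (hp : p.Prime) :
    ∃ θ : FreeLieRing.metabelianLiePower X A p →ₗ[MvPolynomial X ℤ] FreeLieRing.liePower X A p,
      FreeLieRing.IsSymmetrization hp.two_le θ.toAddMonoidHom ∧
      (∀ θ' : FreeLieRing.metabelianLiePower X A p →+ FreeLieRing.liePower X A p,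
        FreeLieRing.IsSymmetrization hp.two_le θ' → θ' = θ.toAddMonoidHom) ∧
      ∃ e : AddCommGroup.torsion (FreeLieRing.metabelianLiePower X A p ⊗[MvPolynomial X ℤ] ℤ) ≃+
          AddCommGroup.torsion (FreeLieRing.liePower X A p ⊗[MvPolynomial X ℤ] ℤ),
        ∀ t, (e t : FreeLieRing.liePower X A p ⊗[MvPolynomial X ℤ] ℤ) =
          θ.rTensor ℤ (t : FreeLieRing.metabelianLiePower X A p ⊗[MvPolynomial X ℤ] ℤ) := by
  obtain ⟨θ, h1, h2⟩ := FreeLieRing.exists_thetaLinear (X := X) (A := A) hp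
  have h3 : FreeLieRing.IsSymmetrization hp.two_le θ.toAddMonoidHom := by
    obtain ⟨n, rfl⟩ : ∃ n, p = n + 2 := ⟨p - 2, by have := hp.two_le; omega⟩
    exact FreeLieRing.isSymmetrization_of_eq _ _ h1
  exact ⟨θ, h3, fun θ' h' => h'.eq hp h3, FreeLieRing.exists_torsion_addEquiv hp θ h2⟩
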